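/- **Theorem (Soundness).** Let $\mathcal P$ be a well-typed, alias-safe $\mu$SPARK program. In every terminating evaluation of $\mathcal P$ (of its procedure Main, from the empty store), at every sequence point that the evaluation reaches, in Main or in any procedure called, the statically computed access policy $\Pi$ for that point exists and is consistent, and it satisfies, together with the current binding $\Upsilon$ and store $\Sigma$, the Concurrent Read, Exclusive Write condition (CREW): for any two distinct valid paths $p\neq q$, $$\langle p\rangle^\Upsilon_\Sigma=\langle q\rangle^\Upsilon_\Sigma\ \wedge\ \Pi(p)\ge \mathsf W\ \Longrightarrow\ \Pi(q)=\mathsf{NO}.$$ *Language.* Types are scalar types, pointers `access τ`, and declared records. The field types of a record mention only records declared earlier, or the record itself behind a pointer. Paths are $x$, $p.f$, $p.\texttt{all}$. Expressions are paths, scalar constants, binary operators on scalars, addresses $p\texttt{'Access}$ and `null`. Statements are $p:=e$, $p:=\texttt{new }\tau$, `if`, `while`, and calls of (mutually recursive) procedures with `in`, `in-out`, `out` parameters and local variables; arguments for `in-out` and `out` are paths. Main has no parameters. Typing is standard. Sequence points are the points before and after statements. A path is valid if it is well-typed in the current procedure and evaluates to an address (no null dereference). *Semantics.* An address is a location followed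 by field names; a binding $\Upsilon$ maps variables to addresses, a store $\Sigma$ maps locations to values (scalars, addresses, null, records). $\langle x\rangle=\Upsilon(x)$, $\langle p.f\rangle=\langle p\rangle.f$, $\langle p.\texttt{all}\rangle=[\![p]\!]=\Sigma(\langle p\rangle)$ and $[\![p\texttt{'Access}]\!]=\langle p\rangle$; illicit operations block. Evaluation is big-step. Assignment copies a value; `new` stores a fresh location holding the default value (0, False, null, fieldwise). A call binds `in` parameters to fresh locations holding the argument values, other parameters to the addresses of the arguments, and locals to fresh locations with default values. Memory is never reclaimed. *Policies.* Permissions form the diamond $\mathsf{RW}>\mathsf R,\mathsf W>\mathsf{NO}$. A policy $\Pi$ is a partial map from paths to permissions, defined on the well-typed paths of a procedure. Consistent means: $\Pi(p)=\mathsf{RW}$ implies $\Pi(p.f)=\Pi(p.\texttt{all})=\mathsf{RW}$; $\Pi(p)=\mathsf R$ implies $\Pi(p.f)=\Pi(p.\texttt{all})=\mathsf R$; $\Pi(p)=\mathsf W$ implies $\Pi(p.f)\ge\mathsf W$ (whenever these paths are well-typed). A type or path is deep if a pointer can be reached from it (pointers themselves included), else shallow. An extension of $p$ is near if it has no more `all`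 than $p$, else far. *Transformers at a path $p$.* check $\pi$: requires $\Pi(p)\ge\pi$. fresh $\pi$: $p$ and all its extensions get $\pi$. cut: $p$ (if deep) and its near deep extensions get $\mathsf W$, near shallow ones are kept, far ones get $\mathsf{NO}$. block: nothing at a variable; at $p.\texttt{all}$, set $p$ to $\mathsf W$ and block at $p$; at $p.f$, stop if $\Pi(p)=\mathsf{NO}$, and if $\Pi(p)\ge\mathsf W$ set $p$ to $\mathsf W$ and block at $p$. drop: nothing at a variable; at $p.f$, set $p$ to $\mathsf{NO}$ and drop at $p$; at $p.\texttt{all}$, set $p$ to $\mathsf W$ and block at $p$. lift: nothing at a variable; at $p.\texttt{all}$, set $p$ to $\mathsf{RW}$ and lift at $p$; at $p.f$, do the same if all strict extensions of $p$ have $\mathsf{RW}$, else stop. borrow: $p$, its prefixes and extensions get $\mathsf{NO}$. freeze: these lose the write permission. *At an expression $e$.* check $\pi$: every path occurring in $e$ has permission $\ge\pi$. move: if $e$ is shallow, check $\mathsf R$; if $e$ is a deep path $p$, (check $\mathsf{RW}$; cut; block) at $p$; if $e=p\texttt{'Access}$, (check $\mathsf{RW}$; fresh $\mathsf{NO}$;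 drop) at $p$; nothing for null. observe: freeze at $p$ if $e$ is a deep path $p$ or $p\texttt{'Access}$; nothing otherwise. *Alias safety of statements ($\Pi\to\Pi'$).* $p:=e$: move at $e$, then (check $\mathsf W$; fresh $\mathsf{RW}$; lift) at $p$. $p:=\texttt{new }\tau$: check $\mathsf W$ at $p$, then (fresh $\mathsf W$; cut; block) at $p.\texttt{all}$. `if`: check $\mathsf R$ at the condition; $\Pi'$ is the pointwise meet of the policies after the two branches. `while`: check $\mathsf R$ at the condition; the policy after the body, analysed from $\Pi$, is pointwise $\ge\Pi$; and $\Pi'=\Pi$. Call: from $\Pi$, the chain (check $\mathsf R$; observe) at each `in` argument, (check $\mathsf{RW}$; borrow) at each `in-out` argument, (check $\mathsf W$; borrow) at each `out` argument must succeed; $\Pi'$ is obtained from $\Pi$ by (fresh $\mathsf{RW}$; lift) at each `in-out` and `out` argument. *Alias safety of programs.* A procedure is alias-safe if its body is alias-safe from the policy obtained from the empty one by fresh $\mathsf R$ at `in` parameters, fresh $\mathsf{RW}$ at `in-out` parameters, and (fresh $\mathsf W$; cut) at `out` parameters and locals, and if every `in-out` and `out` parameter has $\mathsf{RW}$ at the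 end of the body. A program is alias-safe if all its procedures are. The statically computed policy at a sequence point is the one that this analysis reaches there. -/

import Mathlib

namespace MuSpark

/-! ### Types, paths, expressions, statements, programs -/

abbrev Ident := String

/-- Scalar types. -/
inductive STy
  | int
  | real
  | bool
deriving DecidableEq

/-- Scalar constants. -/
inductive Scalar
  | int (n : ℤ)
  | real (x : ℝ)
  | bool (b : Bool)

def Scalar.ty : Scalar → STy
  | .int _ => .int
  | .real _ => .real
  | .bool _ => .bool

/-- Data types: scalar types, access (pointer) types and named record types. -/
inductive Ty
  | scalar (t : STy)
  | access (τ : Ty)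
  | record (R : Ident)
deriving DecidableEq

/-- A record type declaration, with its fields in order. -/
structure RecDecl where
  name : Ident
  fields : List (Ident × Ty)

/-- Paths: a variable, followed by record fields and by dereferences `.all`. -/
inductive Path
  | var (x : Ident)
  | field (p : Path) (f : Ident)
  | deref (p : Path)
deriving DecidableEq

/-- A binary operator on scalars: any typed, possibly partial, binary operation
(a partial one, such as a division, blocks the execution where it is undefined). -/
structure BinOp where
  dom₁ : STy
  dom₂ : STy
  cod : STy
  op : Scalar → Scalar → Option Scalar
  typed : ∀ a b c, a.ty = dom₁ → b.ty = dom₂ → op a b = some c → c.ty = cod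

/-- Expressions; `addrOf p` is the address expression `p'Access`. -/
inductive Expr
  | path (p : Path)
  | const (c : Scalar)
  | binop (o : BinOp) (e₁ e₂ : Expr)
  | addrOf (p : Path)
  | null

/-- Statements: `p := e`, `p := new τ`, conditional, while loop, procedure call. -/
inductive Stmt
  | assign (p : Path) (e : Expr)
  | alloc (p : Path) (τ : Ty)
  | ite (e : Expr) (s₁ s₂ : List Stmt)
  | loop (e : Expr) (s : List Stmt)
  | call (P : Ident) (args : List Expr)

/-- Parameter modes `in`, `in-out` and `out`. -/
inductive Mode
  | input
  | inout
  | output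
deriving DecidableEq

structure Param where
  name : Ident
  mode : Mode
  ty : Ty

structure Proc where
  name : Ident
  params : List Param
  locals : List (Ident × Ty)
  body : List Stmt

/-- A program: record declarations in order, procedures, and the name of the main procedure. -/
structure Program where
  records : List RecDecl
  procs : List Proc
  main : Ident

/-- The procedure declared under a given name. -/
def Program.proc? (prog : Program) (P : Ident) : Option Proc :=
  prog.procs.find? (fun pr => pr.name = P)

/-! ### Typing -/

/-- Typing contexts give the types of the parameters and local variables in scope. -/
abbrev Ctx := Ident → Option Ty

def Proc.ctx (pr : Proc) : Ctx := fun x =>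
  (pr.params.map (fun a => (a.name, a.ty)) ++ pr.locals).lookup x

/-- The type of field `f` in the record type `R`. -/
def fieldTy (D : List RecDecl) (R f : Ident) : Option Ty :=
  (D.find? (fun d => d.name = R)).bind (fun d => d.fields.lookup f)

/-- The type of a path, if it is well-typed. -/
def Path.ty (D : List RecDecl) (Γ : Ctx) : Path → Option Ty
  | .var x => Γ x
  | .field p f =>
    match Path.ty D Γ p with
    | some (.record R) => fieldTy D R f
    | _ => none
  | .deref p =>
    match Path.ty D Γ p with
    | some (.access τ) => some τ
    | _ => none

def Path.WellTyped (D : List RecDecl) (Γ : Ctx) (p : Path) : Prop :=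
  ∃ τ, p.ty D Γ = some τ

/-- Typing of expressions; `null` has every access type. -/
inductive HasType (D : List RecDecl) (Γ : Ctx) : Expr → Ty → Prop
  | path {p τ} : p.ty D Γ = some τ → HasType D Γ (.path p) τ
  | const {c} : HasType D Γ (.const c) (.scalar c.ty)
  | binop {o e₁ e₂} : HasType D Γ e₁ (.scalar o.dom₁) → HasType D Γ e₂ (.scalar o.dom₂) →
      HasType D Γ (.binop o e₁ e₂) (.scalar o.cod)
  | addrOf {p τ} : p.ty D Γ = some τ → HasType D Γ (.addrOf p) (.access τ)
  | null {τ} : HasType D Γ .null (.access τ)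

/-- Only record types from the list `known` occur in the type. -/
def Ty.WF (known : List Ident) : Ty → Prop
  | .scalar _ => True
  | .access τ => τ.WF known
  | .record R => R ∈ known

/-- The type of a field in the declaration of the record type `self`, when the record types in
`earlier` have been declared before: it may mention earlier record types, and it may contain
`self` behind a pointer. -/
def Ty.FieldOK (earlier : List Ident) (self : Ident) : Ty → Prop
  | .scalar _ => True
  | .access τ => τ.WF (self :: earlier)
  | .record R => R ∈ earlier

def RecordsOK (D : List RecDecl) : Prop :=
  (D.map RecDecl.name).Nodup ∧
  ∀ pre d post, D = pre ++ d :: post →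
    (d.fields.map Prod.fst).Nodup ∧
    ∀ fd ∈ d.fields, Ty.FieldOK (pre.map RecDecl.name) d.name fd.2

/-- An actual parameter fits a formal one: the types agree, and it is a path if the mode is
`in-out` or `out`. -/
def ArgOK (D : List RecDecl) (Γ : Ctx) (a : Param) (e : Expr) : Prop :=
  HasType D Γ e a.ty ∧ (a.mode ≠ .input → ∃ p, e = .path p)

inductive StmtOK (prog : Program) (Γ : Ctx) : Stmt → Prop
  | assign {p e τ} : p.ty prog.records Γ = some τ → HasType prog.records Γ e τ →
      StmtOK prog Γ (.assign p e)
  | alloc {p τ} : p.ty prog.records Γ = some (.access τ) → StmtOK prog Γ (.alloc p τ)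
  | ite {e s₁ s₂} : HasType prog.records Γ e (.scalar .bool) →
      (∀ s ∈ s₁, StmtOK prog Γ s) → (∀ s ∈ s₂, StmtOK prog Γ s) → StmtOK prog Γ (.ite e s₁ s₂)
  | loop {e s₁} : HasType prog.records Γ e (.scalar .bool) →
      (∀ s ∈ s₁, StmtOK prog Γ s) → StmtOK prog Γ (.loop e s₁)
  | call {P args pr} : prog.proc? P = some pr →
      List.Forall₂ (ArgOK prog.records Γ) pr.params args → StmtOK prog Γ (.call P args)

def ProcOK (prog : Program) (pr : Proc) : Prop :=
  (pr.params.map Param.name ++ pr.locals.map Prod.fst).Nodup ∧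
  (∀ a ∈ pr.params, a.ty.WF (prog.records.map RecDecl.name)) ∧
  (∀ d ∈ pr.locals, d.2.WF (prog.records.map RecDecl.name)) ∧
  ∀ s ∈ pr.body, StmtOK prog pr.ctx s

def Program.WellTyped (prog : Program) : Prop :=
  RecordsOK prog.records ∧
  (prog.procs.map Proc.name).Nodup ∧
  (∀ pr ∈ prog.procs, ProcOK prog pr) ∧
  ∃ pr, prog.proc? prog.main = some pr ∧ pr.params = []

/-! ### Values, stores, evaluation of paths and expressions -/

/-- Locations: an infinite set of names. -/
abbrev Loc := ℕ

/-- The address `ℓ.f₁. … .fₙ` of a component of the value at the location `ℓ`. -/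
structure Addr where
  loc : Loc
  flds : List Ident

def Addr.field (a : Addr) (f : Ident) : Addr := ⟨a.loc, a.flds ++ [f]⟩

inductive Value
  | scalar (c : Scalar)
  | addr (a : Addr)
  | null
  | record (fs : List (Ident × Value))

/-- The component of a value found under a list of field names. -/
def Value.get : Value → List Ident → Option Value
  | v, [] => some v
  | .record fs, f :: l =>
    match fs.lookup f with
    | some w => Value.get w l
    | none => none
  | _, _ :: _ => none

/-- Replacement of the component of a value found under a list of field names. -/
def Value.set : Value → List Ident → Value → Option Value
  | _, [], u => some u
  | .record fs, f :: l, u =>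
    match fs.lookup f with
    | some w => (Value.set w l u).map fun w' =>
        .record (fs.map fun gv => if gv.1 = f then (gv.1, w') else gv)
    | none => none
  | _, _ :: _, _ => none

/-- A binding maps variable names to addresses. -/
abbrev Binding := Ident → Option Addr

/-- A store maps locations to values. -/
abbrev Store := Loc → Option Value

def Store.read (σ : Store) (a : Addr) : Option Value :=
  (σ a.loc).bind fun v => v.get a.flds

/-- The update of the store at an address; undefined if there is nothing at that address. -/
def Store.write (σ : Store) (a : Addr) (v : Value) : Option Store :=
  ((σ a.loc).bind fun w => w.set a.flds v).map fun w' => Function.update σ a.loc (some w')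

/-- The address of a path; undefined if a null pointer is dereferenced. -/
def lval (β : Binding) (σ : Store) : Path → Option Addr
  | .var x => β x
  | .field p f => (lval β σ p).map fun a => a.field f
  | .deref p =>
    match (lval β σ p).bind (Store.read σ) with
    | some (.addr a) => some a
    | _ => none

def eval (β : Binding) (σ : Store) : Expr → Option Value
  | .path p => (lval β σ p).bind (Store.read σ)
  | .const c => some (.scalar c)
  | .binop o e₁ e₂ =>
    match eval β σ e₁, eval β σ e₂ with
    | some (.scalar c₁), some (.scalar c₂) => (o.op c₁ c₂).map Value.scalar
    | _, _ => none
  | .addrOf p => (lval β σ p).map Value.addr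
  | .null => some .null

def STy.default : STy → Scalar
  | .int => .int 0
  | .real => .real 0
  | .bool => .bool false

/-- Default values, for record declarations listed with the latest one first. -/
def defaultAux : List RecDecl → Ty → Value
  | _, .scalar t => .scalar t.default
  | _, .access _ => .null
  | [], .record _ => .record []
  | d :: ds, .record R =>
    if d.name = R then .record (d.fields.map fun fd => (fd.1, defaultAux ds fd.2))
    else defaultAux ds (.record R)

/-- The default value of a type. -/
def defaultValue (D : List RecDecl) (τ : Ty) : Value := defaultAux D.reverse τ

/-! ### Big-step semantics

The evaluation judgement also records the sequence points that the evaluation passes through. -/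

/-- Steps that lead to a sequence point inside a sequence of statements. -/
inductive Dir
  | next
  | thenBranch
  | elseBranch
  | loopBody
deriving DecidableEq

/-- A sequence point inside a sequence of statements. The empty list is the point at the start
of the sequence; `next` skips the first statement, and the other three steps enter a branch or
the body of the first statement. The point after a statement is the one that precedes the rest
of the sequence. -/
abbrev Pos := List Dir

/-- An arrival of the execution at the sequence point `pos` in the body of the procedure `proc`,
with the current binding and the current store. -/
structure Visit where
  proc : Ident
  pos : Pos
  bind : Binding
  store : Store

/-- Parameter passing. The arguments are evaluated in the caller's binding `β` and store `σ`;
an `in` parameter is bound to a fresh location that holds the value of the argument, the other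
parameters are bound to the addresses of the arguments. -/
inductive BindParams (β : Binding) (σ : Store) :
    List Param → List Expr → Binding → Store → Prop
  | nil : BindParams β σ [] [] (fun _ => none) σ
  | input {a ps e es β' σ' v ℓ} : BindParams β σ ps es β' σ' → a.mode = .input →
      eval β σ e = some v → σ' ℓ = none →
      BindParams β σ (a :: ps) (e :: es) (Function.update β' a.name (some ⟨ℓ, []⟩))
        (Function.update σ' ℓ (some v))
  | ref {a ps p es β' σ' ad} : BindParams β σ ps es β' σ' → a.mode ≠ .input →
      lval β σ p = some ad →
      BindParams β σ (a :: ps) (.path p :: es) (Function.update β' a.name (some ad)) σ'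

/-- Allocation of the local variables in fresh locations that hold default values. -/
inductive BindLocals (D : List RecDecl) :
    List (Ident × Ty) → Binding → Store → Binding → Store → Prop
  | nil {β σ} : BindLocals D [] β σ β σ
  | cons {d ds β σ β' σ' ℓ} : BindLocals D ds β σ β' σ' → σ' ℓ = none →
      BindLocals D (d :: ds) β σ (Function.update β' d.1 (some ⟨ℓ, []⟩))
        (Function.update σ' ℓ (some (defaultValue D d.2)))

mutual

/-- `EvalStmt prog P c β σ s T σ'`: the statement `s`, which stands right after the sequence
point `c` of the procedure `P`, terminates in the store `σ'` when it is evaluated under the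
binding `β` and the store `σ`, and `T` lists the sequence points passed in between. -/
inductive EvalStmt (prog : Program) :
    Ident → Pos → Binding → Store → Stmt → List Visit → Store → Prop
  | assign {P c β σ p e v a σ'} : eval β σ e = some v → lval β σ p = some a →
      σ.write a v = some σ' → EvalStmt prog P c β σ (.assign p e) [] σ'
  | alloc {P c β σ p τ ℓ a σ'} : σ ℓ = none → lval β σ p = some a →
      σ.write a (.addr ⟨ℓ, []⟩) = some σ' →
      EvalStmt prog P c β σ (.alloc p τ) []
        (Function.update σ' ℓ (some (defaultValue prog.records τ)))
  | ifTrue {P c β σ e s₁ s₂ T σ'} : eval β σ e = some (.scalar (.bool true)) →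
      EvalSeq prog P (c ++ [.thenBranch]) β σ s₁ T σ' →
      EvalStmt prog P c β σ (.ite e s₁ s₂) T σ'
  | ifFalse {P c β σ e s₁ s₂ T σ'} : eval β σ e = some (.scalar (.bool false)) →
      EvalSeq prog P (c ++ [.elseBranch]) β σ s₂ T σ' →
      EvalStmt prog P c β σ (.ite e s₁ s₂) T σ'
  | whileTrue {P c β σ e s T₁ σ₁ T₂ σ'} : eval β σ e = some (.scalar (.bool true)) →
      EvalSeq prog P (c ++ [.loopBody]) β σ s T₁ σ₁ →
      EvalStmt prog P c β σ₁ (.loop e s) T₂ σ' →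
      EvalStmt prog P c β σ (.loop e s) (T₁ ++ ⟨P, c, β, σ₁⟩ :: T₂) σ'
  | whileFalse {P c β σ e s} : eval β σ e = some (.scalar (.bool false)) →
      EvalStmt prog P c β σ (.loop e s) [] σ
  | call {P c β σ Q args pr β₁ σ₁ βQ σQ T σ'} : prog.proc? Q = some pr →
      BindParams β σ pr.params args β₁ σ₁ →
      BindLocals prog.records pr.locals β₁ σ₁ βQ σQ →
      EvalSeq prog Q [] βQ σQ pr.body T σ' →
      EvalStmt prog P c β σ (.call Q args) T σ'

/-- Evaluation of the sequence of statements that starts at the sequence point `c` of the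
procedure `P`. -/
inductive EvalSeq (prog : Program) :
    Ident → Pos → Binding → Store → List Stmt → List Visit → Store → Prop
  | nil {P c β σ} : EvalSeq prog P c β σ [] [⟨P, c, β, σ⟩] σ
  | cons {P c β σ s ss T₁ σ₁ T₂ σ'} : EvalStmt prog P c β σ s T₁ σ₁ →
      EvalSeq prog P (c ++ [.next]) β σ₁ ss T₂ σ' →
      EvalSeq prog P c β σ (s :: ss) (⟨P, c, β, σ⟩ :: T₁ ++ T₂) σ'

end

/-- A terminating evaluation of the program: the main procedure, which has no parameters, is
executed from the empty store; `T` lists all the sequence points passed, in all procedures. -/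
def Program.Terminates (prog : Program) (T : List Visit) (σ' : Store) : Prop :=
  ∃ pr β σ, prog.proc? prog.main = some pr ∧ pr.params = [] ∧
    BindLocals prog.records pr.locals (fun _ => none) (fun _ => none) β σ ∧
    EvalSeq prog prog.main [] β σ pr.body T σ'

/-! ### Permissions, access policies, permission transformers -/

/-- A permission: whether one may read, and whether one may write. With the componentwise order
these form the diamond lattice `RW > R | W > NO`. -/
abbrev Perm := Bool × Bool

def Perm.NO : Perm := (false, false)
def Perm.RO : Perm := (true, false)
def Perm.WO : Perm := (false, true)
def Perm.RW : Perm := (true, true)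

/-- Access policies: partial functions from paths to permissions. -/
abbrev Policy := Path → Option Perm

/-- The policy gives the path `p` at least the permission `π`. -/
def Policy.AtLeast (Θ : Policy) (p : Path) (π : Perm) : Prop := ∃ π', Θ p = some π' ∧ π ≤ π'

/-- `Path.Ext p q`: the path `q` is equal to `p` or is a strict extension of `p`. -/
inductive Path.Ext : Path → Path → Prop
  | refl {p} : Path.Ext p p
  | field {p q f} : Path.Ext p q → Path.Ext p (.field q f)
  | deref {p q} : Path.Ext p q → Path.Ext p (.deref q)

/-- The number of pointer dereferences in a path. An extension is near if it has as many of
them, and far otherwise. -/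
def Path.derefs : Path → ℕ
  | .var _ => 0
  | .field p _ => p.derefs
  | .deref p => p.derefs + 1

/-- Deep types: a pointer can be reached from their values. Other types are shallow. -/
inductive Ty.Deep (D : List RecDecl) : Ty → Prop
  | access {τ} : Ty.Deep D (.access τ)
  | record {R f τ} : fieldTy D R f = some τ → Ty.Deep D τ → Ty.Deep D (.record R)

def Path.Deep (D : List RecDecl) (Γ : Ctx) (p : Path) : Prop :=
  ∃ τ, p.ty D Γ = some τ ∧ τ.Deep D

/-- The expression has a shallow type. -/
def Expr.Shallow (D : List RecDecl) (Γ : Ctx) (e : Expr) : Prop :=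
  ∃ τ, HasType D Γ e τ ∧ ¬ τ.Deep D

/-- The paths that occur as sub-expressions in an expression. -/
def Expr.paths : Expr → List Path
  | .path p => [p]
  | .const _ => []
  | .binop _ e₁ e₂ => e₁.paths ++ e₂.paths
  | .addrOf p => [p]
  | .null => []

/-- A transformer of policies at an object of type `α` (a path, an expression). -/
abbrev Transf (α : Type) := α → Policy → Policy → Prop

/-- First `S`, then `T`, both at the same object. -/
def Transf.comp {α : Type} (S T : Transf α) : Transf α :=
  fun a Θ Θ' => ∃ Θ₁, S a Θ Θ₁ ∧ T a Θ₁ Θ'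

/-- The transformer applied to all the objects in a list, from left to right. -/
inductive Transf.Chain {α : Type} (T : Transf α) : List α → Policy → Policy → Prop
  | nil {Θ} : Transf.Chain T [] Θ Θ
  | cons {a l Θ Θ₁ Θ'} : T a Θ Θ₁ → Transf.Chain T l Θ₁ Θ' → Transf.Chain T (a :: l) Θ Θ'

def checkP (π : Perm) : Transf Path := fun p Θ Θ' => Θ.AtLeast p π ∧ Θ' = Θ

def checkE (π : Perm) : Transf Expr :=
  fun e Θ Θ' => (∀ p ∈ e.paths, Θ.AtLeast p π) ∧ Θ' = Θ

open Classical in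
/-- Assigns `π` to the path and to all its (well-typed) extensions. -/
noncomputable def freshFun (D : List RecDecl) (Γ : Ctx) (π : Perm) (p : Path) (Θ : Policy) :
    Policy :=
  fun q => if p.Ext q ∧ q.WellTyped D Γ then some π else Θ q

def fresh (D : List RecDecl) (Γ : Ctx) (π : Perm) : Transf Path :=
  fun p Θ Θ' => Θ' = freshFun D Γ π p Θ

open Classical in
/-- The path and its near deep extensions receive `W`, near shallow extensions keep their
permissions, far extensions receive `NO`. (A shallow path has no far extension and no deep one,
so that nothing changes there.) -/
noncomputable def cutFun (D : List RecDecl) (Γ : Ctx) (p : Path) (Θ : Policy) : Policy :=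
  fun q =>
    if p.Ext q ∧ q.WellTyped D Γ then
      if q.derefs = p.derefs then
        if q.Deep D Γ then some Perm.WO else Θ q
      else some Perm.NO
    else Θ q

def cut (D : List RecDecl) (Γ : Ctx) : Transf Path := fun p Θ Θ' => Θ' = cutFun D Γ p Θ

def Policy.set (Θ : Policy) (p : Path) (π : Perm) : Policy := Function.update Θ p (some π)

/-- Loss of the read permission for the prefixes. -/
inductive block : Transf Path
  | var {x Θ} : block (.var x) Θ Θ
  | deref {p Θ Θ'} : block p (Θ.set p Perm.WO) Θ' → block (.deref p) Θ Θ'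
  | fieldStop {p f Θ} : Θ p = some Perm.NO → block (.field p f) Θ Θ
  | field {p f Θ Θ'} : Θ.AtLeast p Perm.WO → block p (Θ.set p Perm.WO) Θ' →
      block (.field p f) Θ Θ'

/-- Loss of both permissions for the prefixes up to the first pointer, and of the read
permission afterwards. -/
inductive drop : Transf Path
  | var {x Θ} : drop (.var x) Θ Θ
  | deref {p Θ Θ'} : block p (Θ.set p Perm.WO) Θ' → drop (.deref p) Θ Θ'
  | field {p f Θ Θ'} : drop p (Θ.set p Perm.NO) Θ' → drop (.field p f) Θ Θ'

/-- All strict well-typed extensions of the path have the permission `RW`. -/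
def Policy.AllRW (D : List RecDecl) (Γ : Ctx) (Θ : Policy) (p : Path) : Prop :=
  ∀ q, p.Ext q → q ≠ p → q.WellTyped D Γ → Θ q = some Perm.RW

/-- Propagation of `RW` to the prefixes, wherever possible. -/
inductive lift (D : List RecDecl) (Γ : Ctx) : Transf Path
  | var {x Θ} : lift D Γ (.var x) Θ Θ
  | deref {p Θ Θ'} : lift D Γ p (Θ.set p Perm.RW) Θ' → lift D Γ (.deref p) Θ Θ'
  | field {p f Θ Θ'} : Θ.AllRW D Γ p → lift D Γ p (Θ.set p Perm.RW) Θ' →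
      lift D Γ (.field p f) Θ Θ'
  | fieldStop {p f Θ} : ¬ Θ.AllRW D Γ p → lift D Γ (.field p f) Θ Θ

/-- Ownership transfer from the right-hand side of an assignment. -/
inductive move (D : List RecDecl) (Γ : Ctx) : Transf Expr
  | shallow {e Θ Θ'} : e.Shallow D Γ → checkE Perm.RO e Θ Θ' → move D Γ e Θ Θ'
  | deepPath {p Θ Θ'} : p.Deep D Γ →
      ((checkP Perm.RW).comp ((cut D Γ).comp block)) p Θ Θ' → move D Γ (.path p) Θ Θ'
  | addrOf {p Θ Θ'} : ((checkP Perm.RW).comp ((fresh D Γ Perm.NO).comp drop)) p Θ Θ' →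
      move D Γ (.addrOf p) Θ Θ'
  | null {Θ} : move D Γ .null Θ Θ

/-- One of the two paths is an extension of the other, or they are equal. -/
def Path.Comparable (p q : Path) : Prop := p.Ext q ∨ q.Ext p

open Classical in
/-- `NO` for the path, its prefixes and its extensions. -/
noncomputable def borrowFun (D : List RecDecl) (Γ : Ctx) (p : Path) (Θ : Policy) : Policy :=
  fun q => if p.Comparable q ∧ q.WellTyped D Γ then some Perm.NO else Θ q

def borrow (D : List RecDecl) (Γ : Ctx) : Transf Path := fun p Θ Θ' => Θ' = borrowFun D Γ p Θ

open Classical in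
/-- Removal of the write permission from the path, its prefixes and its extensions. -/
noncomputable def freezeFun (p : Path) (Θ : Policy) : Policy :=
  fun q => if p.Comparable q then (Θ q).map (fun π => π ⊓ Perm.RO) else Θ q

def freeze : Transf Path := fun p Θ Θ' => Θ' = freezeFun p Θ

/-- Sharing of an `in` argument. -/
inductive observe (D : List RecDecl) (Γ : Ctx) : Transf Expr
  | shallow {e Θ} : e.Shallow D Γ → observe D Γ e Θ Θ
  | deepPath {p Θ Θ'} : p.Deep D Γ → freeze p Θ Θ' → observe D Γ (.path p) Θ Θ'
  | addrOf {p Θ Θ'} : freeze p Θ Θ' → observe D Γ (.addrOf p) Θ Θ'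
  | null {Θ} : observe D Γ .null Θ Θ

/-! ### Alias safety -/

/-- The actual parameters that are passed for the formal parameters of a given mode. -/
def argsOf (m : Mode) (ps : List Param) (es : List Expr) : List Expr :=
  (ps.zip es).filterMap fun ae => if ae.1.mode = m then some ae.2 else none

def Expr.path? : Expr → Option Path
  | .path p => some p
  | _ => none

def refArgsOf (m : Mode) (ps : List Param) (es : List Expr) : List Path :=
  (argsOf m ps es).filterMap Expr.path?

mutual

/-- `SafeStmt prog Γ Θ s Θ'`: the statement `s` is alias-safe with respect to the policy `Θ` and
yields the policy `Θ'`. -/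
inductive SafeStmt (prog : Program) (Γ : Ctx) : Policy → Stmt → Policy → Prop
  | assign {Θ p e Θ₁ Θ'} : move prog.records Γ e Θ Θ₁ →
      ((checkP Perm.WO).comp ((fresh prog.records Γ Perm.RW).comp (lift prog.records Γ)))
        p Θ₁ Θ' →
      SafeStmt prog Γ Θ (.assign p e) Θ'
  | alloc {Θ p τ Θ₁ Θ'} : checkP Perm.WO p Θ Θ₁ →
      ((fresh prog.records Γ Perm.WO).comp ((cut prog.records Γ).comp block)) (.deref p) Θ₁ Θ' →
      SafeStmt prog Γ Θ (.alloc p τ) Θ'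
  | ite {Θ e s₁ s₂ Θ₁ Θ₂ Θ'} : checkE Perm.RO e Θ Θ →
      SafeSeq prog Γ Θ s₁ Θ₁ → SafeSeq prog Γ Θ s₂ Θ₂ →
      (∀ p, Θ' p = Option.map₂ (fun π₁ π₂ => π₁ ⊓ π₂) (Θ₁ p) (Θ₂ p)) →
      SafeStmt prog Γ Θ (.ite e s₁ s₂) Θ'
  | loop {Θ e s Θ'} : checkE Perm.RO e Θ Θ → SafeSeq prog Γ Θ s Θ' →
      (∀ p π, Θ p = some π → Θ'.AtLeast p π) →
      SafeStmt prog Γ Θ (.loop e s) Θ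
  | call {Θ P args pr Θ₁ Θ₂ Θ₃ Θ'} : prog.proc? P = some pr →
      ((checkE Perm.RO).comp (observe prog.records Γ)).Chain
        (argsOf .input pr.params args) Θ Θ₁ →
      ((checkP Perm.RW).comp (borrow prog.records Γ)).Chain
        (refArgsOf .inout pr.params args) Θ₁ Θ₂ →
      ((checkP Perm.WO).comp (borrow prog.records Γ)).Chain
        (refArgsOf .output pr.params args) Θ₂ Θ₃ →
      ((fresh prog.records Γ Perm.RW).comp (lift prog.records Γ)).Chain
        (refArgsOf .inout pr.params args ++ refArgsOf .output pr.params args) Θ Θ' →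
      SafeStmt prog Γ Θ (.call P args) Θ'

/-- Alias safety of a sequence of statements. -/
inductive SafeSeq (prog : Program) (Γ : Ctx) : Policy → List Stmt → Policy → Prop
  | nil {Θ} : SafeSeq prog Γ Θ [] Θ
  | cons {Θ s ss Θ₁ Θ'} : SafeStmt prog Γ Θ s Θ₁ → SafeSeq prog Γ Θ₁ ss Θ' →
      SafeSeq prog Γ Θ (s :: ss) Θ'

end

/-- The variables of the parameters of a given mode, as paths. -/
def Proc.paramPaths (pr : Proc) (m : Mode) : List Path :=
  (pr.params.filter fun a => a.mode = m).map fun a => .var a.name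

def Proc.localPaths (pr : Proc) : List Path := pr.locals.map fun d => .var d.1

/-- The policy at the start of a procedure body, built up from the empty policy. -/
def InitPolicy (D : List RecDecl) (pr : Proc) (Θ : Policy) : Prop :=
  ∃ Θ₁ Θ₂ Θ₃,
    (fresh D pr.ctx Perm.RO).Chain (pr.paramPaths .input) (fun _ => none) Θ₁ ∧
    (fresh D pr.ctx Perm.RW).Chain (pr.paramPaths .inout) Θ₁ Θ₂ ∧
    ((fresh D pr.ctx Perm.WO).comp (cut D pr.ctx)).Chain (pr.paramPaths .output) Θ₂ Θ₃ ∧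
    ((fresh D pr.ctx Perm.WO).comp (cut D pr.ctx)).Chain pr.localPaths Θ₃ Θ

def Proc.AliasSafe (prog : Program) (pr : Proc) : Prop :=
  ∃ Θ Θ', InitPolicy prog.records pr Θ ∧ SafeSeq prog pr.ctx Θ pr.body Θ' ∧
    ∀ p ∈ pr.paramPaths .inout ++ pr.paramPaths .output, Θ' p = some Perm.RW

def Program.AliasSafe (prog : Program) : Prop := ∀ pr ∈ prog.procs, pr.AliasSafe prog

/-- `PolicyIn prog Γ Θ ss c Θ'`: when the sequence `ss` is analysed from the policy `Θ`, the
policy computed for its sequence point `c` is `Θ'`. -/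
inductive PolicyIn (prog : Program) (Γ : Ctx) : Policy → List Stmt → Pos → Policy → Prop
  | here {Θ ss} : PolicyIn prog Γ Θ ss [] Θ
  | next {Θ s ss c Θ₁ Θ'} : SafeStmt prog Γ Θ s Θ₁ → PolicyIn prog Γ Θ₁ ss c Θ' →
      PolicyIn prog Γ Θ (s :: ss) (.next :: c) Θ'
  | thenBranch {Θ e s₁ s₂ ss c Θ'} : PolicyIn prog Γ Θ s₁ c Θ' →
      PolicyIn prog Γ Θ (.ite e s₁ s₂ :: ss) (.thenBranch :: c) Θ'
  | elseBranch {Θ e s₁ s₂ ss c Θ'} : PolicyIn prog Γ Θ s₂ c Θ' →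
      PolicyIn prog Γ Θ (.ite e s₁ s₂ :: ss) (.elseBranch :: c) Θ'
  | loopBody {Θ e s ss c Θ'} : PolicyIn prog Γ Θ s c Θ' →
      PolicyIn prog Γ Θ (.loop e s :: ss) (.loopBody :: c) Θ'

/-- The access policy computed for the sequence point `c` in the body of the procedure `pr`. -/
def PolicyAt (prog : Program) (pr : Proc) (c : Pos) (Θ' : Policy) : Prop :=
  ∃ Θ, InitPolicy prog.records pr Θ ∧ PolicyIn prog pr.ctx Θ pr.body c Θ'

/-! ### Consistency and the CREW condition -/

/-- Consistency of a policy on the well-typed paths. -/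
def Policy.Consistent (D : List RecDecl) (Γ : Ctx) (Θ : Policy) : Prop :=
  (∀ p f, (Path.field p f).WellTyped D Γ →
    (Θ p = some Perm.RW → Θ (.field p f) = some Perm.RW) ∧
    (Θ p = some Perm.RO → Θ (.field p f) = some Perm.RO) ∧
    (Θ p = some Perm.WO → Θ.AtLeast (.field p f) Perm.WO)) ∧
  (∀ p, (Path.deref p).WellTyped D Γ →
    (Θ p = some Perm.RW → Θ (.deref p) = some Perm.RW) ∧
    (Θ p = some Perm.RO → Θ (.deref p) = some Perm.RO))

/-- The Concurrent Read, Exclusive Write condition: whenever two distinct well-typed paths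
evaluate to the same address and one of them may be written, the other has no permission. -/
def CREW (D : List RecDecl) (Γ : Ctx) (Θ : Policy) (β : Binding) (σ : Store) : Prop :=
  ∀ p q, p ≠ q → p.WellTyped D Γ → q.WellTyped D Γ →
    ∀ a, lval β σ p = some a → lval β σ q = some a →
      Θ.AtLeast p Perm.WO → Θ q = some Perm.NO

end MuSpark

/-!
Soundness of the alias analysis of μSPARK. The proof keeps an invariant `Inv` at every sequence
point of an evaluation: the store and the binding are well-typed, the policy is regular (`Good`),
and the readable or writable paths are separated in memory: a writable path has the address of no
other readable or writable path. The CREW condition follows (`Inv.crew`).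

Separation is only asked of paths whose type has no fields (`Path.Leaf`): scalars, pointers and
records without fields. Changes of the permissions of enclosing records, by `block`, `drop` and
`lift`, then never matter for it, and nothing is lost, since two paths with the same address extend
by the same fields to two such paths with the same address. Only the paths below `in` parameters have
exactly the permission `R`. They are never written in a body, so they need no separation from one
another.

`Good` says that `RW` is inherited by all extensions, writability by all fields, that a path below
an `in` parameter has exactly `R` and any other path has `NO` or is writable, and that all pointers on
the way to a writable path are writable. The last condition is what makes separation useful: a
write to a path changes the meaning only of paths that pass through a pointer in the written object,
and by separation such an accessible path extends the written one. Hence the evaluation of the other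
accessible paths is unaffected (`Inv.lval_eq`).

* Assignment (`assign_inv`): below the assigned path, the new store shows what was found before the
  assignment below the moved path, which has been given up. An injective renaming of paths thus
  carries separation over.
* Allocation (`alloc_inv`): paths into the new location differ in address from all old ones.
* Call: the callee starts in a separated state, since each accessible address is that of a fresh
  location or of an accessible extension of an argument (`Origin`), and the checks with `borrow` and
  `observe` keep the arguments apart (`args_safe`, `call_entry`). For the return (`call_return`), the
  invariant is combined with a frame property (`Frame`): an evaluation changes pointers only at
  addresses of writable paths, the `Footprint`, which grows by new locations only. So the paths of
  the caller that are not below an argument are unaffected, and those below an argument are seen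
  through a parameter, which has `RW` at the end of the callee.
* Conditionals and loops: the policy afterwards allows no more than the one reached, and the
  invariant is antitone in the set of writable paths (`Inv.weaken`). For the branch not taken,
  regularity of its final policy is obtained from the analysis alone (`SafeSeq.good`).

The analysis is deterministic (`PolicyAt.det`), so the policy in the invariant is the only one
computed for the sequence point.
-/

namespace MuSpark

/-! ### Paths as sequences of selectors -/

/-- A step from a path to a longer one: `some f` selects the field `f`, `none` dereferences. -/
abbrev Sel := Option Ident

/-- The extension of a path by one selector. -/
def Path.step (p : Path) : Sel → Path
  | some f => .field p f
  | none => .deref p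

/-- The extension of a path by a list of selectors. -/
def Path.app (p : Path) (w : List Sel) : Path := w.foldl Path.step p

/-- The near extension of a path by a list of field names. -/
def Path.sub (p : Path) (l : List Ident) : Path := p.app (l.map some)

/-- The variable at which a path starts. -/
def Path.root : Path → Ident
  | .var x => x
  | .field p _ => p.root
  | .deref p => p.root

/-- The number of selectors of a path. -/
def Path.depth : Path → ℕ
  | .var _ => 0
  | .field p _ => p.depth + 1
  | .deref p => p.depth + 1

theorem Path.app_nil (p : Path) : p.app [] = p := rfl

theorem Path.app_cons (p : Path) (s : Sel) (w : List Sel) : p.app (s :: w) = (p.step s).app w := rfl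

theorem Path.app_append (p : Path) (w w' : List Sel) : p.app (w ++ w') = (p.app w).app w' := by
  simp [Path.app]

theorem Path.app_snoc (p : Path) (w : List Sel) (s : Sel) :
    p.app (w ++ [s]) = (p.app w).step s := by
  rw [Path.app_append]; rfl

theorem Path.depth_step (p : Path) (s : Sel) : (p.step s).depth = p.depth + 1 := by
  cases s <;> rfl

theorem Path.depth_app (p : Path) (w : List Sel) : (p.app w).depth = p.depth + w.length := by
  induction w generalizing p with
  | nil => rfl
  | cons s w ih => rw [Path.app_cons, ih, Path.depth_step, List.length_cons]; omega

theorem Path.step_inj {p q : Path} {s t : Sel} : p.step s = q.step t ↔ p = q ∧ s = t := by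
  cases s <;> cases t <;> simp [Path.step]

theorem Path.app_inj {p : Path} {w w' : List Sel} (h : p.app w = p.app w') : w = w' := by
  induction w using List.reverseRecOn generalizing w' with
  | nil =>
    have := congrArg Path.depth h
    rw [Path.depth_app, Path.depth_app] at this
    simp at this
    simp [this]
  | append_singleton w s ih =>
    cases w' using List.reverseRecOn with
    | nil =>
      have := congrArg Path.depth h
      rw [Path.depth_app, Path.depth_app] at this
      simp at this
    | append_singleton w' s' =>
      rw [Path.app_snoc, Path.app_snoc, Path.step_inj] at h
      rw [ih h.1, h.2]

theorem Path.Ext.step {p q : Path} (h : p.Ext q) (s : Sel) : p.Ext (q.step s) := by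
  cases s
  · exact h.deref
  · exact h.field

theorem Path.ext_app (p : Path) (w : List Sel) : p.Ext (p.app w) := by
  induction w using List.reverseRecOn with
  | nil => exact .refl
  | append_singleton w s ih => rw [Path.app_snoc]; exact ih.step s

theorem Path.Ext.exists_app {p q : Path} (h : p.Ext q) : ∃ w, q = p.app w := by
  induction h with
  | refl => exact ⟨[], rfl⟩
  | @field q f _ ih =>
    obtain ⟨w, rfl⟩ := ih
    exact ⟨w ++ [some f], by rw [Path.app_snoc]; rfl⟩
  | deref _ ih =>
    obtain ⟨w, rfl⟩ := ih
    exact ⟨w ++ [none], by rw [Path.app_snoc]; rfl⟩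

theorem Path.Ext.trans {p q r : Path} (h : p.Ext q) (h' : q.Ext r) : p.Ext r := by
  obtain ⟨w, rfl⟩ := h.exists_app
  obtain ⟨w', rfl⟩ := h'.exists_app
  rw [← Path.app_append]
  exact Path.ext_app _ _

theorem Path.Ext.depth_le {p q : Path} (h : p.Ext q) : p.depth ≤ q.depth := by
  obtain ⟨w, rfl⟩ := h.exists_app
  rw [Path.depth_app]; omega

theorem Path.Ext.eq_of_depth {p q : Path} (h : p.Ext q) (hd : q.depth ≤ p.depth) : q = p := by
  obtain ⟨w, rfl⟩ := h.exists_app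
  rw [Path.depth_app] at hd
  have : w = [] := List.length_eq_zero_iff.1 (by omega)
  rw [this, Path.app_nil]

theorem Path.ext_step_iff {p q : Path} {s : Sel} : p.Ext (q.step s) ↔ p = q.step s ∨ p.Ext q := by
  constructor
  · intro h
    obtain ⟨w, hw⟩ := h.exists_app
    cases w using List.reverseRecOn with
    | nil => exact .inl hw.symm
    | append_singleton w t =>
      rw [Path.app_snoc, Path.step_inj] at hw
      rw [hw.1]
      exact .inr (Path.ext_app _ _)
  · rintro (h | h)
    · rw [← h]; exact .refl
    · exact h.step s

/-- Two prefixes of one path are comparable. -/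
theorem Path.comparable_of_ext {p q r : Path} (hp : p.Ext r) (hq : q.Ext r) :
    p.Comparable q := by
  induction hp with
  | refl => exact .inr hq
  | @field r f hr ih =>
    rcases (Path.ext_step_iff (s := some f)).1 hq with h | h
    · exact .inl (h ▸ hr.field)
    · exact ih h
  | @deref r hr ih =>
    rcases (Path.ext_step_iff (s := none)).1 hq with h | h
    · exact .inl (h ▸ hr.deref)
    · exact ih h

theorem Path.not_deref_ext_self {p q : Path} (h : p.Ext q) : ¬ (Path.deref q).Ext p := by
  intro h'
  have := h.depth_le
  have h2 := h'.depth_le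
  simp only [Path.depth] at h2
  omega

theorem Path.root_step (p : Path) (s : Sel) : (p.step s).root = p.root := by
  cases s <;> rfl

theorem Path.root_app (p : Path) (w : List Sel) : (p.app w).root = p.root := by
  induction w generalizing p with
  | nil => rfl
  | cons s w ih => rw [Path.app_cons, ih, Path.root_step]

theorem Path.Ext.root_eq {p q : Path} (h : p.Ext q) : q.root = p.root := by
  obtain ⟨w, rfl⟩ := h.exists_app
  exact Path.root_app _ _

theorem Path.root_ext (p : Path) : (Path.var p.root).Ext p := by
  induction p with
  | var x => exact .refl
  | field p f ih => exact ih.field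
  | deref p ih => exact ih.deref

theorem Path.derefs_app (p : Path) (w : List Sel) :
    (p.app w).derefs = p.derefs + w.count none := by
  induction w generalizing p with
  | nil => rfl
  | cons s w ih =>
    rw [Path.app_cons, ih]
    cases s
    · simp [Path.step, Path.derefs]; omega
    · simp [Path.step, Path.derefs]

theorem Path.derefs_sub (p : Path) (l : List Ident) : (p.sub l).derefs = p.derefs := by
  rw [Path.sub, Path.derefs_app]
  simp [List.count_eq_zero]

theorem Path.Ext.derefs_le {p q : Path} (h : p.Ext q) : p.derefs ≤ q.derefs := by
  obtain ⟨w, rfl⟩ := h.exists_app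
  rw [Path.derefs_app]; omega

/-- A list of selectors consists of fields, or has a first dereference. -/
theorem sel_split (w : List Sel) :
    (∃ l : List Ident, w = l.map some) ∨
      ∃ (l : List Ident) (w' : List Sel), w = l.map some ++ none :: w' := by
  induction w with
  | nil => exact .inl ⟨[], rfl⟩
  | cons s w ih =>
    cases s with
    | none => exact .inr ⟨[], w, rfl⟩
    | some f =>
      rcases ih with ⟨l, rfl⟩ | ⟨l, w', rfl⟩
      · exact .inl ⟨f :: l, rfl⟩
      · exact .inr ⟨f :: l, w', rfl⟩

theorem sel_split_inj {l l' : List Ident} {w w' : List Sel}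
    (h : l.map some ++ none :: w = l'.map some ++ none :: w') : l = l' ∧ w = w' := by
  induction l generalizing l' with
  | nil =>
    cases l' with
    | nil => simpa using h
    | cons f l' => simp at h
  | cons g l ih =>
    cases l' with
    | nil => simp at h
    | cons f l' =>
      simp only [List.map_cons, List.cons_append, List.cons.injEq, Option.some.injEq] at h
      obtain ⟨h1, h2⟩ := ih h.2
      exact ⟨by rw [h.1, h1], h2⟩

/-- An extension of a path is near or goes through a pointer in a near extension. -/
theorem Path.Ext.cases_near {p r : Path} (h : p.Ext r) :
    (∃ l, r = p.sub l) ∨ ∃ l w, r = (Path.deref (p.sub l)).app w := by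
  obtain ⟨w, rfl⟩ := h.exists_app
  rcases sel_split w with ⟨l, rfl⟩ | ⟨l, w', rfl⟩
  · exact .inl ⟨l, rfl⟩
  · exact .inr ⟨l, w', by rw [Path.app_append]; rfl⟩

theorem Path.Ext.near {p r : Path} (h : p.Ext r) (hd : r.derefs = p.derefs) :
    ∃ l, r = p.sub l := by
  rcases h.cases_near with h | ⟨l, w, rfl⟩
  · exact h
  · rw [Path.derefs_app, Path.derefs, Path.derefs_sub] at hd
    omega

theorem Path.ext_sub (p : Path) (l : List Ident) : p.Ext (p.sub l) := Path.ext_app _ _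

theorem Path.deref_sub_app (p : Path) (l : List Ident) (w : List Sel) :
    (Path.deref (p.sub l)).app w = p.app (l.map some ++ none :: w) := by
  rw [Path.app_append]; rfl

theorem Path.sub_append (p : Path) (l l' : List Ident) : p.sub (l ++ l') = (p.sub l).sub l' := by
  rw [Path.sub, List.map_append, Path.app_append]; rfl

/-! ### Types along selectors -/

section
variable (D : List RecDecl) (Γ : Ctx)

/-- The type reached from a type by one selector, if any. -/
def tyStep : Ty → Sel → Option Ty
  | .record R, some f => fieldTy D R f
  | .access τ, none => some τ
  | _, _ => none

/-- The type reached from a type by a list of selectors, if any. -/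
def tyWalk : Ty → List Sel → Option Ty
  | τ, [] => some τ
  | τ, s :: w => (tyStep D τ s).bind fun τ' => tyWalk τ' w

theorem tyWalk_append (τ : Ty) (w w' : List Sel) :
    tyWalk D τ (w ++ w') = (tyWalk D τ w).bind fun τ' => tyWalk D τ' w' := by
  induction w generalizing τ with
  | nil => rfl
  | cons s w ih =>
    simp only [List.cons_append, tyWalk]
    cases tyStep D τ s <;> simp [ih]

theorem Path.ty_step (p : Path) (s : Sel) :
    (p.step s).ty D Γ = (p.ty D Γ).bind fun τ => tyStep D τ s := by
  cases s with
  | none =>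
    simp only [Path.step, Path.ty]
    rcases p.ty D Γ with _ | (_ | _ | _) <;> rfl
  | some f =>
    simp only [Path.step, Path.ty]
    rcases p.ty D Γ with _ | (_ | _ | _) <;> rfl

theorem Path.ty_app (p : Path) (w : List Sel) :
    (p.app w).ty D Γ = (p.ty D Γ).bind fun τ => tyWalk D τ w := by
  induction w generalizing p with
  | nil => simp [Path.app_nil, tyWalk]
  | cons s w ih =>
    rw [Path.app_cons, ih, Path.ty_step]
    cases p.ty D Γ <;> simp [tyWalk]

variable {D Γ}

theorem Path.WellTyped.of_ext {p q : Path} (h : q.WellTyped D Γ) (hpq : p.Ext q) :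
    p.WellTyped D Γ := by
  obtain ⟨w, rfl⟩ := hpq.exists_app
  obtain ⟨τ, hτ⟩ := h
  rw [Path.ty_app] at hτ
  rcases hp : p.ty D Γ with _ | τ'
  · simp [hp] at hτ
  · exact ⟨τ', hp⟩

theorem Path.WellTyped.of_step {p : Path} {s : Sel} (h : (p.step s).WellTyped D Γ) :
    p.WellTyped D Γ := h.of_ext (Path.Ext.refl.step s)

theorem Path.ty_of_deref {p : Path} (h : (Path.deref p).WellTyped D Γ) :
    ∃ τ, p.ty D Γ = some (.access τ) := by
  obtain ⟨τ, hτ⟩ := h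
  simp only [Path.ty] at hτ
  split at hτ
  · rename_i τ' h; exact ⟨τ', h⟩
  · simp at hτ

theorem Path.ty_of_field {p : Path} {f : Ident} (h : (Path.field p f).WellTyped D Γ) :
    ∃ R τ, p.ty D Γ = some (.record R) ∧ fieldTy D R f = some τ := by
  obtain ⟨τ, hτ⟩ := h
  simp only [Path.ty] at hτ
  split at hτ
  · rename_i R h; exact ⟨R, τ, h, hτ⟩
  · simp at hτ

/-- A path is not both a record and a pointer. -/
theorem Path.not_field_of_deref {p : Path} {f : Ident} (h : (Path.deref p).WellTyped D Γ) :
    ¬ (Path.field p f).WellTyped D Γ := by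
  intro h'
  obtain ⟨τ, h1⟩ := Path.ty_of_deref h
  obtain ⟨R, τ', h2, -⟩ := Path.ty_of_field h'
  simp [h1] at h2

/-- Types without fields: scalar types, pointer types and records without fields. -/
def Ty.Leaf (D : List RecDecl) (τ : Ty) : Prop := ∀ R f, τ = .record R → fieldTy D R f = none

variable (D Γ) in
/-- Well-typed paths of a type without fields. -/
def Path.Leaf (p : Path) : Prop := ∃ τ, p.ty D Γ = some τ ∧ τ.Leaf D

theorem Path.Leaf.wellTyped {p : Path} (h : p.Leaf D Γ) : p.WellTyped D Γ :=
  let ⟨τ, h, _⟩ := h; ⟨τ, h⟩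

theorem Path.leaf_of_ty_access {p : Path} {τ : Ty} (h : p.ty D Γ = some (.access τ)) :
    p.Leaf D Γ := ⟨_, h, fun _ _ h => by cases h⟩

theorem Path.leaf_of_deref {p : Path} (h : (Path.deref p).WellTyped D Γ) : p.Leaf D Γ :=
  let ⟨_, h⟩ := Path.ty_of_deref h; Path.leaf_of_ty_access h

theorem Path.not_leaf_of_field {p : Path} {f : Ident} (h : (Path.field p f).WellTyped D Γ) :
    ¬ p.Leaf D Γ := by
  rintro ⟨τ, h1, h2⟩
  obtain ⟨R, τ', h3, h4⟩ := Path.ty_of_field h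
  rw [h1] at h3
  cases h3
  rw [h2 R f rfl] at h4
  cases h4

/-- By-value containment of record types follows the order of declaration. -/
theorem idxOf_lt_of_fieldTy (hD : RecordsOK D) {R R' f : Ident}
    (h : fieldTy D R f = some (.record R')) :
    (D.map RecDecl.name).idxOf R' < (D.map RecDecl.name).idxOf R := by
  simp only [fieldTy, Option.bind_eq_some_iff] at h
  obtain ⟨d, hd, hf⟩ := h
  rw [List.find?_eq_some_iff_append] at hd
  obtain ⟨hn, pre, post, rfl, hpre⟩ := hd
  have hn : d.name = R := by simpa using hn
  have hmem : (f, Ty.record R') ∈ d.fields := by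
    rw [List.lookup_eq_some_iff] at hf
    obtain ⟨l₁, l₂, e, -⟩ := hf
    rw [e]; simp
  have hok := ((hD.2 pre d post rfl).2 _ hmem)
  simp only [Ty.FieldOK] at hok
  have hR : R ∉ pre.map RecDecl.name := by
    simp only [List.mem_map, not_exists, not_and]
    intro x hx hxR
    have := hpre x hx
    simp [hxR] at this
  rw [List.map_append, List.idxOf_append_of_mem hok, List.idxOf_append_of_notMem hR,
    List.map_cons, hn, List.idxOf_cons_self]
  have := List.idxOf_lt_length_of_mem hok
  omega

/-- Every type has a component without fields, because records cannot contain themselves by value.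
-/
theorem exists_leaf (hD : RecordsOK D) (τ : Ty) :
    ∃ (l : List Ident) (τ' : Ty), tyWalk D τ (l.map some) = some τ' ∧ τ'.Leaf D := by
  by_cases hl : τ.Leaf D
  · exact ⟨[], τ, rfl, hl⟩
  · simp only [Ty.Leaf, not_forall] at hl
    obtain ⟨R, f, rfl, hf⟩ := hl
    obtain ⟨τ₁, hf⟩ := Option.ne_none_iff_exists'.1 hf
    have ih : ∃ (l : List Ident) (τ' : Ty), tyWalk D τ₁ (l.map some) = some τ' ∧ τ'.Leaf D := by
      cases τ₁ with
      | scalar t => exact ⟨[], _, rfl, fun _ _ h => by cases h⟩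
      | access t => exact ⟨[], _, rfl, fun _ _ h => by cases h⟩
      | record R' =>
        have := idxOf_lt_of_fieldTy hD hf
        exact exists_leaf hD (.record R')
    obtain ⟨l, τ', h1, h2⟩ := ih
    exact ⟨f :: l, τ', by simp [tyWalk, tyStep, hf, h1], h2⟩
termination_by match τ with
  | .record R => (D.map RecDecl.name).idxOf R
  | _ => 0

/-- A type with a deep component is deep. -/
theorem deep_of_tyWalk {τ τ' : Ty} {l : List Ident} (h : tyWalk D τ (l.map some) = some τ')
    (hd : τ'.Deep D) : τ.Deep D := by
  induction l generalizing τ with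
  | nil => cases h; exact hd
  | cons f l ih =>
    simp only [List.map_cons, tyWalk, Option.bind_eq_some_iff] at h
    obtain ⟨τ₁, h1, h2⟩ := h
    cases τ with
    | record R => exact .record h1 (ih h2)
    | scalar t => cases h1
    | access t => cases h1

theorem tyWalk_scalar {t : STy} {w : List Sel} {τ' : Ty}
    (h : tyWalk D (.scalar t) w = some τ') : w = [] ∧ τ' = .scalar t := by
  cases w with
  | nil => cases h; exact ⟨rfl, rfl⟩
  | cons s w => cases s <;> simp [tyWalk, tyStep] at h

theorem tyWalk_access {τ τ' : Ty} {l : List Ident}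
    (h : tyWalk D (.access τ) (l.map some) = some τ') : l = [] ∧ τ' = .access τ := by
  cases l with
  | nil => cases h; exact ⟨rfl, rfl⟩
  | cons f l => simp [tyWalk, tyStep] at h

end

/-! ### Components of values -/

theorem Value.get_nil (v : Value) : v.get [] = some v := by cases v <;> rfl

theorem Value.get_record_cons (fs : List (Ident × Value)) (f : Ident) (l : List Ident) :
    (Value.record fs).get (f :: l) = (fs.lookup f).bind fun w => w.get l := by
  rw [Value.get]
  cases fs.lookup f <;> rfl

theorem Value.get_append (v : Value) (l m : List Ident) :
    v.get (l ++ m) = (v.get l).bind fun w => w.get m := by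
  induction l generalizing v with
  | nil => simp [Value.get_nil]
  | cons f l ih =>
    cases v with
    | record fs =>
      simp only [List.cons_append, Value.get_record_cons]
      cases fs.lookup f <;> simp [ih]
    | _ => rfl

theorem Value.set_nil (v u : Value) : v.set [] u = some u := by cases v <;> rfl

theorem Value.set_cons_eq_some {v u v' : Value} {f : Ident} {l : List Ident}
    (h : v.set (f :: l) u = some v') : ∃ fs w w', v = .record fs ∧ fs.lookup f = some w ∧
      w.set l u = some w' ∧
      v' = .record (fs.map fun gv => if gv.1 = f then (gv.1, w') else gv) := by
  cases v with
  | record fs =>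
    rw [Value.set] at h
    rcases hw : fs.lookup f with _ | w
    · simp [hw] at h
    · simp only [hw, Option.map_eq_some_iff] at h
      obtain ⟨w', h1, h2⟩ := h
      exact ⟨fs, w, w', rfl, hw, h1, h2.symm⟩
  | _ => cases h

theorem lookup_replace (fs : List (Ident × Value)) (f g : Ident) (w' : Value) :
    (fs.map fun gv => if gv.1 = f then (gv.1, w') else gv).lookup g =
      if g = f then (fs.lookup f).map fun _ => w' else fs.lookup g := by
  induction fs with
  | nil => simp
  | cons hv fs ih =>
    obtain ⟨h, v⟩ := hv
    by_cases h1 : h = f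
    · subst h1
      by_cases h2 : g = h
      · subst h2; simp
      · simp [List.lookup_cons, beq_eq_false_iff_ne.2 h2, ih, h2]
    · by_cases h2 : g = h
      · subst h2; simp [h1]
      · simp only [List.map_cons, h1, if_false, List.lookup_cons, beq_eq_false_iff_ne.2 h2, ih]
        by_cases h3 : g = f
        · subst h3; simp [beq_eq_false_iff_ne.2 h2]
        · simp [h3]

theorem Value.get_set_below {v u v' : Value} {l : List Ident} (h : v.set l u = some v')
    (m : List Ident) : v'.get (l ++ m) = u.get m := by
  induction l generalizing v v' with
  | nil => rw [Value.set_nil] at h; cases h; rfl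
  | cons f l ih =>
    obtain ⟨fs, w, w', rfl, hw, h1, rfl⟩ := Value.set_cons_eq_some h
    rw [List.cons_append, Value.get_record_cons, lookup_replace]
    simp [hw, ih h1]

/-- Replacing a component leaves those neither above nor below it unchanged. -/
theorem Value.get_set_apart {v u v' : Value} {l m : List Ident} (h : v.set l u = some v')
    (h1 : ¬ l <+: m) (h2 : ¬ m <+: l) : v'.get m = v.get m := by
  induction l generalizing v v' m with
  | nil => exact absurd List.nil_prefix h1
  | cons f l ih =>
    obtain ⟨fs, w, w', rfl, hw, h3, rfl⟩ := Value.set_cons_eq_some h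
    cases m with
    | nil => exact absurd List.nil_prefix h2
    | cons g m =>
      rw [Value.get_record_cons, Value.get_record_cons, lookup_replace]
      by_cases hg : g = f
      · subst hg
        simp only [List.cons_prefix_cons, true_and] at h1 h2
        simp [hw, ih h3 h1 h2]
      · simp [hg]

/-! ### Well-typed stores -/

/-- A store typing gives the types of the allocated locations. -/
abbrev STyping := Loc → Option Ty

/-- The address of a component, given by field names. -/
def Addr.sub (a : Addr) (l : List Ident) : Addr := ⟨a.loc, a.flds ++ l⟩

section
variable (D : List RecDecl)

/-- The type of the component of a location at an address. -/
def addrTy (L : STyping) (a : Addr) : Option Ty :=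
  (L a.loc).bind fun τ => tyWalk D τ (a.flds.map some)

/-- A value in a cell of a pointer type is null or an address of the right type. (The contents
of the other cells do not matter for aliasing.) -/
def PtrOK (L : STyping) (u : Value) (τ : Ty) : Prop :=
  ∀ τ', τ = .access τ' → u = .null ∨ ∃ b, u = .addr b ∧ addrTy D L b = some τ'

/-- A value has all the components that its type requires, with well-typed pointers in them. -/
def VTyped (L : STyping) (v : Value) (τ : Ty) : Prop :=
  ∀ (l : List Ident) (τ' : Ty), tyWalk D τ (l.map some) = some τ' →
    ∃ u, v.get l = some u ∧ PtrOK D L u τ'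

/-- Exactly the allocated locations have types, and their contents are of these types. -/
structure STyped (L : STyping) (σ : Store) : Prop where
  dom : ∀ ℓ, σ ℓ = none ↔ L ℓ = none
  val : ∀ ℓ τ v, L ℓ = some τ → σ ℓ = some v → VTyped D L v τ

/-- Bindings give the declared variables addresses of their types. -/
def BTyped (L : STyping) (Γ : Ctx) (β : Binding) : Prop :=
  ∀ x τ, Γ x = some τ → ∃ a, β x = some a ∧ addrTy D L a = some τ

end

/-- Extension of store typings by new locations. -/
def STyping.Le (L L' : STyping) : Prop := ∀ ℓ τ, L ℓ = some τ → L' ℓ = some τ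

theorem STyping.Le.refl (L : STyping) : L.Le L := fun _ _ h => h

theorem STyping.Le.trans {L L' L'' : STyping} (h : L.Le L') (h' : L'.Le L'') : L.Le L'' :=
  fun ℓ τ e => h' ℓ τ (h ℓ τ e)

section
variable {D : List RecDecl} {Γ : Ctx} {L L' : STyping} {σ σ' : Store} {β : Binding}

theorem addrTy_mono (h : L.Le L') {a : Addr} {τ : Ty} (ha : addrTy D L a = some τ) :
    addrTy D L' a = some τ := by
  simp only [addrTy, Option.bind_eq_some_iff] at ha ⊢
  obtain ⟨τ', h1, h2⟩ := ha
  exact ⟨τ', h _ _ h1, h2⟩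

theorem PtrOK.mono (h : L.Le L') {u : Value} {τ : Ty} (hu : PtrOK D L u τ) : PtrOK D L' u τ := by
  intro τ' e
  rcases hu τ' e with h1 | ⟨b, h1, h2⟩
  · exact .inl h1
  · exact .inr ⟨b, h1, addrTy_mono h h2⟩

theorem VTyped.mono (h : L.Le L') {v : Value} {τ : Ty} (hv : VTyped D L v τ) :
    VTyped D L' v τ := by
  intro l τ' e
  obtain ⟨u, h1, h2⟩ := hv l τ' e
  exact ⟨u, h1, h2.mono h⟩

theorem BTyped.mono (h : L.Le L') (hb : BTyped D L Γ β) : BTyped D L' Γ β := by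
  intro x τ e
  obtain ⟨a, h1, h2⟩ := hb x τ e
  exact ⟨a, h1, addrTy_mono h h2⟩

theorem VTyped.get {v u : Value} {τ τ' : Ty} {l : List Ident} (hv : VTyped D L v τ)
    (hl : tyWalk D τ (l.map some) = some τ') (hu : v.get l = some u) : VTyped D L u τ' := by
  intro m τ'' hm
  obtain ⟨w, h1, h2⟩ := hv (l ++ m) τ'' (by rw [List.map_append, tyWalk_append, hl]; exact hm)
  rw [Value.get_append, hu] at h1
  exact ⟨w, h1, h2⟩

theorem addrTy_sub {a : Addr} {τ : Ty} (ha : addrTy D L a = some τ) (l : List Ident) :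
    addrTy D L (a.sub l) = tyWalk D τ (l.map some) := by
  simp only [addrTy, Option.bind_eq_some_iff] at ha
  obtain ⟨τ', h1, h2⟩ := ha
  simp [addrTy, Addr.sub, h1, tyWalk_append, h2]

theorem addrTy_ne_none {a : Addr} {τ : Ty} (ha : addrTy D L a = some τ) : L a.loc ≠ none := by
  intro h; simp [addrTy, h] at ha

theorem STyped.read (hσ : STyped D L σ) {a : Addr} {τ : Ty} (ha : addrTy D L a = some τ) :
    ∃ v, σ.read a = some v ∧ VTyped D L v τ := by
  simp only [addrTy, Option.bind_eq_some_iff] at ha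
  obtain ⟨τ', h1, h2⟩ := ha
  rcases hv : σ a.loc with _ | v
  · rw [hσ.dom] at hv; simp [hv] at h1
  · have ht := hσ.val _ _ _ h1 hv
    obtain ⟨u, h3, -⟩ := ht _ _ h2
    exact ⟨u, by simp [Store.read, hv, h3], ht.get h2 h3⟩

theorem Addr.sub_nil (a : Addr) : a.sub [] = a := by cases a; simp [Addr.sub]

theorem Store.read_sub (σ : Store) (a : Addr) (l : List Ident) :
    σ.read (a.sub l) = (σ.read a).bind fun v => v.get l := by
  simp only [Store.read, Addr.sub]
  cases σ a.loc <;> simp [Value.get_append]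

theorem VTyped.ptr {v : Value} {τ : Ty} (h : VTyped D L v (.access τ)) :
    v = .null ∨ ∃ b, v = .addr b ∧ addrTy D L b = some τ := by
  obtain ⟨u, h1, h2⟩ := h [] _ rfl
  rw [Value.get_nil] at h1
  cases h1
  exact h2 _ rfl

theorem VTyped.addr {b : Addr} {τ : Ty} (h : VTyped D L (.addr b) (.access τ)) :
    addrTy D L b = some τ := by
  rcases h.ptr with h | ⟨c, h, h'⟩
  · cases h
  · cases h; exact h'

theorem vtyped_ptr {v : Value} {τ : Ty}
    (h : v = .null ∨ ∃ b, v = .addr b ∧ addrTy D L b = some τ) : VTyped D L v (.access τ) := by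
  intro l τ' hl
  obtain ⟨rfl, rfl⟩ := tyWalk_access hl
  refine ⟨v, Value.get_nil _, fun τ' e => ?_⟩
  cases e
  exact h

theorem vtyped_scalar (v : Value) (t : STy) : VTyped D L v (.scalar t) := by
  intro l τ' hl
  obtain ⟨h, rfl⟩ := tyWalk_scalar hl
  have : l = [] := by simpa using h
  subst this
  exact ⟨v, Value.get_nil _, fun τ' e => by cases e⟩

/-! ### Evaluation of paths along selectors -/

/-- The address reached from a given one by one selector. -/
def lstep (σ : Store) (a : Addr) : Sel → Option Addr
  | some f => some (a.field f)
  | none =>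
    match σ.read a with
    | some (.addr b) => some b
    | _ => none

/-- The address reached from a given one along a list of selectors. -/
def walk (σ : Store) : Addr → List Sel → Option Addr
  | a, [] => some a
  | a, s :: w => (lstep σ a s).bind fun b => walk σ b w

theorem lstep_none_eq_some {a b : Addr} :
    lstep σ a none = some b ↔ σ.read a = some (.addr b) := by
  simp only [lstep]
  rcases σ.read a with _ | (_ | _ | _ | _) <;> simp

theorem lval_step (β : Binding) (σ : Store) (p : Path) (s : Sel) :
    lval β σ (p.step s) = (lval β σ p).bind fun a => lstep σ a s := by
  cases s with
  | none =>
    simp only [Path.step, lval]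
    cases lval β σ p <;> rfl
  | some f =>
    simp only [Path.step, lval]
    cases lval β σ p <;> rfl

theorem lval_app (β : Binding) (σ : Store) (p : Path) (w : List Sel) :
    lval β σ (p.app w) = (lval β σ p).bind fun a => walk σ a w := by
  induction w generalizing p with
  | nil => rw [Path.app_nil]; cases lval β σ p <;> rfl
  | cons s w ih =>
    rw [Path.app_cons, ih, lval_step]
    cases lval β σ p <;> simp [walk]

theorem walk_fields (σ : Store) (a : Addr) (l : List Ident) :
    walk σ a (l.map some) = some (a.sub l) := by
  induction l generalizing a with
  | nil => simp [walk, Addr.sub_nil]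
  | cons f l ih => simp [walk, lstep, ih, Addr.field, Addr.sub]

theorem lval_sub {p : Path} {a : Addr} (h : lval β σ p = some a) (l : List Ident) :
    lval β σ (p.sub l) = some (a.sub l) := by
  rw [Path.sub, lval_app, h]; exact walk_fields _ _ _

theorem lval_deref {p : Path} {b : Addr} : lval β σ (.deref p) = some b ↔
    ∃ a, lval β σ p = some a ∧ σ.read a = some (.addr b) := by
  have := lval_step β σ p none
  simp only [Path.step] at this
  rw [this, Option.bind_eq_some_iff]
  simp only [lstep_none_eq_some]

theorem lval_typed (hσ : STyped D L σ) (hβ : BTyped D L Γ β) {p : Path} {τ : Ty} {a : Addr}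
    (hp : p.ty D Γ = some τ) (ha : lval β σ p = some a) : addrTy D L a = some τ := by
  induction p generalizing τ a with
  | var x =>
    obtain ⟨b, h1, h2⟩ := hβ x τ hp
    simp only [lval] at ha
    rw [h1] at ha
    cases ha
    exact h2
  | field p f ih =>
    obtain ⟨R, τ', h1, h2⟩ := Path.ty_of_field ⟨τ, hp⟩
    simp only [lval, Option.map_eq_some_iff] at ha
    obtain ⟨b, h3, rfl⟩ := ha
    have h4 := addrTy_sub (ih h1 h3) [f]
    simp only [Path.ty, h1] at hp
    change addrTy D L (b.sub [f]) = some τ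
    simpa [tyWalk, tyStep, hp] using h4
  | deref p ih =>
    obtain ⟨τ', h1⟩ := Path.ty_of_deref ⟨τ, hp⟩
    obtain ⟨b, h2, h3⟩ := lval_deref.1 ha
    obtain ⟨v, h4, h5⟩ := hσ.read (ih h1 h2)
    rw [h3] at h4
    cases h4
    simp only [Path.ty, h1] at hp
    cases hp
    exact h5.addr

theorem eval_typed (hσ : STyped D L σ) (hβ : BTyped D L Γ β) {e : Expr} {τ : Ty} {v : Value}
    (he : HasType D Γ e τ) (hv : eval β σ e = some v) : VTyped D L v τ := by
  cases he with
  | @path p _ hp =>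
    simp only [eval, Option.bind_eq_some_iff] at hv
    obtain ⟨a, h1, h2⟩ := hv
    obtain ⟨u, h3, h4⟩ := hσ.read (lval_typed hσ hβ hp h1)
    rw [h2] at h3
    cases h3
    exact h4
  | const => exact vtyped_scalar _ _
  | binop _ _ => exact vtyped_scalar _ _
  | @addrOf p τ hp =>
    simp only [eval, Option.map_eq_some_iff] at hv
    obtain ⟨a, h1, rfl⟩ := hv
    exact vtyped_ptr (.inr ⟨a, rfl, lval_typed hσ hβ hp h1⟩)
  | null =>
    cases hv
    exact vtyped_ptr (.inl rfl)

/-! ### Updates of the store -/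

theorem Store.write_eq_some {a : Addr} {u : Value} (h : σ.write a u = some σ') :
    ∃ v v', σ a.loc = some v ∧ v.set a.flds u = some v' ∧
      σ' = Function.update σ a.loc (some v') := by
  simp only [Store.write, Option.map_eq_some_iff, Option.bind_eq_some_iff] at h
  obtain ⟨v', ⟨v, h1, h2⟩, h3⟩ := h
  exact ⟨v, v', h1, h2, h3.symm⟩

/-- No component lies strictly below a pointer. -/
theorem not_access_of_prefix {τ τ₁ τ₂ : Ty} {l m : List Ident}
    (h1 : tyWalk D τ (l.map some) = some τ₁) (h2 : tyWalk D τ (m.map some) = some (.access τ₂))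
    (h : m <+: l) : m = l := by
  obtain ⟨k, rfl⟩ := h
  rw [List.map_append, tyWalk_append, h2] at h1
  obtain ⟨rfl, -⟩ := tyWalk_access h1
  simp

theorem VTyped.set {v v' u : Value} {τ τ₁ : Ty} {l : List Ident} (hv : VTyped D L v τ)
    (hl : tyWalk D τ (l.map some) = some τ₁) (hu : VTyped D L u τ₁) (h : v.set l u = some v') :
    VTyped D L v' τ := by
  intro m τ' hm
  by_cases h1 : l <+: m
  · obtain ⟨k, rfl⟩ := h1
    rw [List.map_append, tyWalk_append, hl] at hm
    obtain ⟨w, h2, h3⟩ := hu k τ' hm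
    exact ⟨w, by rw [Value.get_set_below h, h2], h3⟩
  · by_cases h2 : m <+: l
    · obtain ⟨k, rfl⟩ := h2
      have h3 := Value.get_set_below h []
      rw [List.append_nil, Value.get_nil, Value.get_append] at h3
      obtain ⟨w, h4, -⟩ := Option.bind_eq_some_iff.1 h3
      refine ⟨w, h4, fun τ₂ e => ?_⟩
      subst e
      exact absurd ⟨[], by rw [← not_access_of_prefix hl hm ⟨k, rfl⟩]; simp⟩ h1
    · rw [Value.get_set_apart h h1 h2]
      exact hv m τ' hm

theorem STyped.write (hσ : STyped D L σ) {a : Addr} {u : Value} {τ : Ty}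
    (ha : addrTy D L a = some τ) (hu : VTyped D L u τ) (h : σ.write a u = some σ') :
    STyped D L σ' := by
  obtain ⟨v, v', h1, h2, rfl⟩ := Store.write_eq_some h
  have hne : L a.loc ≠ none := addrTy_ne_none ha
  constructor
  · intro ℓ
    by_cases hℓ : ℓ = a.loc
    · subst hℓ; simp [hne]
    · rw [Function.update_of_ne hℓ]; exact hσ.dom ℓ
  · intro ℓ τ' w h3 h4
    by_cases hℓ : ℓ = a.loc
    · subst hℓ
      rw [Function.update_self] at h4
      cases h4
      simp only [addrTy, h3, Option.bind_some] at ha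
      exact (hσ.val _ _ _ h3 h1).set ha hu h2
    · rw [Function.update_of_ne hℓ] at h4
      exact hσ.val _ _ _ h3 h4

theorem Store.read_write_below {a : Addr} {u : Value} (h : σ.write a u = some σ')
    (l : List Ident) : σ'.read (a.sub l) = u.get l := by
  obtain ⟨v, v', h1, h2, rfl⟩ := Store.write_eq_some h
  simp [Store.read, Addr.sub, Value.get_set_below h2]

/-- An update of the store changes no pointer except those at or below the updated address. -/
theorem Store.read_write {a b : Addr} {u : Value} {τ τ' : Ty} (h : σ.write a u = some σ')
    (ha : addrTy D L a = some τ) (hb : addrTy D L b = some (.access τ')) :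
    σ'.read b = σ.read b ∨
      ∃ l, b = a.sub l ∧ tyWalk D τ (l.map some) = some (.access τ') := by
  obtain ⟨v, v', h1, h2, rfl⟩ := Store.write_eq_some h
  obtain ⟨ℓ, m⟩ := b
  by_cases hℓ : ℓ = a.loc
  · subst hℓ
    by_cases hm : a.flds <+: m
    · obtain ⟨k, rfl⟩ := hm
      refine .inr ⟨k, rfl, ?_⟩
      rw [← addrTy_sub ha]; exact hb
    · by_cases hm' : m <+: a.flds
      · simp only [addrTy, Option.bind_eq_some_iff] at ha hb
        obtain ⟨τ₀, h3, h4⟩ := ha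
        obtain ⟨τ₁, h5, h6⟩ := hb
        rw [h3] at h5
        cases h5
        exact absurd ⟨[], by rw [← not_access_of_prefix h4 h6 hm']; simp⟩ hm
      · left
        simp [Store.read, Value.get_set_apart h2 hm hm', h1]
  · left
    simp [Store.read, Function.update_of_ne hℓ]

/-! ### Allocation -/

theorem le_update {ℓ : Loc} (τ : Ty) (hℓ : L ℓ = none) :
    L.Le (Function.update L ℓ (some τ)) := by
  intro ℓ' τ' h
  rw [Function.update_of_ne (by rintro rfl; simp [hℓ] at h)]
  exact h

theorem STyped.alloc (hσ : STyped D L σ) {ℓ : Loc} {v : Value} {τ : Ty} (hℓ : σ ℓ = none)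
    (hv : VTyped D L v τ) :
    STyped D (Function.update L ℓ (some τ)) (Function.update σ ℓ (some v)) := by
  have hle := le_update τ ((hσ.dom ℓ).1 hℓ)
  constructor
  · intro ℓ'
    by_cases h : ℓ' = ℓ
    · subst h; simp
    · rw [Function.update_of_ne h, Function.update_of_ne h]; exact hσ.dom ℓ'
  · intro ℓ' τ' w h1 h2
    by_cases h : ℓ' = ℓ
    · subst h
      rw [Function.update_self] at h1 h2
      cases h1
      cases h2
      exact hv.mono hle
    · rw [Function.update_of_ne h] at h1 h2
      exact (hσ.val _ _ _ h1 h2).mono hle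

theorem lookup_map_snd (fs : List (Ident × Ty)) (g : Ty → Value) (f : Ident) :
    (fs.map fun fd => (fd.1, g fd.2)).lookup f = (fs.lookup f).map g := by
  induction fs with
  | nil => rfl
  | cons a fs ih =>
    obtain ⟨x, τ⟩ := a
    by_cases h : f = x
    · subst h; simp
    · simp [List.lookup_cons, beq_eq_false_iff_ne.2 h, ih]

/-- Default values are well-typed. The list `ds` holds an initial segment of the declarations, the
last one first; it suffices that it declares the record type in question, because the types of the
fields are declared still earlier. (A record type without a declaration has no fields.) -/
theorem defaultAux_typed (hD : RecordsOK D) (L : STyping) (ds : List RecDecl) (post : List RecDecl)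
    (hds : D = ds.reverse ++ post) (τ : Ty)
    (hτ : ∀ R, τ = .record R → R ∈ ds.map RecDecl.name ∨ ∀ f, fieldTy D R f = none) :
    VTyped D L (defaultAux ds τ) τ := by
  cases τ with
  | scalar t => exact vtyped_scalar _ _
  | access t =>
    have : defaultAux ds (.access t) = .null := by cases ds <;> rfl
    exact vtyped_ptr (.inl this)
  | record R =>
    induction ds generalizing post R with
    | nil =>
      intro l τ' hl
      rcases hτ R rfl with h | h
      · simp at h
      · cases l with
        | nil => exact ⟨_, Value.get_nil _, fun τ₁ e => by cases hl; cases e⟩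
        | cons f l => simp [tyWalk, tyStep, h] at hl
    | cons d ds ih =>
      have hds' : D = ds.reverse ++ d :: post := by simpa using hds
      have hok := hD.2 _ _ _ hds'
      by_cases hd : d.name = R
      · intro l τ' hl
        have hfind : D.find? (fun d => d.name = R) = some d := by
          rw [List.find?_eq_some_iff_append]
          refine ⟨by simpa using hd, ds.reverse, post, hds', fun d' hd' => ?_⟩
          have hn := hD.1
          rw [hds', List.map_append, List.nodup_append] at hn
          have := hn.2.2 d'.name (List.mem_map_of_mem hd') d.name (by simp)
          rw [hd] at this
          simpa using this
        simp only [defaultAux, if_pos hd]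
        cases l with
        | nil => exact ⟨_, Value.get_nil _, fun τ₁ e => by cases hl; cases e⟩
        | cons f l =>
          simp only [List.map_cons, tyWalk, tyStep, Option.bind_eq_some_iff] at hl
          obtain ⟨τ₁, h1, h2⟩ := hl
          have hf : d.fields.lookup f = some τ₁ := by
            simpa [fieldTy, hfind] using h1
          rw [Value.get_record_cons, lookup_map_snd, hf]
          simp only [Option.map_some, Option.bind_some]
          cases τ₁ with
          | scalar t => exact vtyped_scalar _ _ l τ' h2
          | access t =>
            have : defaultAux ds (.access t) = .null := by cases ds <;> rfl
            exact vtyped_ptr (.inl this) l τ' h2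
          | record R' =>
            refine ih (d :: post) hds' R' (fun R'' e => ?_) l τ' h2
            cases e
            left
            have hmem : (f, Ty.record R') ∈ d.fields := by
              rw [List.lookup_eq_some_iff] at hf
              obtain ⟨l₁, l₂, e, -⟩ := hf
              rw [e]; simp
            have h3 := hok.2 _ hmem
            simpa [Ty.FieldOK] using h3
      · simp only [defaultAux, if_neg hd]
        refine ih (d :: post) hds' R (fun R'' e => ?_)
        cases e
        rcases hτ R rfl with h | h
        · left
          simpa [Ne.symm hd] using h
        · exact .inr h

theorem defaultValue_typed (hD : RecordsOK D) (L : STyping) (τ : Ty) :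
    VTyped D L (defaultValue D τ) τ := by
  refine defaultAux_typed hD L D.reverse [] (by simp) τ fun R _ => ?_
  by_cases h : R ∈ D.map RecDecl.name
  · left; simpa using h
  · right
    intro f
    have : D.find? (fun d => d.name = R) = none := by
      rw [List.find?_eq_none]
      intro d hd
      have : d.name ≠ R := fun e => h (e ▸ List.mem_map_of_mem hd)
      simpa using this
    simp [fieldTy, this]

end

/-! ### Invariants of access policies -/

/-- The path has at least the write permission. -/
def Policy.Live (Θ : Policy) (p : Path) : Prop := Θ p = some Perm.WO ∨ Θ p = some Perm.RW

theorem Policy.atLeast_RW {Θ : Policy} {p : Path} : Θ.AtLeast p Perm.RW ↔ Θ p = some Perm.RW := by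
  constructor
  · rintro ⟨⟨r, w⟩, h, hle⟩
    cases r <;> cases w <;> first | exact h | exact absurd hle (by decide)
  · intro h; exact ⟨_, h, le_refl _⟩

theorem Policy.atLeast_WO {Θ : Policy} {p : Path} : Θ.AtLeast p Perm.WO ↔ Θ.Live p := by
  constructor
  · rintro ⟨⟨r, w⟩, h, hle⟩
    cases r <;> cases w <;>
      first | exact .inl h | exact .inr h | exact absurd hle (by decide)
  · rintro (h | h)
    · exact ⟨_, h, le_refl _⟩
    · exact ⟨_, h, by decide⟩

theorem Policy.atLeast_RO {Θ : Policy} {p : Path} :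
    Θ.AtLeast p Perm.RO ↔ Θ p = some Perm.RO ∨ Θ p = some Perm.RW := by
  constructor
  · rintro ⟨⟨r, w⟩, h, hle⟩
    cases r <;> cases w <;>
      first | exact .inl h | exact .inr h | exact absurd hle (by decide)
  · rintro (h | h)
    · exact ⟨_, h, le_refl _⟩
    · exact ⟨_, h, by decide⟩

theorem Policy.not_live_of_NO {Θ : Policy} {p : Path} (h : Θ p = some Perm.NO) :
    ¬ Θ.Live p := by
  rintro (h' | h') <;> rw [h] at h' <;> revert h' <;> decide

theorem Policy.not_live_of_RO {Θ : Policy} {p : Path} (h : Θ p = some Perm.RO) :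
    ¬ Θ.Live p := by
  rintro (h' | h') <;> rw [h] at h' <;> revert h' <;> decide

section
variable (D : List RecDecl) (Γ : Ctx) (In : Ident → Prop)

/-- The invariant of the policies met in the analysis of a body, except for the conditions
that relate the path `q` to its parent. The variables in `In` are those of the `in`
parameters; the paths below them have exactly the permission `R`, and `R` does not occur
elsewhere. The condition `up` says that the pointers on the way to a writable path are
writable. -/
structure GoodBut (Θ : Policy) (q : Path) : Prop where
  inp : ∀ p : Path, p.WellTyped D Γ → In p.root → Θ p = some Perm.RO
  out : ∀ p : Path, p.WellTyped D Γ → ¬ In p.root → Θ p = some Perm.NO ∨ Θ.Live p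
  rw_step : ∀ (p : Path) (s : Sel), (p.step s).WellTyped D Γ → Θ p = some Perm.RW →
    Θ (p.step s) = some Perm.RW ∨ p.step s = q
  live_field : ∀ (p : Path) (f : Ident), (Path.field p f).WellTyped D Γ → Θ.Live p →
    Θ.Live (.field p f) ∨ Path.field p f = q
  up : ∀ s r : Path, r.WellTyped D Γ → (Path.deref s).Ext r → Θ.Live r → Θ.Live s

/-- The invariant of the policies met in the analysis of a body. -/
structure Good (Θ : Policy) : Prop where
  inp : ∀ p : Path, p.WellTyped D Γ → In p.root → Θ p = some Perm.RO
  out : ∀ p : Path, p.WellTyped D Γ → ¬ In p.root → Θ p = some Perm.NO ∨ Θ.Live p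
  rw_step : ∀ (p : Path) (s : Sel), (p.step s).WellTyped D Γ → Θ p = some Perm.RW →
    Θ (p.step s) = some Perm.RW
  live_field : ∀ (p : Path) (f : Ident), (Path.field p f).WellTyped D Γ → Θ.Live p →
    Θ.Live (.field p f)
  up : ∀ s r : Path, r.WellTyped D Γ → (Path.deref s).Ext r → Θ.Live r → Θ.Live s

end

section
variable {D : List RecDecl} {Γ : Ctx} {In : Ident → Prop} {Θ Θ' : Policy} {p q r : Path}

theorem Good.goodBut (h : Good D Γ In Θ) (q : Path) : GoodBut D Γ In Θ q :=
  ⟨h.inp, h.out, fun p s h1 h2 => .inl (h.rw_step p s h1 h2),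
    fun p f h1 h2 => .inl (h.live_field p f h1 h2), h.up⟩

theorem GoodBut.good_of_var {x : Ident} (h : GoodBut D Γ In Θ (.var x)) : Good D Γ In Θ :=
  ⟨h.inp, h.out,
    fun p s h1 h2 => (h.rw_step p s h1 h2).resolve_right (by cases s <;> simp [Path.step]),
    fun p f h1 h2 => (h.live_field p f h1 h2).resolve_right (by simp), h.up⟩

theorem GoodBut.not_in (h : GoodBut D Γ In Θ q) (hp : p.WellTyped D Γ) (hl : Θ.Live p) :
    ¬ In p.root := fun hin => Policy.not_live_of_RO (h.inp p hp hin) hl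

theorem Good.not_in (h : Good D Γ In Θ) (hp : p.WellTyped D Γ) (hl : Θ.Live p) :
    ¬ In p.root := (h.goodBut p).not_in hp hl

theorem Good.rw_ext (h : Good D Γ In Θ) (hp : Θ p = some Perm.RW) (hpq : p.Ext q)
    (hq : q.WellTyped D Γ) : Θ q = some Perm.RW := by
  induction hpq with
  | refl => exact hp
  | @field q f _ ih => exact h.rw_step q (some f) hq (ih (Path.WellTyped.of_step (s := some f) hq))
  | @deref q _ ih => exact h.rw_step q none hq (ih (Path.WellTyped.of_step (s := none) hq))

theorem Good.live_sub (h : Good D Γ In Θ) (hp : Θ.Live p) (l : List Ident)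
    (hq : (p.sub l).WellTyped D Γ) : Θ.Live (p.sub l) := by
  induction l using List.reverseRecOn with
  | nil => exact hp
  | append_singleton l f ih =>
    have e : p.sub (l ++ [f]) = .field (p.sub l) f := by rw [Path.sub_append]; rfl
    rw [e] at hq ⊢
    exact h.live_field _ f hq (ih (Path.WellTyped.of_step (s := some f) hq))

theorem Policy.set_self (Θ : Policy) (p : Path) (π : Perm) : Θ.set p π p = some π := by
  simp [Policy.set]

theorem Policy.set_of_ne (Θ : Policy) (π : Perm) (h : r ≠ p) : Θ.set p π r = Θ r := by
  simp [Policy.set, h]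

theorem Policy.live_set_of_ne (π : Perm) (h : r ≠ p) : (Θ.set p π).Live r ↔ Θ.Live r := by
  simp only [Policy.Live, Policy.set_of_ne Θ π h]

theorem Policy.live_set_WO (hp : Θ.Live p) : (Θ.set p Perm.WO).Live r ↔ Θ.Live r := by
  by_cases h : r = p
  · subst h
    exact ⟨fun _ => hp, fun _ => .inl (Θ.set_self _ _)⟩
  · exact Policy.live_set_of_ne _ h

theorem Policy.not_live_set_NO : ¬ (Θ.set p Perm.NO).Live p :=
  Policy.not_live_of_NO (Θ.set_self _ _)

/-! ### The transformers block, drop and lift -/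

/-- Removing the read permission from the parent moves the exception to the parent. -/
theorem GoodBut.lower {s : Sel} (h : GoodBut D Γ In Θ (p.step s)) (hp : p.WellTyped D Γ)
    (hlp : Θ.Live p) (hq : ∀ f, s = some f → Θ.Live (p.step s)) :
    GoodBut D Γ In (Θ.set p Perm.WO) p := by
  have hlive : ∀ r, (Θ.set p Perm.WO).Live r ↔ Θ.Live r := fun r => Policy.live_set_WO hlp
  refine ⟨fun r hr hin => ?_, fun r hr hin => ?_, fun r t hr hrw => ?_, fun r f hr hl => ?_,
    fun s r hr hs hl => ?_⟩
  · by_cases e : r = p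
    · subst e; exact absurd hin (h.not_in hp hlp)
    · rw [Policy.set_of_ne _ _ e]; exact h.inp r hr hin
  · rw [hlive]
    by_cases e : r = p
    · subst e; exact .inr hlp
    · rw [Policy.set_of_ne _ _ e]; exact h.out r hr hin
  · have hne : r ≠ p := by
      rintro rfl
      rw [Policy.set_self] at hrw
      revert hrw; decide
    rw [Policy.set_of_ne _ _ hne] at hrw
    by_cases e : r.step t = p
    · exact .inr e
    · rw [Policy.set_of_ne _ _ e]
      exact .inl ((h.rw_step r t hr hrw).resolve_right fun e' => hne (Path.step_inj.1 e').1)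
  · rw [hlive] at hl ⊢
    rcases h.live_field r f hr hl with h1 | h1
    · exact .inl h1
    · have h2 : r.step (some f) = p.step s := h1
      obtain ⟨rfl, rfl⟩ := Path.step_inj.1 h2
      exact .inl (hq f rfl)
  · rw [hlive] at hl ⊢
    exact h.up s r hr hs hl

/-- A writable path without the read permission, with all its parents treated by `block`,
restores the invariant; no path gains or loses the write permission. -/
theorem block_good (hb : block q Θ Θ') (h : GoodBut D Γ In Θ q) (hq : q.WellTyped D Γ)
    (hl : Θ.Live q) (hup : ∀ s : Path, (Path.deref s).Ext q → Θ.Live s) :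
    Good D Γ In Θ' ∧ ∀ r, Θ'.Live r ↔ Θ.Live r := by
  induction hb with
  | var => exact ⟨h.good_of_var, fun _ => Iff.rfl⟩
  | @deref p Θ Θ' _ ih =>
    have hp : p.WellTyped D Γ := Path.WellTyped.of_step (s := none) hq
    have hlp := hup p .refl
    obtain ⟨h1, h2⟩ := ih (GoodBut.lower (s := none) h hp hlp (by simp)) hp
      ((Policy.live_set_WO hlp).2 hlp)
      (fun s hs => (Policy.live_set_WO hlp).2 (hup s hs.deref))
    exact ⟨h1, fun r => (h2 r).trans (Policy.live_set_WO hlp)⟩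
  | @fieldStop p f Θ hno =>
    refine ⟨⟨h.inp, h.out, fun r s h1 h2 => (h.rw_step r s h1 h2).resolve_right fun e => ?_,
      fun r g h1 h2 => (h.live_field r g h1 h2).resolve_right fun e => ?_, h.up⟩, fun _ => Iff.rfl⟩
    · obtain ⟨rfl, rfl⟩ := (Path.step_inj (t := some f)).1 e
      exact Policy.not_live_of_NO hno (.inr h2)
    · cases e
      exact Policy.not_live_of_NO hno h2
  | @field p f Θ Θ' hlp _ ih =>
    rw [Policy.atLeast_WO] at hlp
    have hp : p.WellTyped D Γ := Path.WellTyped.of_step (s := some f) hq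
    obtain ⟨h1, h2⟩ := ih (GoodBut.lower (s := some f) h hp hlp (fun _ _ => hl)) hp
      ((Policy.live_set_WO hlp).2 hlp)
      (fun s hs => (Policy.live_set_WO hlp).2 (hup s hs.field))
    exact ⟨h1, fun r => (h2 r).trans (Policy.live_set_WO hlp)⟩

/-- After the removal of all permissions from `q` and its extensions, `drop` restores the invariant.
The paths that it deprives of the write permission are records with fields. -/
theorem drop_good (hb : drop q Θ Θ') (h : GoodBut D Γ In Θ q) (hq : q.WellTyped D Γ)
    (hin : ¬ In q.root) (hup : ∀ s : Path, (Path.deref s).Ext q → Θ.Live s) :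
    Good D Γ In Θ' ∧ ∀ r : Path, r.Leaf D Γ → (Θ'.Live r ↔ Θ.Live r) := by
  induction hb with
  | var => exact ⟨h.good_of_var, fun _ _ => Iff.rfl⟩
  | @deref p Θ Θ' hb =>
    have hp : p.WellTyped D Γ := Path.WellTyped.of_step (s := none) hq
    have hlp := hup p .refl
    obtain ⟨h1, h2⟩ := block_good hb (GoodBut.lower (s := none) h hp hlp (by simp)) hp
      ((Policy.live_set_WO hlp).2 hlp)
      (fun s hs => (Policy.live_set_WO hlp).2 (hup s hs.deref))
    exact ⟨h1, fun r _ => (h2 r).trans (Policy.live_set_WO hlp)⟩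
  | @field p f Θ Θ' _ ih =>
    have hp : p.WellTyped D Γ := Path.WellTyped.of_step (s := some f) hq
    have hlive : ∀ r, (Θ.set p Perm.NO).Live r ↔ Θ.Live r ∧ r ≠ p := by
      intro r
      by_cases e : r = p
      · subst e
        exact ⟨fun h => absurd h Policy.not_live_set_NO, fun h => absurd rfl h.2⟩
      · rw [Policy.live_set_of_ne _ e]
        simp [e]
    have hsp : ∀ s r : Path, r.WellTyped D Γ → (Path.deref s).Ext r → s ≠ p := by
      rintro s r hr hs rfl
      exact Path.not_field_of_deref (hr.of_ext hs) hq
    obtain ⟨h1, h2⟩ := ih (by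
      refine ⟨fun r hr hin' => ?_, fun r hr hin' => ?_, fun r t hr hrw => ?_, fun r g hr hl => ?_,
        fun s r hr hs hl => ?_⟩
      · rw [Policy.set_of_ne _ _ (by rintro rfl; exact hin hin')]
        exact h.inp r hr hin'
      · by_cases e : r = p
        · subst e; exact .inl (Policy.set_self _ _ _)
        · rw [Policy.set_of_ne _ _ e, Policy.live_set_of_ne _ e]
          exact h.out r hr hin'
      · have hne : r ≠ p := fun e => ((hlive r).1 (.inr hrw)).2 e
        rw [Policy.set_of_ne _ _ hne] at hrw
        by_cases e : r.step t = p
        · exact .inr e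
        · rw [Policy.set_of_ne _ _ e]
          exact .inl ((h.rw_step r t hr hrw).resolve_right
            fun e' => hne ((Path.step_inj (t := some f)).1 e').1)
      · rw [hlive] at hl ⊢
        by_cases e : Path.field r g = p
        · exact .inr e
        · exact .inl ⟨(h.live_field r g hr hl.1).resolve_right
            fun e' => hl.2 (by cases e'; rfl), e⟩
      · rw [hlive] at hl ⊢
        exact ⟨h.up s r hr hs hl.1, hsp s r hr hs⟩) hp hin
      (fun s hs => (hlive s).2 ⟨hup s hs.field, hsp s p hp hs⟩)
    refine ⟨h1, fun r hr => (h2 r hr).trans ((hlive r).trans ?_)⟩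
    refine ⟨fun h => h.1, fun h => ⟨h, ?_⟩⟩
    rintro rfl
    exact Path.not_leaf_of_field hq hr

/-- A path may get `RW` when all its strict extensions have it. -/
theorem Good.set_RW (h : Good D Γ In Θ) (hin : ¬ In p.root)
    (hall : ∀ q : Path, p.Ext q → q ≠ p → q.WellTyped D Γ → Θ q = some Perm.RW)
    (hup : ∀ s : Path, (Path.deref s).Ext p → Θ.Live s) : Good D Γ In (Θ.set p Perm.RW) := by
  have hmono : ∀ r, Θ.Live r → (Θ.set p Perm.RW).Live r := by
    intro r hr
    by_cases e : r = p
    · subst e; exact .inr (Policy.set_self _ _ _)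
    · rwa [Policy.live_set_of_ne _ e]
  refine ⟨fun r hr hin' => ?_, fun r hr hin' => ?_, fun r t hr hrw => ?_, fun r g hr hl => ?_,
    fun s r hr hs hl => ?_⟩
  · rw [Policy.set_of_ne _ _ (by rintro rfl; exact hin hin')]
    exact h.inp r hr hin'
  · by_cases e : r = p
    · subst e; exact .inr (.inr (Policy.set_self _ _ _))
    · rw [Policy.set_of_ne _ _ e, Policy.live_set_of_ne _ e]
      exact h.out r hr hin'
  · by_cases e' : r.step t = p
    · rw [e', Policy.set_self]
    rw [Policy.set_of_ne _ _ e']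
    by_cases e : r = p
    · subst e
      exact hall _ (Path.Ext.refl.step t) e' hr
    · rw [Policy.set_of_ne _ _ e] at hrw
      exact h.rw_step r t hr hrw
  · by_cases e : r = p
    · subst e
      exact hmono _ (.inr (hall _ (Path.Ext.refl.field) (by
        intro e
        have := congrArg Path.depth e
        simp [Path.depth] at this) hr))
    · rw [Policy.live_set_of_ne _ e] at hl
      exact hmono _ (h.live_field r g hr hl)
  · apply hmono
    by_cases e : r = p
    · subst e; exact hup s hs
    · rw [Policy.live_set_of_ne _ e] at hl
      exact h.up s r hr hs hl

/-- Lifting preserves the invariant. It grants the write permission to records with fields only. -/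
theorem lift_good (hb : lift D Γ q Θ Θ') (h : Good D Γ In Θ) (hq : q.WellTyped D Γ)
    (hrw : Θ q = some Perm.RW) :
    Good D Γ In Θ' ∧ (∀ r : Path, r.Leaf D Γ → (Θ'.Live r ↔ Θ.Live r)) ∧
      ∀ r, Θ.Live r → Θ'.Live r := by
  have hmono : ∀ (Θ : Policy) (p r : Path), Θ.Live r → (Θ.set p Perm.RW).Live r := by
    intro Θ p r hr
    by_cases e : r = p
    · subst e; exact .inr (Policy.set_self _ _ _)
    · rwa [Policy.live_set_of_ne _ e]
  induction hb with
  | var => exact ⟨h, fun _ _ => Iff.rfl, fun _ h => h⟩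
  | fieldStop => exact ⟨h, fun _ _ => Iff.rfl, fun _ h => h⟩
  | @deref p Θ Θ' _ ih =>
    have hp : p.WellTyped D Γ := Path.WellTyped.of_step (s := none) hq
    have hlp : Θ.Live p := h.up p _ hq .refl (.inr hrw)
    have hg : Good D Γ In (Θ.set p Perm.RW) := by
      refine h.set_RW (h.not_in hp hlp) (fun r hr hne hrt => ?_) (fun s hs => h.up s p hp hs hlp)
      obtain ⟨w, rfl⟩ := hr.exists_app
      cases w with
      | nil => exact absurd rfl hne
      | cons s w =>
        rw [Path.app_cons] at hrt ⊢
        cases s with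
        | none => exact h.rw_ext hrw (Path.ext_app _ _) hrt
        | some f =>
          exact absurd (hrt.of_ext (Path.ext_app _ _)) (Path.not_field_of_deref hq)
    obtain ⟨h1, h2, h3⟩ := ih hg hp (Policy.set_self _ _ _)
    refine ⟨h1, fun r hr => (h2 r hr).trans ?_, fun r hr => h3 r (hmono _ _ _ hr)⟩
    by_cases e : r = p
    · subst e; exact ⟨fun _ => hlp, hmono _ _ _⟩
    · exact Policy.live_set_of_ne _ e
  | @field p f Θ Θ' hall _ ih =>
    have hp : p.WellTyped D Γ := Path.WellTyped.of_step (s := some f) hq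
    have hg : Good D Γ In (Θ.set p Perm.RW) :=
      h.set_RW (h.not_in (p := .field p f) hq (.inr hrw)) hall
        (fun s hs => h.up s _ hq hs.field (.inr hrw))
    obtain ⟨h1, h2, h3⟩ := ih hg hp (Policy.set_self _ _ _)
    refine ⟨h1, fun r hr => (h2 r hr).trans ?_, fun r hr => h3 r (hmono _ _ _ hr)⟩
    refine Policy.live_set_of_ne _ ?_
    rintro rfl
    exact Path.not_leaf_of_field hq hr

/-! ### The transformers fresh and cut -/

theorem freshFun_of_ext {π : Perm} (h : p.Ext r) (hr : r.WellTyped D Γ) :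
    freshFun D Γ π p Θ r = some π := by simp [freshFun, h, hr]

theorem freshFun_of_not_ext {π : Perm} (h : ¬ p.Ext r) : freshFun D Γ π p Θ r = Θ r := by
  simp [freshFun, h]

theorem cutFun_near (h : p.Ext r) (hr : r.WellTyped D Γ) (hd : r.derefs = p.derefs) :
    cutFun D Γ p Θ r = some Perm.WO ∧ r.Deep D Γ ∨ cutFun D Γ p Θ r = Θ r ∧ ¬ r.Deep D Γ := by
  by_cases hdeep : r.Deep D Γ
  · exact .inl ⟨by simp [cutFun, h, hr, hd, hdeep], hdeep⟩
  · exact .inr ⟨by simp [cutFun, h, hr, hd, hdeep], hdeep⟩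

theorem cutFun_far (h : p.Ext r) (hr : r.WellTyped D Γ) (hd : r.derefs ≠ p.derefs) :
    cutFun D Γ p Θ r = some Perm.NO := by simp [cutFun, h, hr, hd]

theorem cutFun_of_not_ext (h : ¬ p.Ext r) : cutFun D Γ p Θ r = Θ r := by
  simp [cutFun, h]

theorem live_congr {p : Path} (h : Θ p = Θ' p) : Θ.Live p ↔ Θ'.Live p := by
  simp only [Policy.Live, h]

/-- A path above `p` has no child below `p` other than `p`. -/
theorem Path.eq_of_ext_step {s : Sel} (h : p.Ext (r.step s)) (h' : ¬ p.Ext r) : r.step s = p := by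
  rcases Path.ext_step_iff.1 h with h | h
  · exact h.symm
  · exact absurd h h'

/-- A pointer on the way to an extension of `p` is an extension of `p` or is passed on the way
to `p`. -/
theorem Path.deref_ext_cases {s : Path} (hs : (Path.deref s).Ext r) (hp : p.Ext r) :
    p.Ext s ∨ (Path.deref s).Ext p := by
  rcases Path.comparable_of_ext hs hp with h | h
  · exact .inr h
  · rcases (Path.ext_step_iff (s := none)).1 h with h | h
    · exact .inr (h ▸ .refl)
    · exact .inl h

theorem fresh_RW_good (h : Good D Γ In Θ) (hp : p.WellTyped D Γ) (hl : Θ.Live p) :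
    Good D Γ In (freshFun D Γ Perm.RW p Θ) ∧ ∀ r : Path, r.WellTyped D Γ →
      ((freshFun D Γ Perm.RW p Θ).Live r ↔ Θ.Live r ∨ p.Ext r) := by
  have hin := h.not_in hp hl
  have hlive : ∀ r : Path, r.WellTyped D Γ →
      ((freshFun D Γ Perm.RW p Θ).Live r ↔ Θ.Live r ∨ p.Ext r) := by
    intro r hr
    by_cases e : p.Ext r
    · exact ⟨fun _ => .inr e, fun _ => .inr (freshFun_of_ext e hr)⟩
    · rw [live_congr (freshFun_of_not_ext e)]
      simp [e]
  refine ⟨⟨fun r hr hin' => ?_, fun r hr hin' => ?_, fun r t hr hrw => ?_, fun r g hr hlr => ?_,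
    fun s r hr hs hlr => ?_⟩, hlive⟩
  · rw [freshFun_of_not_ext fun e => hin (e.root_eq ▸ hin')]
    exact h.inp r hr hin'
  · by_cases e : p.Ext r
    · exact .inr (.inr (freshFun_of_ext e hr))
    · rw [freshFun_of_not_ext e, live_congr (freshFun_of_not_ext e)]
      exact h.out r hr hin'
  · by_cases e : p.Ext (r.step t)
    · exact freshFun_of_ext e hr
    · rw [freshFun_of_not_ext fun e' => e (e'.step t)] at hrw
      rw [freshFun_of_not_ext e]
      exact h.rw_step r t hr hrw
  · rw [hlive _ (Path.WellTyped.of_step (s := some g) hr)] at hlr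
    rw [hlive _ hr]
    rcases hlr with hlr | hlr
    · exact .inl (h.live_field r g hr hlr)
    · exact .inr hlr.field
  · have hst : s.WellTyped D Γ := Path.WellTyped.of_step (s := none) (hr.of_ext hs)
    rw [hlive _ hr] at hlr
    rw [hlive _ hst]
    rcases hlr with hlr | hlr
    · exact .inl (h.up s r hr hs hlr)
    · rcases Path.deref_ext_cases hs hlr with h1 | h1
      · exact .inr h1
      · exact .inl (h.up s p hp h1 hl)

/-- Overwriting a path and its extensions by one permission `W` or `NO` breaks the invariant at
most between the path and its parent. -/
theorem fresh_goodBut {π : Perm} (hπ : π = Perm.WO ∨ π = Perm.NO) (h : Good D Γ In Θ)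
    (hin : ¬ In p.root) (hup : ∀ s : Path, (Path.deref s).Ext p → Θ.Live s) :
    GoodBut D Γ In (freshFun D Γ π p Θ) p := by
  refine ⟨fun r hr hin' => ?_, fun r hr hin' => ?_, fun r t hr hrw => ?_, fun r g hr hlr => ?_,
    fun s r hr hs hlr => ?_⟩
  · rw [freshFun_of_not_ext fun e => hin (e.root_eq ▸ hin')]
    exact h.inp r hr hin'
  · by_cases e : p.Ext r
    · rcases hπ with rfl | rfl
      · exact .inr (.inl (freshFun_of_ext e hr))
      · exact .inl (freshFun_of_ext e hr)
    · rw [freshFun_of_not_ext e, live_congr (freshFun_of_not_ext e)]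
      exact h.out r hr hin'
  · have hrt : r.WellTyped D Γ := hr.of_step
    have e : ¬ p.Ext r := by
      intro e
      rw [freshFun_of_ext e hrt] at hrw
      rcases hπ with rfl | rfl <;> revert hrw <;> decide
    by_cases e' : p.Ext (r.step t)
    · exact .inr (Path.eq_of_ext_step e' e)
    · rw [freshFun_of_not_ext e] at hrw
      rw [freshFun_of_not_ext e']
      exact .inl (h.rw_step r t hr hrw)
  · have hrt : r.WellTyped D Γ := Path.WellTyped.of_step (s := some g) hr
    by_cases e : p.Ext r
    · left
      rw [Policy.Live, freshFun_of_ext e hrt] at hlr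
      rw [Policy.Live, freshFun_of_ext e.field hr]
      exact hlr
    · by_cases e' : p.Ext (.field r g)
      · exact .inr (Path.eq_of_ext_step (s := some g) e' e)
      · rw [live_congr (freshFun_of_not_ext e)] at hlr
        rw [live_congr (freshFun_of_not_ext e')]
        exact .inl (h.live_field r g hr hlr)
  · have hst : s.WellTyped D Γ := Path.WellTyped.of_step (s := none) (hr.of_ext hs)
    by_cases e : p.Ext s
    · have e' : p.Ext r := e.deref.trans hs
      rw [Policy.Live, freshFun_of_ext e' hr] at hlr
      rw [Policy.Live, freshFun_of_ext e hst]
      exact hlr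
    · rw [live_congr (freshFun_of_not_ext e)]
      by_cases e' : p.Ext r
      · rcases Path.deref_ext_cases hs e' with h1 | h1
        · exact absurd h1 e
        · exact hup s h1
      · rw [live_congr (freshFun_of_not_ext e')] at hlr
        exact h.up s r hr hs hlr

theorem Path.deep_of_field {f : Ident} (h : (Path.field p f).Deep D Γ) : p.Deep D Γ := by
  obtain ⟨τ, h1, h2⟩ := h
  obtain ⟨R, τ', h3, h4⟩ := Path.ty_of_field ⟨τ, h1⟩
  simp only [Path.ty, h3] at h1
  exact ⟨_, h3, .record h1 h2⟩

theorem Path.deep_of_deref (h : (Path.deref p).WellTyped D Γ) : p.Deep D Γ := by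
  obtain ⟨τ, h1⟩ := Path.ty_of_deref h
  exact ⟨_, h1, .access⟩

/-- The far extensions, and no other paths, lose the write permission in a cut. -/
theorem cut_goodBut (h : GoodBut D Γ In Θ q) (hin : ¬ In q.root)
    (hq : ∀ r : Path, q.Ext r → r.WellTyped D Γ → Θ.Live r) :
    GoodBut D Γ In (cutFun D Γ q Θ) q ∧ ∀ r : Path, r.WellTyped D Γ →
      ((cutFun D Γ q Θ).Live r ↔ Θ.Live r ∧ ¬ (q.Ext r ∧ r.derefs ≠ q.derefs)) := by
  have hlive : ∀ r : Path, r.WellTyped D Γ →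
      ((cutFun D Γ q Θ).Live r ↔ Θ.Live r ∧ ¬ (q.Ext r ∧ r.derefs ≠ q.derefs)) := by
    intro r hr
    by_cases e : q.Ext r
    · by_cases hd : r.derefs = q.derefs
      · refine iff_of_true ?_ ⟨hq r e hr, fun h => h.2 hd⟩
        rcases cutFun_near (Θ := Θ) e hr hd with h | h
        · exact .inl h.1
        · rw [live_congr h.1]; exact hq r e hr
      · exact iff_of_false (Policy.not_live_of_NO (cutFun_far e hr hd)) fun h => h.2 ⟨e, hd⟩
    · rw [live_congr (cutFun_of_not_ext e)]
      simp [e]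
  refine ⟨⟨fun r hr hin' => ?_, fun r hr hin' => ?_, fun r t hr hrw => ?_, fun r g hr hlr => ?_,
    fun s r hr hs hlr => ?_⟩, hlive⟩
  · rw [cutFun_of_not_ext fun e => hin (e.root_eq ▸ hin')]
    exact h.inp r hr hin'
  · by_cases hl : (cutFun D Γ q Θ).Live r
    · exact .inr hl
    · left
      rw [hlive r hr] at hl
      by_cases e : q.Ext r
      · refine cutFun_far e hr fun hd => hl ⟨hq r e hr, fun h => h.2 hd⟩
      · rw [cutFun_of_not_ext e]
        exact (h.out r hr hin').resolve_right fun h => hl ⟨h, fun h => e h.1⟩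
  · have hrt : r.WellTyped D Γ := hr.of_step
    by_cases e : q.Ext r
    · have hnd := ((hlive r hrt).1 (.inr hrw)).2
      have hd : r.derefs = q.derefs := by
        by_contra hd; exact hnd ⟨e, hd⟩
      rcases cutFun_near (Θ := Θ) e hrt hd with h1 | h1
      · rw [h1.1] at hrw
        exact absurd hrw (by decide)
      · rw [h1.1] at hrw
        cases t with
        | none => exact absurd (Path.deep_of_deref hr) h1.2
        | some g =>
          rcases cutFun_near (Θ := Θ) (e.step (some g)) hr hd with h2 | h2
          · exact absurd (Path.deep_of_field h2.2) h1.2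
          · rw [h2.1]; exact h.rw_step r (some g) hr hrw
    · by_cases e' : q.Ext (r.step t)
      · exact .inr (Path.eq_of_ext_step e' e)
      · rw [cutFun_of_not_ext e] at hrw
        rw [cutFun_of_not_ext e']
        exact h.rw_step r t hr hrw
  · rw [hlive _ (Path.WellTyped.of_step (s := some g) hr)] at hlr
    rw [hlive _ hr]
    rcases h.live_field r g hr hlr.1 with h1 | h1
    · by_cases e : Path.field r g = q
      · exact .inr e
      · refine .inl ⟨h1, fun h2 => hlr.2 ⟨?_, h2.2⟩⟩
        by_contra h3
        exact e (Path.eq_of_ext_step (s := some g) h2.1 h3)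
    · exact .inr h1
  · have hst : s.WellTyped D Γ := Path.WellTyped.of_step (s := none) (hr.of_ext hs)
    rw [hlive _ hr] at hlr
    rw [hlive _ hst]
    refine ⟨h.up s r hr hs hlr.1, fun h1 => hlr.2 ⟨h1.1.deref.trans hs, ?_⟩⟩
    have h2 := hs.derefs_le
    have h3 := h1.1.derefs_le
    simp only [Path.derefs] at h2
    omega

/-! ### Effect of the statements on the set of writable paths -/

/-- A move out of a path takes the write permission from its far extensions. -/
theorem move_path_good (h : Good D Γ In Θ) (hq : q.WellTyped D Γ)
    (hm : ((checkP Perm.RW).comp ((cut D Γ).comp block)) q Θ Θ') :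
    Θ q = some Perm.RW ∧ Good D Γ In Θ' ∧ ∀ r : Path, r.WellTyped D Γ →
      (Θ'.Live r ↔ Θ.Live r ∧ ¬ (q.Ext r ∧ r.derefs ≠ q.derefs)) := by
  obtain ⟨_, ⟨hc, rfl⟩, _, rfl, hb⟩ := hm
  rw [Policy.atLeast_RW] at hc
  have hin := h.not_in hq (.inr hc)
  obtain ⟨h1, h2⟩ := cut_goodBut (h.goodBut q) hin fun r hr hrt => .inr (h.rw_ext hc hr hrt)
  obtain ⟨h3, h4⟩ := block_good hb h1 hq ((h2 q hq).2 ⟨.inr hc, fun h => h.2 rfl⟩) (by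
    intro s hs
    rw [h2 s (Path.WellTyped.of_step (s := none) (hq.of_ext hs))]
    exact ⟨h.up s q hq hs (.inr hc), fun h => Path.not_deref_ext_self h.1 hs⟩)
  exact ⟨hc, h3, fun r hr => (h4 r).trans (h2 r hr)⟩

/-- A move of the address of a path takes the write permission from the path and all its
extensions; among the paths without fields, from no others. -/
theorem move_addr_good (h : Good D Γ In Θ) (hq : q.WellTyped D Γ)
    (hm : ((checkP Perm.RW).comp ((fresh D Γ Perm.NO).comp drop)) q Θ Θ') :
    Θ q = some Perm.RW ∧ Good D Γ In Θ' ∧ ∀ r : Path, r.Leaf D Γ →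
      (Θ'.Live r ↔ Θ.Live r ∧ ¬ q.Ext r) := by
  obtain ⟨_, ⟨hc, rfl⟩, _, rfl, hb⟩ := hm
  rw [Policy.atLeast_RW] at hc
  have hin := h.not_in hq (.inr hc)
  have hup := fun (s : Path) (hs : (Path.deref s).Ext q) => h.up s q hq hs (.inr hc)
  obtain ⟨h3, h4⟩ := drop_good hb (fresh_goodBut (.inr rfl) h hin hup) hq hin (by
    intro s hs
    rw [live_congr (freshFun_of_not_ext fun e => Path.not_deref_ext_self e hs)]
    exact hup s hs)
  refine ⟨hc, h3, fun r hr => (h4 r hr).trans ?_⟩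
  by_cases e : q.Ext r
  · exact iff_of_false (Policy.not_live_of_NO (freshFun_of_ext e hr.wellTyped)) fun h => h.2 e
  · rw [live_congr (freshFun_of_not_ext e)]
    simp [e]

/-- A writable path gets `RW` together with all its extensions; no other path without fields gains
the write permission. -/
theorem fresh_lift_good (h : Good D Γ In Θ) (hp : p.WellTyped D Γ) (hl : Θ.Live p)
    (hm : ((fresh D Γ Perm.RW).comp (lift D Γ)) p Θ Θ') :
    Good D Γ In Θ' ∧ (∀ r : Path, r.Leaf D Γ → (Θ'.Live r ↔ Θ.Live r ∨ p.Ext r)) ∧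
      ∀ r : Path, r.WellTyped D Γ → Θ.Live r → Θ'.Live r := by
  obtain ⟨_, rfl, hb⟩ := hm
  obtain ⟨h1, h2⟩ := fresh_RW_good h hp hl
  obtain ⟨h3, h4, h5⟩ := lift_good hb h1 hp (freshFun_of_ext .refl hp)
  exact ⟨h3, fun r hr => (h4 r hr).trans (h2 r hr.wellTyped),
    fun r hr hlr => h5 r ((h2 r hr).2 (.inl hlr))⟩

/-- After an allocation, the near extensions of the dereferenced pointer are writable and its far
extensions are not. -/
theorem alloc_good (h : Good D Γ In Θ) (hp : (Path.deref p).WellTyped D Γ) (hl : Θ.Live p)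
    (hm : ((fresh D Γ Perm.WO).comp ((cut D Γ).comp block)) (.deref p) Θ Θ') :
    Good D Γ In Θ' ∧ ∀ r : Path, r.WellTyped D Γ →
      (Θ'.Live r ↔ (Θ.Live r ∧ ¬ (Path.deref p).Ext r) ∨ ∃ l, r = (Path.deref p).sub l) := by
  obtain ⟨_, rfl, _, rfl, hb⟩ := hm
  have hpt : p.WellTyped D Γ := Path.WellTyped.of_step (s := none) hp
  have hin := h.not_in hpt hl
  have hup : ∀ s : Path, (Path.deref s).Ext (.deref p) → Θ.Live s := by
    intro s hs
    rcases (Path.ext_step_iff (s := none)).1 hs with e | e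
    · cases e; exact hl
    · exact h.up s p hpt e hl
  have h1 := fresh_goodBut (π := Perm.WO) (p := .deref p) (.inl rfl) h hin hup
  obtain ⟨h2, h3⟩ := cut_goodBut h1 hin fun r hr hrt => .inl (freshFun_of_ext hr hrt)
  have hlive : ∀ r : Path, r.WellTyped D Γ →
      ((cutFun D Γ (.deref p) (freshFun D Γ Perm.WO (.deref p) Θ)).Live r ↔
        (Θ.Live r ∧ ¬ (Path.deref p).Ext r) ∨ ∃ l, r = (Path.deref p).sub l) := by
    intro r hr
    rw [h3 r hr]
    by_cases e : (Path.deref p).Ext r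
    · constructor
      · rintro ⟨-, h4⟩
        right
        apply e.near
        by_contra h5
        exact h4 ⟨e, h5⟩
      · rintro (h4 | ⟨l, rfl⟩)
        · exact absurd e h4.2
        · exact ⟨.inl (freshFun_of_ext e hr), fun h => h.2 (Path.derefs_sub _ _)⟩
    · rw [live_congr (freshFun_of_not_ext e)]
      constructor
      · intro h; exact .inl ⟨h.1, e⟩
      · rintro (h4 | ⟨l, rfl⟩)
        · exact ⟨h4.1, fun h => e h.1⟩
        · exact absurd (Path.ext_sub _ _) e
  obtain ⟨h4, h5⟩ := block_good hb h2 hp ((hlive _ hp).2 (.inr ⟨[], rfl⟩)) (by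
    intro s hs
    rw [hlive s (Path.WellTyped.of_step (s := none) (hp.of_ext hs))]
    exact .inl ⟨hup s hs, fun e => Path.not_deref_ext_self e hs⟩)
  exact ⟨h4, fun r hr => (h5 r).trans (hlive r hr)⟩

/-- A path is writable in a meet of two policies when it is writable in both. -/
theorem meet_good {Θ₁ Θ₂ : Policy} (h1 : Good D Γ In Θ₁) (h2 : Good D Γ In Θ₂)
    (h : ∀ p, Θ p = Option.map₂ (fun π₁ π₂ => π₁ ⊓ π₂) (Θ₁ p) (Θ₂ p)) :
    Good D Γ In Θ ∧ ∀ r : Path, r.WellTyped D Γ → (Θ.Live r ↔ Θ₁.Live r ∧ Θ₂.Live r) := by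
  have hrw : ∀ r, Θ r = some Perm.RW ↔ Θ₁ r = some Perm.RW ∧ Θ₂ r = some Perm.RW := by
    intro r
    rw [h r]
    rcases Θ₁ r with _ | ⟨a, b⟩
    · simp
    · rcases Θ₂ r with _ | ⟨c, d⟩
      · simp
      · simp only [Option.map₂_some_some, Option.some.injEq]
        revert a b c d
        decide
  have hlive : ∀ r : Path, Θ.Live r ↔ Θ₁.Live r ∧ Θ₂.Live r := by
    intro r
    simp only [Policy.Live]
    rw [h r]
    rcases Θ₁ r with _ | ⟨a, b⟩
    · simp
    · rcases Θ₂ r with _ | ⟨c, d⟩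
      · simp
      · simp only [Option.map₂_some_some, Option.some.injEq]
        revert a b c d
        decide
  refine ⟨⟨fun r hr hin' => ?_, fun r hr hin' => ?_, fun r t hr e => ?_, fun r g hr hlr => ?_,
    fun s r hr hs hlr => ?_⟩, fun r _ => hlive r⟩
  · rw [h, h1.inp r hr hin', h2.inp r hr hin']; rfl
  · have e1 := h1.out r hr hin'
    have e2 := h2.out r hr hin'
    simp only [Policy.Live] at e1 e2 ⊢
    rw [h]
    rcases e1 with e1 | e1 | e1 <;> rcases e2 with e2 | e2 | e2 <;> rw [e1, e2] <;> decide
  · rw [hrw] at e ⊢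
    exact ⟨h1.rw_step r t hr e.1, h2.rw_step r t hr e.2⟩
  · rw [hlive] at hlr ⊢
    exact ⟨h1.live_field r g hr hlr.1, h2.live_field r g hr hlr.2⟩
  · rw [hlive] at hlr ⊢
    exact ⟨h1.up s r hr hs hlr.1, h2.up s r hr hs hlr.2⟩

/-- Consistency is clear for `RW` and `W`. For `R` it holds because exactly the paths below the `in`
parameters have this permission. -/
theorem Good.consistent (h : Good D Γ In Θ) : Θ.Consistent D Γ := by
  have hro : ∀ (p : Path) (s : Sel), (p.step s).WellTyped D Γ → Θ p = some Perm.RO →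
      Θ (p.step s) = some Perm.RO := by
    intro p s hs hp
    refine h.inp _ hs ?_
    rw [Path.root_step]
    by_contra hin
    rcases h.out p hs.of_step hin with h1 | h1
    · rw [hp] at h1; revert h1; decide
    · exact Policy.not_live_of_RO hp h1
  refine ⟨fun p f hf => ⟨h.rw_step p (some f) hf, hro p (some f) hf, fun hw => ?_⟩,
    fun p hp => ⟨h.rw_step p none hp, hro p none hp⟩⟩
  rw [Policy.atLeast_WO]
  exact h.live_field p f hf (.inl hw)

end

/-! ### The analysis is deterministic -/

section
variable {D : List RecDecl} {Γ : Ctx} {prog : Program}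

theorem block_det {p : Path} {Θ Θ₁ Θ₂ : Policy} (h₁ : block p Θ Θ₁) (h₂ : block p Θ Θ₂) :
    Θ₁ = Θ₂ := by
  induction h₁ with
  | var => cases h₂; rfl
  | deref _ ih => cases h₂ with | deref h => exact ih h
  | fieldStop h =>
    cases h₂ with
    | fieldStop _ => rfl
    | field h' _ => exact absurd (Policy.atLeast_WO.1 h') (Policy.not_live_of_NO h)
  | field h _ ih =>
    cases h₂ with
    | fieldStop h' => exact absurd (Policy.atLeast_WO.1 h) (Policy.not_live_of_NO h')
    | field _ h' => exact ih h'

theorem drop_det {p : Path} {Θ Θ₁ Θ₂ : Policy} (h₁ : drop p Θ Θ₁) (h₂ : drop p Θ Θ₂) :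
    Θ₁ = Θ₂ := by
  induction h₁ with
  | var => cases h₂; rfl
  | deref h => cases h₂ with | deref h' => exact block_det h h'
  | field _ ih => cases h₂ with | field h => exact ih h

theorem lift_det {p : Path} {Θ Θ₁ Θ₂ : Policy} (h₁ : lift D Γ p Θ Θ₁) (h₂ : lift D Γ p Θ Θ₂) :
    Θ₁ = Θ₂ := by
  induction h₁ with
  | var => cases h₂; rfl
  | deref _ ih => cases h₂ with | deref h => exact ih h
  | fieldStop h =>
    cases h₂ with
    | fieldStop _ => rfl
    | field h' _ => exact absurd h' h
  | field h _ ih =>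
    cases h₂ with
    | fieldStop h' => exact absurd h h'
    | field _ h' => exact ih h'

theorem not_deep_of_shallow_path {p : Path} (h : (Expr.path p).Shallow D Γ) : ¬ p.Deep D Γ := by
  rintro ⟨τ, h1, h2⟩
  obtain ⟨τ', h3, h4⟩ := h
  cases h3 with
  | path h3 =>
    rw [h1] at h3
    cases h3
    exact h4 h2

theorem not_shallow_addrOf {p : Path} : ¬ (Expr.addrOf p).Shallow D Γ := by
  rintro ⟨τ, h1, h2⟩
  cases h1
  exact h2 .access

theorem not_shallow_null : ¬ Expr.null.Shallow D Γ := by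
  rintro ⟨τ, h1, h2⟩
  cases h1
  exact h2 .access

theorem move_det {e : Expr} {Θ Θ₁ Θ₂ : Policy} (h₁ : move D Γ e Θ Θ₁) (h₂ : move D Γ e Θ Θ₂) :
    Θ₁ = Θ₂ := by
  cases h₁ with
  | shallow h hc =>
    cases h₂ with
    | shallow _ hc' => exact hc.2.trans hc'.2.symm
    | deepPath h' _ => exact absurd h' (not_deep_of_shallow_path h)
    | addrOf _ => exact absurd h not_shallow_addrOf
    | null => exact absurd h not_shallow_null
  | deepPath h hc =>
    cases h₂ with
    | shallow h' _ => exact absurd h (not_deep_of_shallow_path h')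
    | deepPath _ hc' =>
      obtain ⟨_, ⟨-, rfl⟩, _, rfl, hb⟩ := hc
      obtain ⟨_, ⟨-, rfl⟩, _, rfl, hb'⟩ := hc'
      exact block_det hb hb'
  | addrOf hc =>
    cases h₂ with
    | shallow h' _ => exact absurd h' not_shallow_addrOf
    | addrOf hc' =>
      obtain ⟨_, ⟨-, rfl⟩, _, rfl, hb⟩ := hc
      obtain ⟨_, ⟨-, rfl⟩, _, rfl, hb'⟩ := hc'
      exact drop_det hb hb'
  | null =>
    cases h₂ with
    | shallow h' _ => exact absurd h' not_shallow_null
    | null => rfl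

theorem chain_det {α : Type} {T : Transf α} (hT : ∀ a Θ Θ₁ Θ₂, T a Θ Θ₁ → T a Θ Θ₂ → Θ₁ = Θ₂)
    {l : List α} {Θ Θ₁ Θ₂ : Policy} (h₁ : T.Chain l Θ Θ₁) (h₂ : T.Chain l Θ Θ₂) : Θ₁ = Θ₂ := by
  induction h₁ with
  | nil => cases h₂; rfl
  | cons h _ ih =>
    cases h₂ with
    | cons h' h'' =>
      cases hT _ _ _ _ h h'
      exact ih h''

theorem fresh_lift_det (p : Path) (Θ Θ₁ Θ₂ : Policy)
    (h₁ : ((fresh D Γ Perm.RW).comp (lift D Γ)) p Θ Θ₁)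
    (h₂ : ((fresh D Γ Perm.RW).comp (lift D Γ)) p Θ Θ₂) : Θ₁ = Θ₂ := by
  obtain ⟨_, rfl, hb⟩ := h₁
  obtain ⟨_, rfl, hb'⟩ := h₂
  exact lift_det hb hb'

theorem SafeStmt.det {s : Stmt} {Θ Θ₁ Θ₂ : Policy} (h₁ : SafeStmt prog Γ Θ s Θ₁)
    (h₂ : SafeStmt prog Γ Θ s Θ₂) : Θ₁ = Θ₂ := by
  revert Θ₂
  refine SafeStmt.rec (motive_1 := fun Θ s Θ₁ _ => ∀ {Θ₂}, SafeStmt prog Γ Θ s Θ₂ → Θ₁ = Θ₂)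
    (motive_2 := fun Θ ss Θ₁ _ => ∀ {Θ₂}, SafeSeq prog Γ Θ ss Θ₂ → Θ₁ = Θ₂)
    ?_ ?_ ?_ ?_ ?_ ?_ ?_ h₁
  · intro Θ p e Θ₁ Θ' hm hc Θ₂ h₂
    cases h₂ with
    | assign hm' hc' =>
      cases move_det hm hm'
      obtain ⟨_, ⟨-, rfl⟩, hb⟩ := hc
      obtain ⟨_, ⟨-, rfl⟩, hb'⟩ := hc'
      exact fresh_lift_det _ _ _ _ hb hb'
  · intro Θ p τ Θ₁ Θ' hm hc Θ₂ h₂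
    cases h₂ with
    | alloc hm' hc' =>
      obtain ⟨-, rfl⟩ := hm
      obtain ⟨-, rfl⟩ := hm'
      obtain ⟨_, rfl, _, rfl, hb⟩ := hc
      obtain ⟨_, rfl, _, rfl, hb'⟩ := hc'
      exact block_det hb hb'
  · intro Θ e s₁ s₂ Θ₁ Θ₂ Θ' _ _ _ hmeet ih₁ ih₂ Θ'' h₂
    cases h₂ with
    | ite _ hs₁ hs₂ hmeet' =>
      cases ih₁ hs₁
      cases ih₂ hs₂
      funext p
      rw [hmeet, hmeet']
  · intro Θ e s Θ' _ _ _ _ Θ₂ h₂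
    cases h₂ with
    | loop _ _ _ => rfl
  · intro Θ P args pr Θ₁ Θ₂ Θ₃ Θ' hpr _ _ _ hc Θ'' h₂
    cases h₂ with
    | call hpr' _ _ _ hc' =>
      rw [hpr] at hpr'
      cases hpr'
      exact chain_det fresh_lift_det hc hc'
  · intro Θ Θ₂ h₂
    cases h₂
    rfl
  · intro Θ s ss Θ₁ Θ' _ _ ih₁ ih₂ Θ₂ h₂
    cases h₂ with
    | cons h h' =>
      cases ih₁ h
      exact ih₂ h'

theorem PolicyIn.det {c : Pos} {ss : List Stmt} {Θ Θ₁ Θ₂ : Policy}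
    (h₁ : PolicyIn prog Γ Θ ss c Θ₁) (h₂ : PolicyIn prog Γ Θ ss c Θ₂) : Θ₁ = Θ₂ := by
  induction h₁ with
  | here => cases h₂; rfl
  | next h _ ih =>
    cases h₂ with
    | next h' h'' =>
      cases h.det h'
      exact ih h''
  | thenBranch _ ih => cases h₂ with | thenBranch h => exact ih h
  | elseBranch _ ih => cases h₂ with | elseBranch h => exact ih h
  | loopBody _ ih => cases h₂ with | loopBody h => exact ih h

theorem fresh_det {π : Perm} (p : Path) (Θ Θ₁ Θ₂ : Policy) (h₁ : fresh D Γ π p Θ Θ₁)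
    (h₂ : fresh D Γ π p Θ Θ₂) : Θ₁ = Θ₂ := Eq.trans h₁ (Eq.symm h₂)

theorem fresh_cut_det {π : Perm} (p : Path) (Θ Θ₁ Θ₂ : Policy)
    (h₁ : ((fresh D Γ π).comp (cut D Γ)) p Θ Θ₁)
    (h₂ : ((fresh D Γ π).comp (cut D Γ)) p Θ Θ₂) : Θ₁ = Θ₂ := by
  obtain ⟨_, rfl, h₁⟩ := h₁
  obtain ⟨_, rfl, h₂⟩ := h₂
  exact Eq.trans h₁ (Eq.symm h₂)

theorem InitPolicy.det {pr : Proc} {Θ Θ' : Policy} (h : InitPolicy D pr Θ)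
    (h' : InitPolicy D pr Θ') : Θ = Θ' := by
  obtain ⟨_, _, _, h1, h2, h3, h4⟩ := h
  obtain ⟨_, _, _, h1', h2', h3', h4'⟩ := h'
  cases chain_det fresh_det h1 h1'
  cases chain_det fresh_det h2 h2'
  cases chain_det fresh_cut_det h3 h3'
  exact chain_det fresh_cut_det h4 h4'

theorem PolicyAt.det {pr : Proc} {c : Pos} {Θ Θ' : Policy} (h : PolicyAt prog pr c Θ)
    (h' : PolicyAt prog pr c Θ') : Θ = Θ' := by
  obtain ⟨_, h1, h2⟩ := h
  obtain ⟨_, h1', h2'⟩ := h'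
  cases h1.det h1'
  exact h2.det h2'

end

/-! ### The separation invariant and its transport along store updates -/

section
variable (D : List RecDecl)

/-- The invariant of an execution at a sequence point: the store, the binding and the policy are
well-formed, and a writable path without fields shares its address with no other readable or
writable path without fields. The readable paths that are not writable are those below the variables
in `In`, the `in` parameters. -/
structure Inv (L : STyping) (Γ : Ctx) (In : Ident → Prop) (Θ : Policy) (β : Binding)
    (σ : Store) : Prop where
  store : STyped D L σ
  bind : BTyped D L Γ β
  good : Good D Γ In Θ
  sep : ∀ p q : Path, p.Leaf D Γ → q.Leaf D Γ → Θ.Live p → (Θ.Live q ∨ In q.root) →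
    ∀ a, lval β σ p = some a → lval β σ q = some a → p = q

/-- The addresses of the writable paths without fields. -/
def Footprint (Γ : Ctx) (Θ : Policy) (β : Binding) (σ : Store) : Set Addr :=
  {a | ∃ p : Path, p.Leaf D Γ ∧ Θ.Live p ∧ lval β σ p = some a}

/-- A transition from `σ` to `σ'` with footprint `F` before and `F'` after it: pointers
outside the footprint are unchanged, and the footprint grows by new locations only. -/
structure Frame (F F' : Set Addr) (L L' : STyping) (σ σ' : Store) : Prop where
  le : L.Le L'
  read : ∀ a τ, addrTy D L a = some (.access τ) → a ∉ F → σ'.read a = σ.read a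
  foot : ∀ a ∈ F', a ∈ F ∨ L a.loc = none

end

section
variable {D : List RecDecl} {Γ : Ctx} {In : Ident → Prop} {Θ Θ' Θ₁ : Policy} {L L' : STyping}
  {β : Binding} {σ σ' : Store}

theorem Frame.of_subset {F F' : Set Addr} (h : F' ⊆ F) : Frame D F F' L L σ σ :=
  ⟨.refl _, fun _ _ _ _ => rfl, fun _ ha => .inl (h ha)⟩

theorem Frame.trans {F F' F'' : Set Addr} {L'' : STyping} {σ'' : Store}
    (h : Frame D F F' L L' σ σ') (h' : Frame D F' F'' L' L'' σ' σ'') :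
    Frame D F F'' L L'' σ σ'' := by
  have hnone : ∀ ℓ, L' ℓ = none → L ℓ = none := by
    intro ℓ hℓ
    rcases e : L ℓ with _ | τ
    · rfl
    · rw [h.le ℓ τ e] at hℓ; cases hℓ
  refine ⟨h.le.trans h'.le, fun a τ ha hF => ?_, fun a ha => ?_⟩
  · rw [h'.read a τ (addrTy_mono h.le ha) fun ha' => ?_, h.read a τ ha hF]
    rcases h.foot a ha' with h1 | h1
    · exact hF h1
    · exact addrTy_ne_none ha h1
  · rcases h'.foot a ha with h1 | h1
    · exact h.foot a h1
    · exact .inr (hnone _ h1)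

theorem footprint_subset (h : ∀ r : Path, r.Leaf D Γ → Θ'.Live r → Θ.Live r) :
    Footprint D Γ Θ' β σ ⊆ Footprint D Γ Θ β σ := by
  rintro a ⟨p, h1, h2, h3⟩
  exact ⟨p, h1, h p h1 h2, h3⟩

/-- The invariant passes to policies with fewer writable paths. -/
theorem Inv.weaken (I : Inv D L Γ In Θ β σ) (hg : Good D Γ In Θ')
    (h : ∀ r : Path, r.Leaf D Γ → Θ'.Live r → Θ.Live r) : Inv D L Γ In Θ' β σ :=
  ⟨I.store, I.bind, hg, fun p q hp hq hlp hlq =>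
    I.sep p q hp hq (h p hp hlp) (hlq.imp_left (h q hq))⟩

/-- Evaluation along selectors depends only on the pointers read on the way. -/
theorem walk_congr {a : Addr} {w : List Sel}
    (h : ∀ w₁ w₂ c, w = w₁ ++ none :: w₂ → walk σ a w₁ = some c → σ'.read c = σ.read c) :
    walk σ' a w = walk σ a w := by
  induction w generalizing a with
  | nil => rfl
  | cons s w ih =>
    have e : lstep σ' a s = lstep σ a s := by
      cases s with
      | some f => rfl
      | none =>
        simp only [lstep]
        rw [h [] w a rfl rfl]
    simp only [walk]
    rw [e]
    rcases hb : lstep σ a s with _ | b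
    · rfl
    · refine ih fun w₁ w₂ c hw hc => h (s :: w₁) w₂ c (by rw [hw]; rfl) ?_
      simp [walk, hb, hc]

/-- A transition that changes only pointers found at writable paths in `Z` does not affect the
evaluation of a path that passes, from its prefix `p` on, through no pointer in `Z`. -/
theorem Inv.walk_eq (I : Inv D L Γ In Θ β σ) {Z : Path → Prop}
    (hZ : ∀ b τ, addrTy D L b = some (.access τ) → σ'.read b = σ.read b ∨
      ∃ z : Path, z.Leaf D Γ ∧ Θ.Live z ∧ Z z ∧ lval β σ z = some b)
    {p : Path} {w : List Sel} {a : Addr} (hp : lval β σ p = some a)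
    (hwt : (p.app w).WellTyped D Γ)
    (hs : ∀ s : Path, p.Ext s → (Path.deref s).Ext (p.app w) →
      (Θ.Live s ∨ In s.root) ∧ ¬ Z s) :
    walk σ' a w = walk σ a w := by
  refine walk_congr fun w₁ w₂ c hw hc => ?_
  have hext : (Path.deref (p.app w₁)).Ext (p.app w) := by
    rw [hw, Path.app_append]; exact Path.ext_app _ _
  have hd : (Path.deref (p.app w₁)).WellTyped D Γ := hwt.of_ext hext
  have hv : lval β σ (p.app w₁) = some c := by rw [lval_app, hp]; exact hc
  obtain ⟨τ, hτ⟩ := Path.ty_of_deref hd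
  obtain ⟨h1, h2⟩ := hs _ (Path.ext_app _ _) hext
  rcases hZ c τ (lval_typed I.store I.bind hτ hv) with h | ⟨z, hz1, hz2, hz3, hz4⟩
  · exact h
  · exact absurd (I.sep z _ hz1 (Path.leaf_of_deref hd) hz2 h1 c hz4 hv ▸ hz3) h2

/-- The case of `Inv.walk_eq` in which the prefix is the variable of the path. -/
theorem Inv.lval_eq (I : Inv D L Γ In Θ β σ) {Z : Path → Prop}
    (hZ : ∀ b τ, addrTy D L b = some (.access τ) → σ'.read b = σ.read b ∨
      ∃ z : Path, z.Leaf D Γ ∧ Θ.Live z ∧ Z z ∧ lval β σ z = some b)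
    {r : Path} (hwt : r.WellTyped D Γ)
    (hs : ∀ s : Path, (Path.deref s).Ext r → (Θ.Live s ∨ In s.root) ∧ ¬ Z s) :
    lval β σ' r = lval β σ r := by
  obtain ⟨w, hw⟩ := r.root_ext.exists_app
  rw [hw, lval_app, lval_app]
  rcases hb : β r.root with _ | a
  · simp [lval, hb]
  · have := I.walk_eq hZ (p := .var r.root) (w := w) (a := a) hb (by rw [← hw]; exact hwt)
      (fun s _ h => hs s (by rw [hw]; exact h))
    simp [lval, hb, this]

/-- Pointers on the way to a path that is writable, or rooted in an `in` parameter, have the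
same property. -/
theorem Good.up_or (h : Good D Γ In Θ) {r : Path} (hr : r.WellTyped D Γ)
    (hl : Θ.Live r ∨ In r.root) {s : Path} (hs : (Path.deref s).Ext r) :
    Θ.Live s ∨ In s.root := by
  rcases hl with hl | hl
  · exact .inl (h.up s r hr hs hl)
  · right; rw [hs.root_eq] at hl; exact hl

theorem Path.ty_sub {p : Path} {τ : Ty} (hp : p.ty D Γ = some τ) (l : List Ident) :
    (p.sub l).ty D Γ = tyWalk D τ (l.map some) := by
  rw [Path.sub, Path.ty_app, hp]; rfl

/-- The assignment of a value `v` to a writable path `p`. The pointer at the component `l` of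
`v`, if not null, leads to the address of a path `src l` all of whose extensions have been given
up in the policy `Θ₁`, after the move; below `p` in the new store, the far extensions of `p` take
the places of the extensions of these paths in the old one. -/
theorem assign_inv (I : Inv D L Γ In Θ β σ) (h₁ : Good D Γ In Θ₁)
    (hsub : ∀ r : Path, r.Leaf D Γ → Θ₁.Live r → Θ.Live r) {p : Path} {τ : Ty}
    (hp : p.ty D Γ = some τ) (hp₁ : Θ₁.Live p) (h' : Good D Γ In Θ')
    (hlive : ∀ r : Path, r.Leaf D Γ → (Θ'.Live r ↔ Θ₁.Live r ∨ p.Ext r))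
    {v : Value} (hv : VTyped D L v τ) {a : Addr} (ha : lval β σ p = some a)
    (hw : σ.write a v = some σ') (src : List Ident → Path)
    (hsrc : ∀ (l : List Ident) (τ' : Ty) (b : Addr),
      tyWalk D τ (l.map some) = some (.access τ') → v.get l = some (.addr b) →
      lval β σ (src l) = some b ∧ (src l).ty D Γ = some τ' ∧
        ∀ r : Path, r.Leaf D Γ → (src l).Ext r → Θ.Live r ∧ ¬ Θ₁.Live r)
    (hinj : ∀ (l l' : List Ident) (τ₁ τ₂ : Ty) (w w' : List Sel),
      tyWalk D τ (l.map some) = some (.access τ₁) →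
      tyWalk D τ (l'.map some) = some (.access τ₂) →
      (src l).app w = (src l').app w' → l = l') :
    Inv D L Γ In Θ' β σ' ∧
      Frame D (Footprint D Γ Θ β σ) (Footprint D Γ Θ' β σ') L L σ σ' := by
  have hpt : p.WellTyped D Γ := ⟨τ, hp⟩
  have hta := lval_typed I.store I.bind hp ha
  have hin := h₁.not_in hpt hp₁
  -- Only the pointers at near extensions of `p` change.
  let Z : Path → Prop := fun z => Θ₁.Live z ∧ ∃ l, z = p.sub l
  have hZ : ∀ b τ', addrTy D L b = some (.access τ') → σ'.read b = σ.read b ∨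
      ∃ z : Path, z.Leaf D Γ ∧ Θ.Live z ∧ Z z ∧ lval β σ z = some b := by
    intro b τ' hb
    rcases Store.read_write hw hta hb with h | ⟨l, rfl, hl⟩
    · exact .inl h
    · right
      have hty : (p.sub l).ty D Γ = some (.access τ') := by rw [Path.ty_sub hp, hl]
      have hlf := Path.leaf_of_ty_access hty
      have hll := h₁.live_sub hp₁ l ⟨_, hty⟩
      exact ⟨p.sub l, hlf, hsub _ hlf hll, ⟨hll, l, rfl⟩, lval_sub ha l⟩
  have hap : lval β σ' p = some a := by
    rw [I.lval_eq hZ hpt (fun s hs => ⟨.inl ?_, ?_⟩), ha]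
    · exact hsub s (Path.leaf_of_deref (hpt.of_ext hs)) (h₁.up s p hpt hs hp₁)
    · rintro ⟨-, l, rfl⟩
      exact Path.not_deref_ext_self (Path.ext_sub p l) hs
  -- Every address of the new state has an origin in the old one.
  have key : ∀ (r : Path) (b : Addr), r.Leaf D Γ → (Θ'.Live r ∨ In r.root) →
      lval β σ' r = some b → ∃ r₀ : Path, r₀.Leaf D Γ ∧ lval β σ r₀ = some b ∧
        ((r₀ = r ∧ (Θ₁.Live r ∨ In r.root)) ∨ ∃ l τ' w, r = (Path.deref (p.sub l)).app w ∧
          r₀ = (src l).app w ∧ tyWalk D τ (l.map some) = some (.access τ') ∧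
          Θ.Live r₀ ∧ ¬ Θ₁.Live r₀) := by
    intro r b hr hl hb
    by_cases hfar : ∃ l w, r = (Path.deref (p.sub l)).app w
    · obtain ⟨l, w, rfl⟩ := hfar
      obtain ⟨τ', hτ'⟩ := Path.ty_of_deref (hr.wellTyped.of_ext (Path.ext_app _ _))
      have hlτ : tyWalk D τ (l.map some) = some (.access τ') := by rw [← Path.ty_sub hp, hτ']
      rw [lval_app, Option.bind_eq_some_iff] at hb
      obtain ⟨c, hc, hcw⟩ := hb
      obtain ⟨a', ha', hr'⟩ := lval_deref.1 hc
      rw [lval_sub hap] at ha'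
      cases ha'
      rw [Store.read_write_below hw] at hr'
      obtain ⟨h1, h2, h3⟩ := hsrc l τ' c hlτ hr'
      have hlf : ((src l).app w).Leaf D Γ := by
        obtain ⟨τ₀, h4, h5⟩ := hr
        refine ⟨τ₀, ?_, h5⟩
        rw [Path.ty_app, h2]
        rw [Path.ty_app] at h4
        simpa [Path.ty, hτ'] using h4
      refine ⟨_, hlf, ?_, .inr ⟨l, τ', w, rfl, rfl, hlτ, h3 _ hlf (Path.ext_app _ _)⟩⟩
      rw [lval_app, h1, ← hcw]
      refine (I.walk_eq hZ h1 hlf.wellTyped fun s hs hs' => ?_).symm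
      have h4 := h3 s (Path.leaf_of_deref (hlf.wellTyped.of_ext hs')) hs
      exact ⟨.inl h4.1, fun hz => h4.2 hz.1⟩
    · have hl' : Θ₁.Live r ∨ In r.root := by
        refine hl.imp_left fun hl => ?_
        rcases (hlive r hr).1 hl with h | h
        · exact h
        · rcases h.cases_near with ⟨l, rfl⟩ | h
          · exact h₁.live_sub hp₁ l hr.wellTyped
          · exact absurd h hfar
      refine ⟨r, hr, ?_, .inl ⟨rfl, hl'⟩⟩
      rw [← hb]
      refine (I.lval_eq hZ hr.wellTyped fun s hs => ⟨?_, ?_⟩).symm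
      · exact (h₁.up_or hr.wellTyped hl' hs).imp_left
          (hsub s (Path.leaf_of_deref (hr.wellTyped.of_ext hs)))
      · rintro ⟨-, l, rfl⟩
        obtain ⟨w, hw⟩ := hs.exists_app
        exact hfar ⟨l, w, hw⟩
  have hlive₀ : ∀ {r r₀ : Path}, r₀.Leaf D Γ → Θ'.Live r →
      ((r₀ = r ∧ (Θ₁.Live r ∨ In r.root)) ∨ ∃ l τ' w, r = (Path.deref (p.sub l)).app w ∧
          r₀ = (src l).app w ∧ tyWalk D τ (l.map some) = some (.access τ') ∧
          Θ.Live r₀ ∧ ¬ Θ₁.Live r₀) → Θ.Live r₀ := by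
    intro r r₀ hr₀ hl h
    rcases h with ⟨rfl, h | h⟩ | ⟨_, _, _, _, _, _, h, _⟩
    · exact hsub _ hr₀ h
    · exact absurd h (h'.not_in hr₀.wellTyped hl)
    · exact h
  refine ⟨⟨I.store.write hta hv hw, I.bind, h', fun r₁ r₂ hr₁ hr₂ hl₁ hl₂ b hb₁ hb₂ => ?_⟩,
    .refl _, fun b τ' hb hF => ?_, ?_⟩
  · obtain ⟨s₁, hs₁, hv₁, ho₁⟩ := key r₁ b hr₁ (.inl hl₁) hb₁
    obtain ⟨s₂, hs₂, hv₂, ho₂⟩ := key r₂ b hr₂ hl₂ hb₂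
    have hls₁ := hlive₀ hs₁ hl₁ ho₁
    have e : s₁ = s₂ := by
      refine I.sep s₁ s₂ hs₁ hs₂ hls₁ ?_ b hv₁ hv₂
      rcases ho₂ with ⟨rfl, h | h⟩ | ⟨_, _, _, _, _, _, h, _⟩
      · exact .inl (hsub _ hs₂ h)
      · exact .inr h
      · exact .inl h
    subst e
    -- A path in use after the move is not an extension of a moved one.
    have hno : ∀ {r : Path}, Θ.Live s₁ → ¬ Θ₁.Live s₁ → s₁ = r → ¬ (Θ₁.Live r ∨ In r.root) := by
      rintro r h1 h2 rfl (h3 | h3)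
      · exact h2 h3
      · exact I.good.not_in hs₁.wellTyped h1 h3
    rcases ho₁ with ⟨e₁, h1⟩ | ⟨l, τ₁, w, rfl, e₁, hτ₁, h1, h2⟩
    · rcases ho₂ with ⟨e₂, -⟩ | ⟨_, _, _, _, _, _, h3, h4⟩
      · exact e₁.symm.trans e₂
      · exact absurd h1 (hno h3 h4 e₁)
    · rcases ho₂ with ⟨e₂, h3⟩ | ⟨l', τ₂, w', rfl, e₂, hτ₂, -, -⟩
      · exact absurd h3 (hno h1 h2 e₂)
      · have e := e₁.symm.trans e₂
        have hll := hinj l l' τ₁ τ₂ w w' hτ₁ hτ₂ e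
        subst hll
        rw [Path.app_inj e]
  · refine (hZ b τ' hb).resolve_right ?_
    rintro ⟨z, h1, h2, -, h3⟩
    exact hF ⟨z, h1, h2, h3⟩
  · rintro b ⟨r, hr, hl, hb⟩
    obtain ⟨s, hs, hsb, ho⟩ := key r b hr (.inl hl) hb
    exact .inl ⟨s, hs, hlive₀ hs hl ho, hsb⟩

/-! ### Allocation -/

theorem walk_typed (hσ : STyped D L σ) {a b : Addr} {τ τ' : Ty} {w : List Sel}
    (ha : addrTy D L a = some τ) (hw : tyWalk D τ w = some τ') (hb : walk σ a w = some b) :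
    addrTy D L b = some τ' := by
  -- The walk is the evaluation of a path whose variable is bound to `a`.
  have h := lval_typed (Γ := fun _ => some τ) (β := fun _ => some a) (p := (Path.var default).app w)
    (τ := τ') (a := b) hσ
  refine h (fun x τ₁ e => ⟨a, rfl, by cases e; exact ha⟩) ?_ ?_
  · rw [Path.ty_app]; exact hw
  · rw [lval_app]; exact hb

theorem read_extend (hσ : STyped D L σ) (hx : ∀ ℓ, σ ℓ ≠ none → σ' ℓ = σ ℓ) {a : Addr} {τ : Ty}
    (ha : addrTy D L a = some τ) : σ'.read a = σ.read a := by
  simp only [Store.read]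
  rw [hx]
  rw [Ne, hσ.dom]
  exact addrTy_ne_none ha

/-- The allocation of new locations does not affect the evaluation of well-typed paths. -/
theorem walk_extend (hσ : STyped D L σ) (hx : ∀ ℓ, σ ℓ ≠ none → σ' ℓ = σ ℓ) {a : Addr}
    {τ τ' : Ty} {w : List Sel} (ha : addrTy D L a = some τ) (hw : tyWalk D τ w = some τ') :
    walk σ' a w = walk σ a w := by
  refine walk_congr fun w₁ w₂ c e hc => ?_
  rw [e, tyWalk_append, Option.bind_eq_some_iff] at hw
  obtain ⟨τ₁, h1, -⟩ := hw
  exact read_extend hσ hx (walk_typed hσ ha h1 hc)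

theorem lval_extend (hσ : STyped D L σ) (hβ : BTyped D L Γ β)
    (hx : ∀ ℓ, σ ℓ ≠ none → σ' ℓ = σ ℓ) {r : Path} (hr : r.WellTyped D Γ) :
    lval β σ' r = lval β σ r := by
  obtain ⟨w, hw⟩ := r.root_ext.exists_app
  obtain ⟨τ', hτ'⟩ := hr
  rw [hw] at hτ' ⊢
  rw [Path.ty_app, Option.bind_eq_some_iff] at hτ'
  obtain ⟨τ, h1, h2⟩ := hτ'
  obtain ⟨a, h3, h4⟩ := hβ _ τ h1
  rw [lval_app, lval_app]
  simp only [lval, h3, Option.bind_some]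
  exact walk_extend hσ hx h4 h2

theorem update_extend {ℓ : Loc} (v : Option Value) (hℓ : σ ℓ = none) :
    ∀ ℓ', σ ℓ' ≠ none → Function.update σ ℓ v ℓ' = σ ℓ' := by
  intro ℓ' h
  rw [Function.update_of_ne]
  rintro rfl
  exact h hℓ

theorem Inv.extend (I : Inv D L Γ In Θ β σ) (hle : L.Le L') (hσ' : STyped D L' σ')
    (hx : ∀ ℓ, σ ℓ ≠ none → σ' ℓ = σ ℓ) : Inv D L' Γ In Θ β σ' := by
  refine ⟨hσ', I.bind.mono hle, I.good, fun p q hp hq hlp hlq a ha hb => ?_⟩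
  rw [lval_extend I.store I.bind hx hp.wellTyped] at ha
  rw [lval_extend I.store I.bind hx hq.wellTyped] at hb
  exact I.sep p q hp hq hlp hlq a ha hb

theorem Store.write_update {a : Addr} {u d : Value} {ℓ : Loc} (hℓ : a.loc ≠ ℓ)
    (h : σ.write a u = some σ') :
    Store.write (Function.update σ ℓ (some d)) a u = some (Function.update σ' ℓ (some d)) := by
  obtain ⟨v, v', h1, h2, rfl⟩ := Store.write_eq_some h
  simp only [Store.write, Function.update_of_ne hℓ, h1, Option.bind_some, h2, Option.map_some,
    Option.some.injEq]
  exact Function.update_comm hℓ.symm _ _ _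

/-- Allocation. The location is added to the store before the pointer to it is written to `p`: the
first step preserves the invariant by `Inv.extend`, and the second changes only the pointer at `p`.
-/
theorem alloc_inv (hD : RecordsOK D) (I : Inv D L Γ In Θ β σ) {p : Path} {τ : Ty}
    (hp : p.ty D Γ = some (.access τ)) (hl : Θ.Live p) (h' : Good D Γ In Θ')
    (hlive : ∀ r : Path, r.WellTyped D Γ →
      (Θ'.Live r ↔ (Θ.Live r ∧ ¬ (Path.deref p).Ext r) ∨ ∃ l, r = (Path.deref p).sub l))
    {ℓ : Loc} (hℓ : σ ℓ = none) {a : Addr} (ha : lval β σ p = some a)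
    (hw : σ.write a (.addr ⟨ℓ, []⟩) = some σ') :
    ∃ L', Inv D L' Γ In Θ' β (Function.update σ' ℓ (some (defaultValue D τ))) ∧
      Frame D (Footprint D Γ Θ β σ)
        (Footprint D Γ Θ' β (Function.update σ' ℓ (some (defaultValue D τ)))) L L' σ
        (Function.update σ' ℓ (some (defaultValue D τ))) := by
  have hLℓ : L ℓ = none := (I.store.dom ℓ).1 hℓ
  have hta := lval_typed I.store I.bind hp ha
  have haℓ : a.loc ≠ ℓ := by
    intro e
    exact addrTy_ne_none hta (e ▸ hLℓ)
  have hle := le_update τ hLℓ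
  have hx := update_extend (some (defaultValue D τ)) hℓ
  have hw₀ := Store.write_update (d := defaultValue D τ) haℓ hw
  have I₀ : Inv D (Function.update L ℓ (some τ)) Γ In Θ β
      (Function.update σ ℓ (some (defaultValue D τ))) :=
    I.extend hle (I.store.alloc hℓ (defaultValue_typed hD _ _)) hx
  generalize hσ₀ : Function.update σ ℓ (some (defaultValue D τ)) = σ₀ at *
  generalize hσ₁ : Function.update σ' ℓ (some (defaultValue D τ)) = σ₁ at *
  generalize hL₁ : Function.update L ℓ (some τ) = L₁ at *
  have hpt : p.WellTyped D Γ := ⟨_, hp⟩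
  have hdt : (Path.deref p).WellTyped D Γ := ⟨τ, by simp [Path.ty, hp]⟩
  have hplf := Path.leaf_of_ty_access hp
  have hin := I.good.not_in hpt hl
  have ha₀ : lval β σ₀ p = some a := by rw [lval_extend I.store I.bind hx hpt, ha]
  have hu : VTyped D L₁ (.addr ⟨ℓ, []⟩) (.access τ) := by
    refine vtyped_ptr (.inr ⟨_, rfl, ?_⟩)
    simp [addrTy, ← hL₁, tyWalk]
  have hta₀ := addrTy_mono hle hta
  have hZ : ∀ b τ', addrTy D L₁ b = some (.access τ') → Store.read σ₁ b = Store.read σ₀ b ∨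
      ∃ z : Path, z.Leaf D Γ ∧ Θ.Live z ∧ z = p ∧ lval β σ₀ z = some b := by
    intro b τ' hb
    rcases Store.read_write hw₀ hta₀ hb with h | ⟨l, rfl, hl'⟩
    · exact .inl h
    · obtain ⟨rfl, -⟩ := tyWalk_access hl'
      exact .inr ⟨p, hplf, hl, rfl, by rw [ha₀, Addr.sub_nil]⟩
  have hap : lval β σ₁ p = some a := by
    rw [I₀.lval_eq hZ hpt (fun s hs => ⟨.inl (I.good.up s p hpt hs hl), ?_⟩), ha₀]
    rintro rfl
    exact Path.not_deref_ext_self .refl hs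
  have hdp : lval β σ₁ (.deref p) = some ⟨ℓ, []⟩ := by
    rw [lval_deref]
    refine ⟨a, hap, ?_⟩
    have := Store.read_write_below hw₀ []
    rw [Addr.sub_nil] at this
    rw [this, Value.get_nil]
  -- An accessible path lies in the new location or is not affected.
  have key : ∀ (r : Path) (b : Addr), r.Leaf D Γ → (Θ'.Live r ∨ In r.root) →
      lval β σ₁ r = some b → (lval β σ r = some b ∧ (Θ.Live r ∨ In r.root)) ∨
        ∃ l, r = (Path.deref p).sub l ∧ b = ⟨ℓ, l⟩ := by
    intro r b hr hlr hb
    by_cases hn : ∃ l, r = (Path.deref p).sub l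
    · obtain ⟨l, rfl⟩ := hn
      rw [lval_sub hdp] at hb
      cases hb
      exact .inr ⟨l, rfl, rfl⟩
    · left
      have hne : ¬ (Path.deref p).Ext r := by
        intro e
        rcases hlr with hlr | hlr
        · exact (((hlive r hr.wellTyped).1 hlr).resolve_right hn).2 e
        · rw [e.root_eq] at hlr; exact hin hlr
      have hlr' : Θ.Live r ∨ In r.root :=
        hlr.imp_left fun h => (((hlive r hr.wellTyped).1 h).resolve_right hn).1
      refine ⟨?_, hlr'⟩
      rw [← hb, ← lval_extend I.store I.bind hx hr.wellTyped]
      refine (I₀.lval_eq hZ hr.wellTyped fun s hs => ⟨I.good.up_or hr.wellTyped hlr' hs, ?_⟩).symm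
      rintro rfl
      exact hne hs
  have hold : ∀ {r : Path} {b : Addr}, r.Leaf D Γ → lval β σ r = some b → b.loc ≠ ℓ := by
    rintro r b ⟨τ', h1, -⟩ h2 rfl
    exact addrTy_ne_none (lval_typed I.store I.bind h1 h2) hLℓ
  refine ⟨L₁, ⟨I₀.store.write hta₀ hu hw₀, I₀.bind, h',
    fun r₁ r₂ hr₁ hr₂ hl₁ hl₂ b hb₁ hb₂ => ?_⟩, hle, fun b τ' hb hF => ?_, ?_⟩
  · rcases key r₁ b hr₁ (.inl hl₁) hb₁ with ⟨h1, h2⟩ | ⟨l₁, rfl, rfl⟩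
    · rcases key r₂ b hr₂ hl₂ hb₂ with ⟨h3, h4⟩ | ⟨l₂, rfl, rfl⟩
      · have h2 := h2.resolve_right (h'.not_in hr₁.wellTyped hl₁)
        exact I.sep r₁ r₂ hr₁ hr₂ h2 h4 b h1 h3
      · exact absurd rfl (hold hr₁ h1)
    · rcases key r₂ _ hr₂ hl₂ hb₂ with ⟨h3, h4⟩ | ⟨l₂, rfl, e⟩
      · exact absurd rfl (hold hr₂ h3)
      · cases e; rfl
  · have hb' : Store.read σ₀ b = σ.read b := read_extend I.store hx hb
    rw [← hb']
    refine (hZ b τ' (addrTy_mono hle hb)).resolve_right ?_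
    rintro ⟨z, h1, h2, -, h3⟩
    rw [lval_extend I.store I.bind hx h1.wellTyped] at h3
    exact hF ⟨z, h1, h2, h3⟩
  · rintro b ⟨r, hr, hlr, hb⟩
    rcases key r b hr (.inl hlr) hb with ⟨h1, h2⟩ | ⟨l, rfl, rfl⟩
    · exact .inl ⟨r, hr, h2.resolve_right (h'.not_in hr.wellTyped hlr), h1⟩
    · exact .inr hLℓ

/-! ### Assignments -/

/-- The values of shallow expressions have no pointers in them. -/
theorem HasType.not_ptr_of_shallow {e : Expr} {τ τ' : Ty} {l : List Ident}
    (he : HasType D Γ e τ) (hs : e.Shallow D Γ)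
    (hl : tyWalk D τ (l.map some) = some (.access τ')) : False := by
  have hd : τ.Deep D := deep_of_tyWalk hl .access
  obtain ⟨τ₁, h1, h2⟩ := hs
  cases he with
  | path he =>
    cases h1 with
    | path h1 => rw [he] at h1; cases h1; exact h2 hd
  | const => cases hd
  | binop _ _ => cases hd
  | addrOf _ => cases h1; exact h2 .access
  | null => cases h1; exact h2 .access

/-- The source paths for `assign_inv`: a pointer in the value of a deep path `q` is found at a near
extension of `q`, hence leads to the dereference of that; a value `q'Access` leads to `q`. -/
theorem stmt_assign_inv (I : Inv D L Γ In Θ β σ) {p : Path} {e : Expr} {τ : Ty}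
    (hp : p.ty D Γ = some τ) (he : HasType D Γ e τ) (hm : move D Γ e Θ Θ₁)
    (hc : ((checkP Perm.WO).comp ((fresh D Γ Perm.RW).comp (lift D Γ))) p Θ₁ Θ')
    {v : Value} {a : Addr} (hv : eval β σ e = some v) (ha : lval β σ p = some a)
    (hw : σ.write a v = some σ') :
    Inv D L Γ In Θ' β σ' ∧
      Frame D (Footprint D Γ Θ β σ) (Footprint D Γ Θ' β σ') L L σ σ' := by
  obtain ⟨_, ⟨hp₁, rfl⟩, hc⟩ := hc
  rw [Policy.atLeast_WO] at hp₁
  have hpt : p.WellTyped D Γ := ⟨τ, hp⟩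
  have hvt := eval_typed I.store I.bind he hv
  cases hm with
  | shallow hs hchk =>
    obtain ⟨-, rfl⟩ := hchk
    obtain ⟨h1, h2, -⟩ := fresh_lift_good I.good hpt hp₁ hc
    exact assign_inv I I.good (fun _ _ h => h) hp hp₁ h1 h2 hvt ha hw (fun _ => p)
      (fun l τ' b hl => (he.not_ptr_of_shallow hs hl).elim)
      (fun l l' τ₁ τ₂ w w' hl => (he.not_ptr_of_shallow hs hl).elim)
  | @deepPath q _ _ hd hm =>
    cases he with
    | path hq =>
    obtain ⟨h1, h2, h3⟩ := move_path_good I.good ⟨τ, hq⟩ hm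
    obtain ⟨h4, h5, -⟩ := fresh_lift_good h2 hpt hp₁ hc
    refine assign_inv I h2 (fun r hr h => ((h3 r hr.wellTyped).1 h).1) hp hp₁ h4 h5 hvt ha hw
      (fun l => .deref (q.sub l)) (fun l τ' b hl hb => ?_) (fun l l' τ₁ τ₂ w w' _ _ h => ?_)
    · simp only [eval, Option.bind_eq_some_iff] at hv
      obtain ⟨c, hc1, hc2⟩ := hv
      have hty : (q.sub l).ty D Γ = some (.access τ') := by rw [Path.ty_sub hq, hl]
      refine ⟨?_, by simp [Path.ty, hty], fun r hr hext => ?_⟩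
      · rw [lval_deref]
        refine ⟨c.sub l, lval_sub hc1 l, ?_⟩
        rw [Store.read_sub, hc2]
        exact hb
      · have hqr : q.Ext r := (Path.ext_sub q l).trans ((Path.Ext.refl.deref).trans hext)
        refine ⟨.inr (I.good.rw_ext h1 hqr hr.wellTyped), fun h => ?_⟩
        refine ((h3 r hr.wellTyped).1 h).2 ⟨hqr, ?_⟩
        have := hext.derefs_le
        simp only [Path.derefs, Path.derefs_sub] at this
        omega
    · simp only [Path.deref_sub_app] at h
      exact (sel_split_inj (Path.app_inj h)).1
  | @addrOf q _ _ hm =>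
    cases he with
    | @addrOf _ τ₀ hq =>
    obtain ⟨h1, h2, h3⟩ := move_addr_good I.good ⟨_, hq⟩ hm
    obtain ⟨h4, h5, -⟩ := fresh_lift_good h2 hpt hp₁ hc
    refine assign_inv I h2 (fun r hr h => ((h3 r hr).1 h).1) hp hp₁ h4 h5 hvt ha hw
      (fun l => q) (fun l τ' b hl hb => ?_) (fun l l' τ₁ τ₂ w w' hl hl' h => ?_)
    · obtain ⟨rfl, e⟩ := tyWalk_access hl
      cases e
      simp only [eval, Option.map_eq_some_iff] at hv
      obtain ⟨c, hc1, rfl⟩ := hv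
      rw [Value.get_nil] at hb
      cases hb
      exact ⟨hc1, hq, fun r hr hext => ⟨.inr (I.good.rw_ext h1 hext hr.wellTyped),
        fun h => ((h3 r hr).1 h).2 hext⟩⟩
    · rw [(tyWalk_access hl).1, (tyWalk_access hl').1]
  | null =>
    obtain ⟨h1, h2, -⟩ := fresh_lift_good I.good hpt hp₁ hc
    cases hv
    refine assign_inv I I.good (fun _ _ h => h) hp hp₁ h1 h2 hvt ha hw (fun _ => p)
      (fun l τ' b hl hb => ?_) (fun l l' τ₁ τ₂ w w' hl hl' _ => ?_)
    · cases l with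
      | nil => rw [Value.get_nil] at hb; cases hb
      | cons f l => cases hb
    · cases he with
      | null => rw [(tyWalk_access hl).1, (tyWalk_access hl').1]

/-- The invariant gives the CREW condition: distinct paths with one address extend to
distinct paths without fields, with the same selectors and hence with one address. -/
theorem Inv.crew (hD : RecordsOK D) (I : Inv D L Γ In Θ β σ) : CREW D Γ Θ β σ := by
  intro p q hne hp hq a ha hb hl
  rw [Policy.atLeast_WO] at hl
  by_contra hno
  have hlq : Θ.Live q ∨ In q.root := by
    by_cases h : In q.root
    · exact .inr h
    · exact .inl ((I.good.out q hq h).resolve_left hno)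
  obtain ⟨τ, hpτ⟩ := hp
  obtain ⟨τ', hqτ⟩ := hq
  have h1 := lval_typed I.store I.bind hpτ ha
  rw [lval_typed I.store I.bind hqτ hb] at h1
  cases h1
  obtain ⟨l, τ₁, h2, h3⟩ := exists_leaf hD τ
  have hpl : (p.sub l).Leaf D Γ := ⟨τ₁, by rw [Path.ty_sub hpτ, h2], h3⟩
  have hql : (q.sub l).Leaf D Γ := ⟨τ₁, by rw [Path.ty_sub hqτ, h2], h3⟩
  have e := I.sep _ _ hpl hql (I.good.live_sub hl l hpl.wellTyped) (hlq.imp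
    (fun h => I.good.live_sub h l hql.wellTyped)
    (fun h => by rw [(Path.ext_sub q l).root_eq]; exact h)) _ (lval_sub ha l) (lval_sub hb l)
  have hle := congrArg Path.depth e
  rw [Path.sub, Path.sub, Path.depth_app, Path.depth_app] at hle
  rcases Path.comparable_of_ext (Path.ext_sub p l) (e ▸ Path.ext_sub q l) with h | h
  · exact hne (h.eq_of_depth (by omega)).symm
  · exact hne (h.eq_of_depth (by omega))

end

/-! ### The policy at the start of a procedure -/

section
variable {D : List RecDecl} {Γ : Ctx} {In : Ident → Prop} {Θ Θ' : Policy}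

theorem Path.ext_var_root {x : Ident} {p : Path} : (Path.var x).Ext p ↔ p.root = x := by
  constructor
  · intro h; exact h.root_eq
  · rintro rfl; exact p.root_ext

/-- The effect of `fresh` at variables is independent of their order and of repetitions. -/
theorem chain_fresh {π : Perm} {l : List Path} (hl : ∀ p ∈ l, ∃ x, p = .var x)
    (h : (fresh D Γ π).Chain l Θ Θ') (p : Path) (hp : p.WellTyped D Γ) :
    (Path.var p.root ∈ l → Θ' p = some π) ∧ (Path.var p.root ∉ l → Θ' p = Θ p) := by
  induction h with
  | nil => simp
  | @cons q l Θ Θ₁ Θ' h _ ih =>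
    obtain ⟨x, rfl⟩ := hl _ List.mem_cons_self
    obtain ⟨h1, h2⟩ := ih fun q hq => hl q (List.mem_cons_of_mem _ hq)
    have h : Θ₁ = _ := h
    subst h
    by_cases hm : Path.var p.root ∈ l
    · exact ⟨fun _ => h1 hm, fun h => absurd (List.mem_cons_of_mem _ hm) h⟩
    · rw [h2 hm]
      by_cases hx : p.root = x
      · have e := Path.ext_var_root.2 hx
        refine ⟨fun _ => freshFun_of_ext e hp, fun h => absurd ?_ h⟩
        rw [hx]; exact List.mem_cons_self
      · refine ⟨fun h => ?_, fun _ => freshFun_of_not_ext fun e => hx (Path.ext_var_root.1 e)⟩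
        rcases List.mem_cons.1 h with h | h
        · cases h; exact absurd rfl hx
        · exact absurd h hm

theorem chain_fresh_cut {l : List Path} (hl : ∀ p ∈ l, ∃ x, p = .var x)
    (h : ((fresh D Γ Perm.WO).comp (cut D Γ)).Chain l Θ Θ') (p : Path) (hp : p.WellTyped D Γ) :
    (Path.var p.root ∈ l → Θ' p = some (if p.derefs = 0 then Perm.WO else Perm.NO)) ∧
      (Path.var p.root ∉ l → Θ' p = Θ p) := by
  induction h with
  | nil => simp
  | @cons q l Θ Θ₁ Θ' h _ ih =>
    obtain ⟨x, rfl⟩ := hl _ List.mem_cons_self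
    obtain ⟨h1, h2⟩ := ih fun q hq => hl q (List.mem_cons_of_mem _ hq)
    obtain ⟨_, rfl, rfl⟩ := h
    by_cases hm : Path.var p.root ∈ l
    · exact ⟨fun _ => h1 hm, fun h => absurd (List.mem_cons_of_mem _ hm) h⟩
    · rw [h2 hm]
      by_cases hx : p.root = x
      · have e := Path.ext_var_root.2 hx
        refine ⟨fun _ => ?_, fun h => absurd ?_ h⟩
        · by_cases hd : p.derefs = 0
          · rw [if_pos hd]
            rcases cutFun_near (Θ := freshFun D Γ Perm.WO (.var x) Θ) e hp hd with h | h
            · exact h.1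
            · rw [h.1]; exact freshFun_of_ext e hp
          · rw [if_neg hd]; exact cutFun_far e hp hd
        · rw [hx]; exact List.mem_cons_self
      · have e : ¬ (Path.var x).Ext p := fun e => hx (Path.ext_var_root.1 e)
        refine ⟨fun h => ?_, fun _ => ?_⟩
        · rcases List.mem_cons.1 h with h | h
          · cases h; exact absurd rfl hx
          · exact absurd h hm
        · rw [cutFun_of_not_ext e, freshFun_of_not_ext e]

/-- The variables of the `in` parameters. -/
def Proc.IsInput (pr : Proc) (x : Ident) : Prop := Path.var x ∈ pr.paramPaths .input

theorem Proc.mem_paramPaths {pr : Proc} {m : Mode} {x : Ident} :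
    Path.var x ∈ pr.paramPaths m ↔ ∃ a ∈ pr.params, a.mode = m ∧ a.name = x := by
  simp [Proc.paramPaths, and_assoc]

theorem Proc.mem_localPaths {pr : Proc} {x : Ident} :
    Path.var x ∈ pr.localPaths ↔ ∃ d ∈ pr.locals, d.1 = x := by
  simp [Proc.localPaths]

theorem lookup_of_mem {l : List (Ident × Ty)} (hn : (l.map Prod.fst).Nodup) {d : Ident × Ty}
    (hd : d ∈ l) : l.lookup d.1 = some d.2 := by
  induction l with
  | nil => cases hd
  | cons a l ih =>
    rw [List.map_cons, List.nodup_cons] at hn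
    obtain ⟨x, τ⟩ := a
    rcases List.mem_cons.1 hd with rfl | hd
    · simp
    · have : d.1 ≠ x := by
        intro e
        exact hn.1 (List.mem_map.2 ⟨d, hd, e⟩)
      rw [List.lookup_cons, beq_eq_false_iff_ne.2 this]
      exact ih hn.2 hd

section
variable {prog : Program} {pr : Proc}

theorem ProcOK.nodup (h : ProcOK prog pr) :
    ((pr.params.map (fun a => (a.name, a.ty)) ++ pr.locals).map Prod.fst).Nodup := by
  have := h.1
  simpa [List.map_append, Function.comp_def] using this

theorem ProcOK.ctx_param (h : ProcOK prog pr) {a : Param} (ha : a ∈ pr.params) :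
    pr.ctx a.name = some a.ty :=
  lookup_of_mem h.nodup (d := (a.name, a.ty))
    (List.mem_append_left _ (List.mem_map.2 ⟨a, ha, rfl⟩))

theorem Proc.ctx_cases {x : Ident} {τ : Ty} (h : pr.ctx x = some τ) :
    (∃ a ∈ pr.params, a.name = x ∧ a.ty = τ) ∨ ∃ d ∈ pr.locals, d.1 = x ∧ d.2 = τ := by
  simp only [Proc.ctx] at h
  rw [List.lookup_eq_some_iff] at h
  obtain ⟨l₁, l₂, e, -⟩ := h
  have hm : (x, τ) ∈ pr.params.map (fun a => (a.name, a.ty)) ++ pr.locals := by rw [e]; simp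
  rcases List.mem_append.1 hm with hm | hm
  · obtain ⟨a, ha, e⟩ := List.mem_map.1 hm
    cases e
    exact .inl ⟨a, ha, rfl, rfl⟩
  · exact .inr ⟨_, hm, rfl, rfl⟩

theorem ProcOK.param_inj (h : ProcOK prog pr) {a b : Param} (ha : a ∈ pr.params)
    (hb : b ∈ pr.params) (e : a.name = b.name) : a = b :=
  List.inj_on_of_nodup_map (List.nodup_append.1 h.1).1 ha hb e

theorem ProcOK.param_ne_local (h : ProcOK prog pr) {a : Param} (ha : a ∈ pr.params)
    {d : Ident × Ty} (hd : d ∈ pr.locals) : a.name ≠ d.1 :=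
  (List.nodup_append.1 h.1).2.2 _ (List.mem_map_of_mem ha) _ (List.mem_map_of_mem hd)

theorem ProcOK.root_cases {p : Path} (hp : p.WellTyped D pr.ctx) :
    (∃ a ∈ pr.params, a.name = p.root) ∨ ∃ d ∈ pr.locals, d.1 = p.root := by
  obtain ⟨τ, hτ⟩ := hp.of_ext p.root_ext
  rcases Proc.ctx_cases hτ with ⟨a, ha, h, -⟩ | ⟨d, hd, h, -⟩
  · exact .inl ⟨a, ha, h⟩
  · exact .inr ⟨d, hd, h⟩

/-- The initial permissions of the paths below a parameter. -/
theorem InitPolicy.param (hok : ProcOK prog pr) (h : InitPolicy D pr Θ) {p : Path}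
    (hp : p.WellTyped D pr.ctx) {a : Param} (ha : a ∈ pr.params) (hpa : a.name = p.root) :
    (pr.IsInput p.root ↔ a.mode = .input) ∧
    (a.mode = .input → Θ p = some Perm.RO) ∧ (a.mode = .inout → Θ p = some Perm.RW) ∧
    (a.mode = .output → Θ p = some (if p.derefs = 0 then Perm.WO else Perm.NO)) := by
  obtain ⟨Θ₁, Θ₂, Θ₃, h1, h2, h3, h4⟩ := h
  have hv : ∀ m, ∀ q ∈ pr.paramPaths m, ∃ x, q = .var x := by
    intro m q hq
    obtain ⟨b, -, rfl⟩ := List.mem_map.1 hq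
    exact ⟨_, rfl⟩
  have hvl : ∀ q ∈ pr.localPaths, ∃ x, q = .var x := by
    intro q hq
    obtain ⟨b, -, rfl⟩ := List.mem_map.1 hq
    exact ⟨_, rfl⟩
  have hmem : ∀ m, Path.var p.root ∈ pr.paramPaths m ↔ a.mode = m := by
    intro m
    rw [Proc.mem_paramPaths]
    constructor
    · rintro ⟨b, hb, rfl, hbr⟩
      rw [hok.param_inj ha hb (hpa.trans hbr.symm)]
    · intro e; exact ⟨a, ha, e, hpa⟩
  have hnl : Path.var p.root ∉ pr.localPaths := by
    rw [Proc.mem_localPaths]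
    rintro ⟨d, hd, e⟩
    exact hok.param_ne_local ha hd (hpa.trans e.symm)
  have c1 := chain_fresh (hv _) h1 p hp
  have c2 := chain_fresh (hv _) h2 p hp
  have c3 := chain_fresh_cut (hv _) h3 p hp
  have c4 := chain_fresh_cut hvl h4 p hp
  rw [hmem] at c1 c2 c3
  rw [c4.2 hnl]
  refine ⟨hmem _, fun e => ?_, fun e => ?_, fun e => c3.1 e⟩
  · rw [c3.2 (by rw [e]; decide), c2.2 (by rw [e]; decide), c1.1 e]
  · rw [c3.2 (by rw [e]; decide), c2.1 e]

/-- The initial permissions of the paths below a local variable. -/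
theorem InitPolicy.local (hok : ProcOK prog pr) (h : InitPolicy D pr Θ) {p : Path}
    (hp : p.WellTyped D pr.ctx) {d : Ident × Ty} (hd : d ∈ pr.locals) (hpd : d.1 = p.root) :
    ¬ pr.IsInput p.root ∧ Θ p = some (if p.derefs = 0 then Perm.WO else Perm.NO) := by
  obtain ⟨Θ₁, Θ₂, Θ₃, h1, h2, h3, h4⟩ := h
  have hvl : ∀ q ∈ pr.localPaths, ∃ x, q = .var x := by
    intro q hq
    obtain ⟨b, -, rfl⟩ := List.mem_map.1 hq
    exact ⟨_, rfl⟩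
  refine ⟨fun hin => ?_, (chain_fresh_cut hvl h4 p hp).1 (Proc.mem_localPaths.2 ⟨d, hd, hpd⟩)⟩
  obtain ⟨a, ha, -, e⟩ := Proc.mem_paramPaths.1 hin
  exact hok.param_ne_local ha hd (e.trans hpd.symm)

/-- The three kinds of paths in the policy at the start of a procedure. -/
theorem InitPolicy.cases (hok : ProcOK prog pr) (h : InitPolicy D pr Θ) {p : Path}
    (hp : p.WellTyped D pr.ctx) :
    (pr.IsInput p.root ∧ Θ p = some Perm.RO) ∨
    (¬ pr.IsInput p.root ∧ Path.var p.root ∈ pr.paramPaths .inout ∧ Θ p = some Perm.RW) ∨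
    (¬ pr.IsInput p.root ∧ Path.var p.root ∉ pr.paramPaths .inout ∧
      Θ p = some (if p.derefs = 0 then Perm.WO else Perm.NO)) := by
  rcases ProcOK.root_cases hp with ⟨a, ha, e⟩ | ⟨d, hd, e⟩
  · obtain ⟨h1, h2, h3, h4⟩ := h.param hok hp ha e
    have hio : Path.var p.root ∈ pr.paramPaths .inout ↔ a.mode = .inout := by
      rw [Proc.mem_paramPaths]
      constructor
      · rintro ⟨b, hb, hm, hbr⟩
        rw [hok.param_inj ha hb (e.trans hbr.symm), hm]
      · intro e'; exact ⟨a, ha, e', e⟩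
    rw [h1, hio]
    rcases hm : a.mode with _ | _ | _
    · exact .inl ⟨rfl, h2 hm⟩
    · exact .inr (.inl ⟨by decide, rfl, h3 hm⟩)
    · exact .inr (.inr ⟨by decide, by decide, h4 hm⟩)
  · obtain ⟨h1, h2⟩ := h.local hok hp hd e
    refine .inr (.inr ⟨h1, ?_, h2⟩)
    rw [Proc.mem_paramPaths]
    rintro ⟨a, ha, -, e'⟩
    exact hok.param_ne_local ha hd (e'.trans e.symm)

theorem InitPolicy.good (hok : ProcOK prog pr) (h : InitPolicy D pr Θ) :
    Good D pr.ctx pr.IsInput Θ := by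
  have hc := fun (p : Path) (hp : p.WellTyped D pr.ctx) => h.cases hok hp
  refine ⟨fun p hp hin => ?_, fun p hp hin => ?_, fun p s hp hrw => ?_, fun p f hp hl => ?_,
    fun s r hr hs hl => ?_⟩
  · rcases hc p hp with h | h | h
    · exact h.2
    · exact absurd hin h.1
    · exact absurd hin h.1
  · rcases hc p hp with h | h | h
    · exact absurd h.1 hin
    · exact .inr (.inr h.2.2)
    · rw [Policy.Live, h.2.2]
      split
      · exact .inr (.inl rfl)
      · exact .inl rfl
  · have hpt := hp.of_step
    have hr := Path.root_step p s
    rcases hc p hpt with h | h | h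
    · rw [h.2] at hrw; exact absurd hrw (by decide)
    · rcases hc _ hp with h' | h' | h'
      · rw [hr] at h'; exact absurd h'.1 h.1
      · exact h'.2.2
      · rw [hr] at h'; exact absurd h.2.1 h'.2.1
    · rw [h.2.2] at hrw
      split at hrw <;> exact absurd hrw (by decide)
  · have hpt := Path.WellTyped.of_step (s := some f) hp
    rcases hc p hpt with h | h | h
    · exact absurd hl (Policy.not_live_of_RO h.2)
    · rcases hc _ hp with h' | h' | h'
      · exact absurd h'.1 h.1
      · exact .inr h'.2.2
      · exact absurd h.2.1 h'.2.1
    · rcases hc _ hp with h' | h' | h'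
      · exact absurd h'.1 h.1
      · exact absurd h'.2.1 h.2.1
      · rw [Policy.Live, h.2.2] at hl
        rw [Policy.Live, h'.2.2]
        exact hl
  · have hst : s.WellTyped D pr.ctx := Path.WellTyped.of_step (s := none) (hr.of_ext hs)
    have hrs : r.root = s.root := hs.root_eq
    rcases hc r hr with h | h | h
    · exact absurd hl (Policy.not_live_of_RO h.2)
    · rcases hc _ hst with h' | h' | h'
      · rw [← hrs] at h'; exact absurd h'.1 h.1
      · exact .inr h'.2.2
      · rw [← hrs] at h'; exact absurd h.2.1 h'.2.1
    · rw [if_neg] at h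
      · exact absurd hl (Policy.not_live_of_NO h.2.2)
      · have := hs.derefs_le
        simp only [Path.derefs] at this
        omega

/-! ### Allocation of parameters and local variables -/

/-- The state after the allocation of some variables, in terms of the typing `L` of the
caller's store `σ`. The variables that do not refer to the caller's memory have different
locations. -/
structure Entered (D : List RecDecl) (L : STyping) (σ : Store) (L₁ : STyping) (β₁ : Binding)
    (σ₁ : Store) : Prop where
  le : L.Le L₁
  store : STyped D L₁ σ₁
  ext : ∀ ℓ, σ ℓ ≠ none → σ₁ ℓ = σ ℓ
  alloc : ∀ x a, β₁ x = some a → L₁ a.loc ≠ none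
  inj : ∀ x y a b, β₁ x = some a → β₁ y = some b → a.loc = b.loc → L a.loc = none → x = y
  flds : ∀ x a, β₁ x = some a → L a.loc = none → a.flds = []

variable {L L₁ : STyping} {β β₁ : Binding} {σ σ₁ : Store}

theorem none_of_le (hle : L.Le L₁) {ℓ : Loc} (h : L₁ ℓ = none) : L ℓ = none := by
  rcases e : L ℓ with _ | τ
  · rfl
  · rw [hle ℓ τ e] at h; cases h

/-- The allocation of a fresh location for a variable. -/
theorem Entered.fresh (E : Entered D L σ L₁ β₁ σ₁) (hσ : STyped D L σ) {ℓ : Loc} {v : Value}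
    {τ : Ty} (hℓ : σ₁ ℓ = none) (hv : VTyped D L₁ v τ) (x : Ident) :
    Entered D L σ (Function.update L₁ ℓ (some τ)) (Function.update β₁ x (some ⟨ℓ, []⟩))
      (Function.update σ₁ ℓ (some v)) := by
  have hL₁ := (E.store.dom ℓ).1 hℓ
  have hL := none_of_le E.le hL₁
  refine ⟨E.le.trans (le_update τ hL₁), E.store.alloc hℓ hv, fun ℓ' h => ?_, fun y a hy => ?_,
    fun y z a b hy hz e hn => ?_, fun y a hy hn => ?_⟩
  · rw [Function.update_of_ne, E.ext ℓ' h]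
    rintro rfl
    exact h ((hσ.dom _).2 hL)
  · by_cases e : y = x
    · subst e
      rw [Function.update_self] at hy
      cases hy
      simp
    · rw [Function.update_of_ne e] at hy
      have := E.alloc y a hy
      rw [Function.update_of_ne]
      · exact this
      · rintro rfl
        exact this hL₁
  · by_cases e1 : y = x
    · by_cases e2 : z = x
      · rw [e1, e2]
      · subst e1
        rw [Function.update_self] at hy
        cases hy
        rw [Function.update_of_ne e2] at hz
        exact absurd hL₁ (by rw [show ℓ = b.loc from e]; exact E.alloc z b hz)
    · rw [Function.update_of_ne e1] at hy
      by_cases e2 : z = x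
      · subst e2
        rw [Function.update_self] at hz
        cases hz
        exact absurd hL₁ (by rw [show ℓ = a.loc from e.symm]; exact E.alloc y a hy)
      · rw [Function.update_of_ne e2] at hz
        exact E.inj y z a b hy hz e hn
  · by_cases e : y = x
    · subst e
      rw [Function.update_self] at hy
      cases hy
      rfl
    · rw [Function.update_of_ne e] at hy
      exact E.flds y a hy hn

/-- The binding of a variable to an address of the caller's memory. -/
theorem Entered.ref (E : Entered D L σ L₁ β₁ σ₁) {ad : Addr} {τ : Ty}
    (had : addrTy D L ad = some τ) (x : Ident) :
    Entered D L σ L₁ (Function.update β₁ x (some ad)) σ₁ := by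
  have hne := addrTy_ne_none had
  refine ⟨E.le, E.store, E.ext, fun y a hy => ?_, fun y z a b hy hz e hn => ?_,
    fun y a hy hn => ?_⟩
  · by_cases e : y = x
    · subst e
      rw [Function.update_self] at hy
      cases hy
      exact fun h => hne (none_of_le E.le h)
    · rw [Function.update_of_ne e] at hy
      exact E.alloc y a hy
  · have h1 : y ≠ x := by
      rintro rfl
      rw [Function.update_self] at hy
      cases hy
      exact hne hn
    have h2 : z ≠ x := by
      rintro rfl
      rw [Function.update_self] at hz
      cases hz
      exact hne (e ▸ hn)
    rw [Function.update_of_ne h1] at hy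
    rw [Function.update_of_ne h2] at hz
    exact E.inj y z a b hy hz e hn
  · have h1 : y ≠ x := by
      rintro rfl
      rw [Function.update_self] at hy
      cases hy
      exact hne hn
    rw [Function.update_of_ne h1] at hy
    exact E.flds y a hy hn

/-- What the binding and the store of the callee hold for a parameter `a` with argument `e`. -/
def BoundTo (L : STyping) (β : Binding) (σ : Store) (L₁ : STyping) (β₁ : Binding)
    (σ₁ : Store) (a : Param) (e : Expr) : Prop :=
  (a.mode = .input → ∃ v ℓ, eval β σ e = some v ∧ β₁ a.name = some ⟨ℓ, []⟩ ∧ L ℓ = none ∧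
    σ₁ ℓ = some v ∧ L₁ ℓ = some a.ty) ∧
  (a.mode ≠ .input → ∃ q ad, e = .path q ∧ lval β σ q = some ad ∧ β₁ a.name = some ad)

theorem BoundTo.mono {L₂ : STyping} {β₂ : Binding} {σ₂ : Store} {a : Param} {e : Expr}
    (h : BoundTo L β σ L₁ β₁ σ₁ a e) (hβ : β₂ a.name = β₁ a.name) (hL : L₁.Le L₂)
    (hσ : ∀ ℓ, σ₁ ℓ ≠ none → σ₂ ℓ = σ₁ ℓ) : BoundTo L β σ L₂ β₂ σ₂ a e := by
  refine ⟨fun hm => ?_, fun hm => ?_⟩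
  · obtain ⟨v, ℓ, h1, h2, h3, h4, h5⟩ := h.1 hm
    exact ⟨v, ℓ, h1, hβ.trans h2, h3, by rw [hσ ℓ (by rw [h4]; simp), h4], hL _ _ h5⟩
  · obtain ⟨q, ad, h1, h2, h3⟩ := h.2 hm
    exact ⟨q, ad, h1, h2, hβ.trans h3⟩

theorem bindParams_entered (hσ : STyped D L σ) (hβ : BTyped D L Γ β) {ps : List Param}
    {es : List Expr} (h : BindParams β σ ps es β₁ σ₁) (hok : List.Forall₂ (ArgOK D Γ) ps es)
    (hn : (ps.map Param.name).Nodup) :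
    ∃ L₁, Entered D L σ L₁ β₁ σ₁ ∧ ∀ ae ∈ ps.zip es, BoundTo L β σ L₁ β₁ σ₁ ae.1 ae.2 := by
  induction h with
  | nil =>
    exact ⟨L, ⟨.refl L, hσ, fun _ _ => rfl, fun _ _ h => (nomatch h), fun _ _ _ _ h => (nomatch h),
      fun _ _ h => nomatch h⟩, fun _ h => nomatch h⟩
  | @input a ps e es β' σ' v ℓ _ hm hv hℓ ih =>
    obtain ⟨ha, hok⟩ := List.forall₂_cons.1 hok
    rw [List.map_cons, List.nodup_cons] at hn
    obtain ⟨L₁, E, hb⟩ := ih hok hn.2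
    have hvt := (eval_typed hσ hβ ha.1 hv).mono E.le
    have hL₁ := (E.store.dom ℓ).1 hℓ
    refine ⟨_, E.fresh hσ hℓ hvt a.name, fun ae hae => ?_⟩
    rw [List.zip_cons_cons] at hae
    rcases List.mem_cons.1 hae with rfl | hae
    · exact ⟨fun _ => ⟨v, ℓ, hv, Function.update_self .., none_of_le E.le hL₁,
        Function.update_self .., Function.update_self ..⟩, fun h => absurd hm h⟩
    · refine (hb ae hae).mono ?_ (le_update _ hL₁) (update_extend _ hℓ)
      rw [Function.update_of_ne]
      intro e'
      exact hn.1 (e' ▸ List.mem_map_of_mem (List.of_mem_zip hae).1)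
  | @ref a ps p es β' σ' ad _ hm had ih =>
    obtain ⟨ha, hok⟩ := List.forall₂_cons.1 hok
    rw [List.map_cons, List.nodup_cons] at hn
    obtain ⟨L₁, E, hb⟩ := ih hok hn.2
    have hty : p.ty D Γ = some a.ty := by
      cases ha.1 with
      | path h => exact h
    refine ⟨_, E.ref (lval_typed hσ hβ hty had) a.name, fun ae hae => ?_⟩
    rw [List.zip_cons_cons] at hae
    rcases List.mem_cons.1 hae with rfl | hae
    · exact ⟨fun h => absurd h hm, fun _ => ⟨p, ad, rfl, had, Function.update_self ..⟩⟩
    · refine (hb ae hae).mono ?_ (.refl _) (fun _ _ => rfl)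
      rw [Function.update_of_ne]
      intro e'
      exact hn.1 (e' ▸ List.mem_map_of_mem (List.of_mem_zip hae).1)

theorem bindLocals_entered (hD : RecordsOK D) (hσ : STyped D L σ) {ds : List (Ident × Ty)}
    {β₂ : Binding} {σ₂ : Store} (h : BindLocals D ds β₁ σ₁ β₂ σ₂)
    (E : Entered D L σ L₁ β₁ σ₁) (hn : (ds.map Prod.fst).Nodup) :
    ∃ L₂, Entered D L σ L₂ β₂ σ₂ ∧ L₁.Le L₂ ∧ (∀ ℓ, σ₁ ℓ ≠ none → σ₂ ℓ = σ₁ ℓ) ∧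
      (∀ x, x ∉ ds.map Prod.fst → β₂ x = β₁ x) ∧
      ∀ d ∈ ds, ∃ ℓ, β₂ d.1 = some ⟨ℓ, []⟩ ∧ L ℓ = none ∧ L₂ ℓ = some d.2 := by
  induction h with
  | nil => exact ⟨L₁, E, .refl _, fun _ _ => rfl, fun _ _ => rfl, fun _ h => by cases h⟩
  | @cons d ds β σ₁ β' σ' ℓ _ hℓ ih =>
    rw [List.map_cons, List.nodup_cons] at hn
    obtain ⟨L₂, E₂, hle, hx, hβ, hd⟩ := ih E hn.2
    have hL₂ := (E₂.store.dom ℓ).1 hℓ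
    refine ⟨_, E₂.fresh hσ hℓ (defaultValue_typed hD _ _) d.1, hle.trans (le_update _ hL₂),
      fun ℓ' h => ?_, fun x hx' => ?_, fun d' hd' => ?_⟩
    · rw [Function.update_of_ne, hx ℓ' h]
      rintro rfl
      rw [hx _ h] at hℓ
      exact h hℓ
    · rw [List.map_cons, List.mem_cons, not_or] at hx'
      rw [Function.update_of_ne hx'.1, hβ x hx'.2]
    · rcases List.mem_cons.1 hd' with rfl | hd'
      · exact ⟨ℓ, Function.update_self .., none_of_le E₂.le hL₂, Function.update_self ..⟩
      · obtain ⟨ℓ', h1, h2, h3⟩ := hd d' hd'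
        refine ⟨ℓ', ?_, h2, le_update _ hL₂ _ _ h3⟩
        rw [Function.update_of_ne, h1]
        intro e
        exact hn.1 (e ▸ List.mem_map_of_mem hd')

end

/-! ### Arguments of a call -/

/-- Every permission other than `NO` that is granted by `Θ₁` is granted by `Θ`. -/
def Policy.Below (Θ₁ Θ : Policy) : Prop :=
  ∀ p π, π ≠ Perm.NO → Θ₁.AtLeast p π → Θ.AtLeast p π

theorem Path.Comparable.symm {p q : Path} (h : p.Comparable q) : q.Comparable p := Or.symm h

theorem borrow_below (p : Path) : (borrowFun D Γ p Θ).Below Θ := by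
  intro q π hπ h
  by_cases e : p.Comparable q ∧ q.WellTyped D Γ
  · obtain ⟨π', h1, h2⟩ := h
    simp only [borrowFun, if_pos e] at h1
    cases h1
    exfalso
    revert hπ h2
    obtain ⟨a, b⟩ := π
    revert a b
    decide
  · simpa [Policy.AtLeast, borrowFun, if_neg e] using h

theorem freeze_below (p : Path) : (freezeFun p Θ).Below Θ := by
  rintro q π - ⟨π', h1, h2⟩
  simp only [freezeFun] at h1
  split at h1
  · rw [Option.map_eq_some_iff] at h1
    obtain ⟨π₁, h3, rfl⟩ := h1
    exact ⟨π₁, h3, h2.trans inf_le_left⟩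
  · exact ⟨π', h1, h2⟩

theorem not_live_borrow {p q : Path} (h : p.Comparable q) (hq : q.WellTyped D Γ) :
    ¬ (borrowFun D Γ p Θ).Live q :=
  Policy.not_live_of_NO (by simp [borrowFun, h, hq])

theorem not_live_freeze {p q : Path} (h : p.Comparable q) : ¬ (freezeFun p Θ).Live q := by
  simp only [Policy.Live, freezeFun, if_pos h]
  rcases Θ q with _ | ⟨a, b⟩
  · simp
  · simp only [Option.map_some, Option.some.injEq]
    revert a b
    decide

theorem Policy.Below.live {Θ₁ : Policy} (h : Θ₁.Below Θ) {p : Path} (hp : Θ₁.Live p) :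
    Θ.Live p :=
  Policy.atLeast_WO.1 (h p _ (by decide) (Policy.atLeast_WO.2 hp))

/-- A chain of borrows is possible only at pairwise incomparable paths: after the borrow of one
path, the check fails at all paths comparable with it. -/
theorem chain_borrow {π : Perm} (hπ : Perm.WO ≤ π) {l : List Path}
    (hl : ∀ p ∈ l, p.WellTyped D Γ)
    (h : ((checkP π).comp (borrow D Γ)).Chain l Θ Θ') :
    Θ'.Below Θ ∧ (∀ p ∈ l, Θ.AtLeast p π) ∧
      (∀ p ∈ l, ∀ q : Path, q.WellTyped D Γ → p.Comparable q → ¬ Θ'.Live q) ∧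
      l.Pairwise fun p q => ¬ p.Comparable q := by
  have hπ' : π ≠ Perm.NO := by
    rintro rfl
    exact absurd hπ (by decide)
  induction h with
  | nil => exact ⟨fun _ _ _ h => h, by simp, by simp, .nil⟩
  | @cons a l Θ Θ₁ Θ' h _ ih =>
    obtain ⟨_, ⟨hc, rfl⟩, hb⟩ := h
    have hb : Θ₁ = _ := hb
    subst hb
    obtain ⟨h1, h2, h3, h4⟩ := ih fun q hq => hl q (List.mem_cons_of_mem _ hq)
    refine ⟨fun q π' hπ' h => borrow_below a q π' hπ' (h1 q π' hπ' h), fun p hp => ?_,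
      fun p hp q hq hpq => ?_, List.pairwise_cons.2 ⟨fun q hq hcmp => ?_, h4⟩⟩
    · rcases List.mem_cons.1 hp with rfl | hp
      · exact hc
      · exact borrow_below a p π hπ' (h2 p hp)
    · rcases List.mem_cons.1 hp with rfl | hp
      · exact fun h => not_live_borrow hpq hq (h1.live h)
      · exact h3 p hp q hq hpq
    · obtain ⟨π₁, h5, h6⟩ := h2 q hq
      exact not_live_borrow hcmp (hl q (List.mem_cons_of_mem _ hq))
        (Policy.atLeast_WO.1 ⟨π₁, h5, hπ.trans h6⟩)

theorem chain_observe {l : List Expr}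
    (h : ((checkE Perm.RO).comp (observe D Γ)).Chain l Θ Θ') :
    Θ'.Below Θ ∧ (∀ e ∈ l, ∀ p ∈ e.paths, Θ.AtLeast p Perm.RO) ∧
      (∀ e ∈ l, ¬ e.Shallow D Γ → ∀ p, e = .path p ∨ e = .addrOf p →
        ∀ q, p.Comparable q → ¬ Θ'.Live q) := by
  induction h with
  | nil => exact ⟨fun _ _ _ h => h, by simp, by simp⟩
  | @cons e l Θ Θ₁ Θ' h _ ih =>
    obtain ⟨_, ⟨hc, e₀⟩, hb⟩ := h
    rw [e₀] at hb
    obtain ⟨h1, h2, h3⟩ := ih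
    have hbelow : Θ₁.Below Θ := by
      cases hb with
      | shallow => exact fun _ _ _ h => h
      | deepPath _ h => cases h; exact freeze_below _
      | addrOf h => cases h; exact freeze_below _
      | null => exact fun _ _ _ h => h
    refine ⟨fun q π' hπ' h => hbelow q π' hπ' (h1 q π' hπ' h), fun e' he' p hp => ?_,
      fun e' he' hs p hp q hpq => ?_⟩
    · rcases List.mem_cons.1 he' with rfl | he'
      · exact hc p hp
      · exact hbelow p _ (by decide) (h2 e' he' p hp)
    · rcases List.mem_cons.1 he' with rfl | he'
      · intro hl
        have hl := h1.live hl
        cases hb with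
        | shallow h => exact hs h
        | deepPath _ h =>
          cases h
          rcases hp with e | e <;> cases e
          exact not_live_freeze hpq hl
        | addrOf h =>
          cases h
          rcases hp with e | e <;> cases e
          exact not_live_freeze hpq hl
        | null => rcases hp with e | e <;> cases e
      · exact h3 e' he' hs p hp q hpq

theorem mem_argsOf {m : Mode} {ps : List Param} {es : List Expr} {e : Expr} :
    e ∈ argsOf m ps es ↔ ∃ ae ∈ ps.zip es, ae.1.mode = m ∧ ae.2 = e := by
  simp only [argsOf, List.mem_filterMap]
  constructor
  · rintro ⟨ae, h1, h2⟩
    split at h2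
    · rename_i hm
      cases h2
      exact ⟨ae, h1, hm, rfl⟩
    · cases h2
  · rintro ⟨ae, h1, hm, rfl⟩
    exact ⟨ae, h1, by simp [hm]⟩

theorem mem_refArgsOf {m : Mode} {ps : List Param} {es : List Expr} {p : Path} :
    p ∈ refArgsOf m ps es ↔ ∃ ae ∈ ps.zip es, ae.1.mode = m ∧ ae.2 = .path p := by
  simp only [refArgsOf, List.mem_filterMap, mem_argsOf]
  constructor
  · rintro ⟨e, ⟨ae, h1, h2, rfl⟩, h3⟩
    refine ⟨ae, h1, h2, ?_⟩
    cases h : ae.2 <;> rw [h] at h3 <;> simp_all [Expr.path?]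
  · rintro ⟨ae, h1, h2, h3⟩
    exact ⟨_, ⟨ae, h1, h2, rfl⟩, by rw [h3]; rfl⟩

theorem refArgsOf_pairwise {m : Mode} {ps : List Param} {es : List Expr}
    (h : (refArgsOf m ps es).Pairwise fun p q => ¬ p.Comparable q) {a b : Param × Expr}
    (ha : a ∈ ps.zip es) (hb : b ∈ ps.zip es) (hab : a ≠ b) (hma : a.1.mode = m)
    (hmb : b.1.mode = m) {p q : Path} (hp : a.2 = .path p) (hq : b.2 = .path q) :
    ¬ p.Comparable q := by
  rw [refArgsOf, argsOf, List.pairwise_filterMap, List.pairwise_filterMap] at h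
  let R : Param × Expr → Param × Expr → Prop := fun a b => a.1.mode = m → b.1.mode = m →
    ∀ p q, a.2 = .path p → b.2 = .path q → ¬ p.Comparable q
  have hR : Std.Symm R := ⟨fun a b h hma hmb p q hp hq hc => h hmb hma q p hq hp hc.symm⟩
  have h' : (ps.zip es).Pairwise R := by
    refine h.imp ?_
    intro a b h1 hma hmb p q hp hq
    exact h1 _ (by simp only [hma, if_true]; exact congrArg some hp) _
      (by simp only [hmb, if_true]; exact congrArg some hq) p rfl q rfl
  exact h'.forall ha hb hab hma hmb p q hp hq

/-- What the alias analysis of a call guarantees for its arguments. -/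
structure ArgsSafe (D : List RecDecl) (Γ : Ctx) (Θ : Policy) (ps : List Param)
    (es : List Expr) : Prop where
  input : ∀ ae ∈ ps.zip es, ae.1.mode = .input → ∀ p ∈ ae.2.paths, Θ.AtLeast p Perm.RO
  inout : ∀ ae ∈ ps.zip es, ae.1.mode = .inout → ∀ p, ae.2 = .path p → Θ p = some Perm.RW
  ref : ∀ ae ∈ ps.zip es, ae.1.mode ≠ .input → ∀ p, ae.2 = .path p → Θ.Live p
  apart : ∀ ae ∈ ps.zip es, ∀ be ∈ ps.zip es, ae ≠ be → ae.1.mode ≠ .input →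
    be.1.mode ≠ .input → ∀ p q, ae.2 = .path p → be.2 = .path q → ¬ p.Comparable q
  input_apart : ∀ ae ∈ ps.zip es, ∀ be ∈ ps.zip es, ae.1.mode = .input →
    be.1.mode ≠ .input → ¬ ae.2.Shallow D Γ → ∀ p q, ae.2 = .path p ∨ ae.2 = .addrOf p →
    be.2 = .path q → ¬ p.Comparable q

theorem forall₂_zip {ps : List Param} {es : List Expr} (h : List.Forall₂ (ArgOK D Γ) ps es) :
    ∀ ae ∈ ps.zip es, ArgOK D Γ ae.1 ae.2 := by
  rintro ⟨a, e⟩ hae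
  exact (List.forall₂_iff_zip.1 h).2 hae

theorem ArgOK.path {a : Param} {e : Expr} {p : Path} (h : ArgOK D Γ a e) (he : e = .path p) :
    p.ty D Γ = some a.ty := by
  subst he
  cases h.1 with
  | path h => exact h

/-- The arguments are checked one after the other, in policies in which everything comparable with
the earlier ones has been borrowed or frozen. The checks therefore keep them apart. -/
theorem args_safe {ps : List Param} {es : List Expr} {Θ₁ Θ₂ Θ₃ : Policy}
    (hok : List.Forall₂ (ArgOK D Γ) ps es)
    (h1 : ((checkE Perm.RO).comp (observe D Γ)).Chain (argsOf .input ps es) Θ Θ₁)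
    (h2 : ((checkP Perm.RW).comp (borrow D Γ)).Chain (refArgsOf .inout ps es) Θ₁ Θ₂)
    (h3 : ((checkP Perm.WO).comp (borrow D Γ)).Chain (refArgsOf .output ps es) Θ₂ Θ₃) :
    ArgsSafe D Γ Θ ps es := by
  have hwt : ∀ m, ∀ p ∈ refArgsOf m ps es, p.WellTyped D Γ := by
    intro m p hp
    obtain ⟨ae, h, -, e⟩ := mem_refArgsOf.1 hp
    exact ⟨_, (forall₂_zip hok ae h).path e⟩
  obtain ⟨b1, c1, d1⟩ := chain_observe h1
  obtain ⟨b2, c2, d2, e2⟩ := chain_borrow (by decide) (hwt _) h2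
  obtain ⟨b3, c3, d3, e3⟩ := chain_borrow (by decide) (hwt _) h3
  have hmode : ∀ m : Mode, m ≠ .input → m = .inout ∨ m = .output := by
    intro m
    cases m <;> simp
  have hcross : ∀ ae ∈ ps.zip es, ∀ be ∈ ps.zip es, ae.1.mode = .inout →
      be.1.mode = .output → ∀ p q, ae.2 = .path p → be.2 = .path q → ¬ p.Comparable q := by
    intro ae ha be hb hma hmb p q hp hq hc
    have hq' := mem_refArgsOf.2 ⟨be, hb, hmb, hq⟩
    exact d2 p (mem_refArgsOf.2 ⟨ae, ha, hma, hp⟩) q (hwt _ _ hq') hc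
      (Policy.atLeast_WO.1 (c3 q hq'))
  have hRW : ∀ ae ∈ ps.zip es, ae.1.mode = .inout → ∀ p, ae.2 = .path p →
      Θ₁.AtLeast p Perm.RW :=
    fun ae ha hm p hp => c2 p (mem_refArgsOf.2 ⟨ae, ha, hm, hp⟩)
  have hlive : ∀ ae ∈ ps.zip es, ae.1.mode ≠ .input → ∀ p, ae.2 = .path p → Θ₁.Live p := by
    intro ae ha hm p hp
    rcases hmode _ hm with hm | hm
    · exact .inr (Policy.atLeast_RW.1 (hRW ae ha hm p hp))
    · exact b2.live (Policy.atLeast_WO.1 (c3 p (mem_refArgsOf.2 ⟨ae, ha, hm, hp⟩)))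
  refine ⟨fun ae ha hm p hp => c1 ae.2 (mem_argsOf.2 ⟨ae, ha, hm, rfl⟩) p hp,
    fun ae ha hm p hp => Policy.atLeast_RW.1 (b1 p _ (by decide) (hRW ae ha hm p hp)),
    fun ae ha hm p hp => b1.live (hlive ae ha hm p hp),
    fun ae ha be hb hne hma hmb p q hp hq => ?_,
    fun ae ha be hb hma hmb hs p q hp hq hc => ?_⟩
  · rcases hmode _ hma with hma | hma <;> rcases hmode _ hmb with hmb | hmb
    · exact refArgsOf_pairwise e2 ha hb hne hma hmb hp hq
    · exact hcross ae ha be hb hma hmb p q hp hq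
    · exact fun h => hcross be hb ae ha hmb hma q p hq hp h.symm
    · exact refArgsOf_pairwise e3 ha hb hne hma hmb hp hq
  · exact d1 ae.2 (mem_argsOf.2 ⟨ae, ha, hma, rfl⟩) hs p hp q hc (hlive be hb hmb q hq)

/-- The return from a call, at the level of policies. -/
theorem chain_fresh_lift {l : List Path} (h : Good D Γ In Θ)
    (hl : ∀ p ∈ l, p.WellTyped D Γ ∧ Θ.Live p)
    (hc : ((fresh D Γ Perm.RW).comp (lift D Γ)).Chain l Θ Θ') :
    Good D Γ In Θ' ∧
      ∀ r : Path, r.Leaf D Γ → (Θ'.Live r ↔ Θ.Live r ∨ ∃ p ∈ l, p.Ext r) := by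
  induction hc with
  | nil => exact ⟨h, by simp⟩
  | @cons p l Θ Θ₁ Θ' h1 _ ih =>
    obtain ⟨hp, hlp⟩ := hl p List.mem_cons_self
    obtain ⟨g1, g2, g3⟩ := fresh_lift_good h hp hlp h1
    obtain ⟨g4, g5⟩ := ih g1 fun q hq =>
      have := hl q (List.mem_cons_of_mem _ hq)
      ⟨this.1, g3 q this.1 this.2⟩
    refine ⟨g4, fun r hr => ?_⟩
    rw [g5 r hr, g2 r hr, or_assoc]
    simp

end

/-! ### Procedure calls -/

section
variable {prog : Program} {pr : Proc} {D : List RecDecl} {Γ : Ctx} {In : Ident → Prop}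
  {Θ Θ' ΘQ : Policy} {L LQ L' : STyping} {β β₁ βQ : Binding} {σ σ₁ σQ σ' : Store}

theorem exists_arg {ps : List Param} {es : List Expr} (h : ps.length = es.length) {a : Param}
    (ha : a ∈ ps) : ∃ e, (a, e) ∈ ps.zip es := by
  rw [← List.map_fst_zip h.le] at ha
  obtain ⟨⟨a', e⟩, h1, rfl⟩ := List.mem_map.1 ha
  exact ⟨e, h1⟩

theorem Path.Leaf.congr {Γ' : Ctx} {p q : Path} {w : List Sel} {τ : Ty} (hp : p.ty D Γ = some τ)
    (hq : q.ty D Γ' = some τ) (h : (p.app w).Leaf D Γ) : (q.app w).Leaf D Γ' := by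
  obtain ⟨τ', h1, h2⟩ := h
  refine ⟨τ', ?_, h2⟩
  rw [Path.ty_app, hp] at h1
  rw [Path.ty_app, hq]
  exact h1

/-- A path of the caller is evaluated in the store of the callee by starting from the address of a
prefix. -/
theorem walk_eq_lval (hσ : STyped D L σ) (hβ : BTyped D L Γ β)
    (hx : ∀ ℓ, σ ℓ ≠ none → σQ ℓ = σ ℓ) {p : Path} {w : List Sel} {a : Addr}
    (hp : lval β σ p = some a) (hw : (p.app w).WellTyped D Γ) :
    lval β σ (p.app w) = walk σQ a w := by
  obtain ⟨τ', hτ'⟩ := hw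
  rw [Path.ty_app, Option.bind_eq_some_iff] at hτ'
  obtain ⟨τ, h1, h2⟩ := hτ'
  rw [walk_extend hσ hx (lval_typed hσ hβ h1 hp) h2, lval_app, hp]
  rfl

/-- A readable path in a good policy has readable extensions: they are writable, or rooted in
an `in` parameter. -/
theorem Good.readable_ext (h : Good D Γ In Θ) {p r : Path} (hp : Θ.AtLeast p Perm.RO)
    (hpr : p.Ext r) (hr : r.WellTyped D Γ) : Θ.Live r ∨ In r.root := by
  rcases Policy.atLeast_RO.1 hp with hp | hp
  · right
    rw [hpr.root_eq]
    by_contra hin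
    rcases h.out p (hr.of_ext hpr) hin with h1 | h1
    · rw [hp] at h1; exact absurd h1 (by decide)
    · exact Policy.not_live_of_RO hp h1
  · exact .inl (.inr (h.rw_ext hp hpr hr))

theorem Path.near_var {r : Path} (h : r.derefs = 0) : ∃ l, r = (Path.var r.root).sub l :=
  r.root_ext.near h

/-- The origin of the address `b` of an accessible path `r` of the callee: a location allocated
by the call, or the address of an accessible extension of an argument in the caller. -/
def Origin (D : List RecDecl) (Γ : Ctx) (In : Ident → Prop) (Θ : Policy) (L : STyping)
    (β : Binding) (σ : Store) (ps : List Param) (es : List Expr) (βQ : Binding) (r : Path)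
    (b : Addr) : Prop :=
  (βQ r.root = some ⟨b.loc, []⟩ ∧ L b.loc = none ∧ r = (Path.var r.root).sub b.flds) ∨
  ∃ ae ∈ ps.zip es, ae.1.name = r.root ∧ ∃ q r₀, q.Ext r₀ ∧ r₀.Leaf D Γ ∧
    lval β σ r₀ = some b ∧
    ((ae.1.mode ≠ .input ∧ ae.2 = .path q ∧ Θ.Live r₀ ∧
        ∃ w, r = (Path.var r.root).app w ∧ r₀ = q.app w) ∨
      (ae.1.mode = .input ∧ (ae.2 = .path q ∨ ae.2 = .addrOf q) ∧ ¬ ae.2.Shallow D Γ ∧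
        (Θ.Live r₀ ∨ In r₀.root)))

/-- The value of an `in` argument is copied to a new location; its pointers lead to extensions of
the path in the argument, which is readable. -/
theorem origin_of_input (I : Inv prog.records L Γ In Θ β σ) (hok : ProcOK prog pr)
    {args : List Expr} (hargs : List.Forall₂ (ArgOK prog.records Γ) pr.params args)
    (A : ArgsSafe prog.records Γ Θ pr.params args) (hx : ∀ ℓ, σ ℓ ≠ none → σQ ℓ = σ ℓ)
    (hB : ∀ ae ∈ pr.params.zip args, BoundTo L β σ LQ βQ σQ ae.1 ae.2) {a : Param} {e : Expr}
    (hae : (a, e) ∈ pr.params.zip args) (hm : a.mode = .input) {r : Path} {b : Addr}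
    (hr : r.Leaf prog.records pr.ctx) (hroot : a.name = r.root) (hb : lval βQ σQ r = some b) :
    Origin prog.records Γ In Θ L β σ pr.params args βQ r b := by
  obtain ⟨v, ℓ, hv, hβ, hℓ, hσv, -⟩ := (hB _ hae).1 hm
  simp only at hv hβ
  rw [hroot] at hβ
  have hvar : lval βQ σQ (.var r.root) = some ⟨ℓ, []⟩ := hβ
  rcases r.root_ext.cases_near with ⟨l, hl⟩ | ⟨l, w, hlw⟩
  · left
    rw [hl, lval_sub hvar] at hb
    have hb : b = ⟨ℓ, l⟩ := by cases hb; simp [Addr.sub]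
    subst hb
    exact ⟨hβ, hℓ, hl⟩
  · right
    have hctx : (Path.var r.root).ty prog.records pr.ctx = some a.ty := by
      rw [← hroot]; exact hok.ctx_param (List.of_mem_zip hae).1
    have hdt : (Path.deref ((Path.var r.root).sub l)).WellTyped prog.records pr.ctx :=
      hr.wellTyped.of_ext (by
        have h := Path.ext_app (Path.deref ((Path.var r.root).sub l)) w
        rwa [← hlw] at h)
    obtain ⟨τ', hτ'⟩ := Path.ty_of_deref hdt
    have hlτ : tyWalk prog.records a.ty (l.map some) = some (.access τ') := by
      rw [← Path.ty_sub hctx, hτ']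
    have hty : (Path.deref ((Path.var r.root).sub l)).ty prog.records pr.ctx = some τ' := by
      simp [Path.ty, hτ']
    rw [hlw, lval_app, Option.bind_eq_some_iff] at hb
    obtain ⟨c, hc, hcw⟩ := hb
    obtain ⟨a', ha', hr'⟩ := lval_deref.1 hc
    rw [lval_sub hvar] at ha'
    cases ha'
    have hread : Store.read σQ ⟨ℓ, []⟩ = some v := by simp [Store.read, hσv, Value.get_nil]
    rw [Store.read_sub, hread] at hr'
    simp only [Option.bind_some] at hr'
    have harg := forall₂_zip hargs _ hae
    have hns : ¬ e.Shallow prog.records Γ := fun hs => harg.1.not_ptr_of_shallow hs hlτ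
    rw [hlw] at hr
    -- The path `s₀` of the caller to which the pointer at `l` leads is an extension of the
    -- path in the argument.
    have main : ∀ q s₀ : Path, (e = .path q ∨ e = .addrOf q) → q ∈ e.paths → q.Ext s₀ →
        s₀.ty prog.records Γ = some τ' → lval β σ s₀ = some c →
        ∃ ae ∈ pr.params.zip args, ae.1.name = r.root ∧ ∃ q r₀, q.Ext r₀ ∧
          r₀.Leaf prog.records Γ ∧ lval β σ r₀ = some b ∧
          ((ae.1.mode ≠ .input ∧ ae.2 = .path q ∧ Θ.Live r₀ ∧
            ∃ w, r = (Path.var r.root).app w ∧ r₀ = q.app w) ∨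
          (ae.1.mode = .input ∧ (ae.2 = .path q ∨ ae.2 = .addrOf q) ∧
            ¬ ae.2.Shallow prog.records Γ ∧ (Θ.Live r₀ ∨ In r₀.root))) := by
      intro q s₀ he hq hqs hs₀ hc
      have hlf : (s₀.app w).Leaf prog.records Γ := hr.congr hty hs₀
      have hqr := hqs.trans (Path.ext_app s₀ w)
      refine ⟨(a, e), hae, hroot, q, s₀.app w, hqr, hlf, ?_, .inr ⟨hm, he, hns, ?_⟩⟩
      · rw [walk_eq_lval I.store I.bind hx hc hlf.wellTyped, hcw]
      · exact I.good.readable_ext (A.input _ hae hm q hq) hqr hlf.wellTyped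
    obtain ⟨hht, -⟩ := harg
    generalize hT : a.ty = T at hht hlτ
    simp only at hht
    cases hht with
    | @path q _ hq =>
      simp only [eval, Option.bind_eq_some_iff] at hv
      obtain ⟨c₀, hc1, hc2⟩ := hv
      have hql : (q.sub l).ty prog.records Γ = some (.access τ') := by rw [Path.ty_sub hq, hlτ]
      refine main q (.deref (q.sub l)) (.inl rfl) (by simp [Expr.paths]) (Path.ext_sub q l).deref
        (by simp [Path.ty, hql]) ?_
      rw [lval_deref]
      exact ⟨c₀.sub l, lval_sub hc1 l, by rw [Store.read_sub, hc2]; exact hr'⟩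
    | const => exact nomatch (tyWalk_scalar hlτ).2
    | binop _ _ => exact nomatch (tyWalk_scalar hlτ).2
    | @addrOf q τ hq =>
      obtain ⟨rfl, e⟩ := tyWalk_access hlτ
      cases e
      simp only [eval, Option.map_eq_some_iff] at hv
      obtain ⟨c₀, hc1, rfl⟩ := hv
      rw [Value.get_nil] at hr'
      cases hr'
      exact main q q (.inr rfl) (by simp [Expr.paths]) .refl hq hc1
    | null =>
      obtain ⟨rfl, -⟩ := tyWalk_access hlτ
      cases hv
      rw [Value.get_nil] at hr'
      cases hr'

/-- An `in-out` or `out` parameter has the address of its argument. Far extensions of an `out`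
parameter are not accessible at the start, hence writability of the argument is enough in this case.
-/
theorem origin_of_ref (I : Inv prog.records L Γ In Θ β σ) (hok : ProcOK prog pr)
    {args : List Expr} (hargs : List.Forall₂ (ArgOK prog.records Γ) pr.params args)
    (A : ArgsSafe prog.records Γ Θ pr.params args) (hx : ∀ ℓ, σ ℓ ≠ none → σQ ℓ = σ ℓ)
    (hB : ∀ ae ∈ pr.params.zip args, BoundTo L β σ LQ βQ σQ ae.1 ae.2)
    (hinit : InitPolicy prog.records pr ΘQ) {a : Param} {e : Expr}
    (hae : (a, e) ∈ pr.params.zip args) (hm : a.mode ≠ .input) {r : Path} {b : Addr}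
    (hr : r.Leaf prog.records pr.ctx) (hroot : a.name = r.root) (hl : ΘQ.Live r)
    (hb : lval βQ σQ r = some b) :
    Origin prog.records Γ In Θ L β σ pr.params args βQ r b := by
  right
  obtain ⟨q, ad, he, had, hβ⟩ := (hB _ hae).2 hm
  simp only at he hβ
  rw [hroot] at hβ
  have hmem := (List.of_mem_zip hae).1
  obtain ⟨-, -, h3, h4⟩ := hinit.param hok hr.wellTyped hmem hroot
  obtain ⟨w, hw⟩ := r.root_ext.exists_app
  have hctx : (Path.var r.root).ty prog.records pr.ctx = some a.ty := by
    rw [← hroot]; exact hok.ctx_param hmem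
  have hq := (forall₂_zip hargs _ hae).path he
  have hlf : (q.app w).Leaf prog.records Γ := by
    rw [hw] at hr
    exact hr.congr hctx hq
  refine ⟨(a, e), hae, hroot, q, q.app w, Path.ext_app _ _, hlf, ?_, .inl ⟨hm, he, ?_, w, hw, rfl⟩⟩
  · rw [walk_eq_lval I.store I.bind hx had hlf.wellTyped, ← hb, hw, lval_app]
    simp [lval, hβ]
  · rcases hm' : a.mode with _ | _ | _
    · exact absurd hm' hm
    · exact .inr (I.good.rw_ext (A.inout _ hae hm' q he) (Path.ext_app _ _) hlf.wellTyped)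
    · have hd : r.derefs = 0 := by
        by_contra hd
        have h5 := h4 hm'
        rw [if_neg hd] at h5
        exact Policy.not_live_of_NO h5 hl
      obtain ⟨l, hl'⟩ := Path.near_var hd
      have : w = l.map some := Path.app_inj (hw.symm.trans hl')
      subst this
      exact I.good.live_sub (A.ref _ hae hm q he) l hlf.wellTyped

/-- The invariant at the start of the body of a called procedure. -/
theorem call_entry (hD : RecordsOK prog.records) (hok : ProcOK prog pr)
    (I : Inv prog.records L Γ In Θ β σ) {args : List Expr}
    (hargs : List.Forall₂ (ArgOK prog.records Γ) pr.params args)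
    (A : ArgsSafe prog.records Γ Θ pr.params args)
    (hp : BindParams β σ pr.params args β₁ σ₁)
    (hl : BindLocals prog.records pr.locals β₁ σ₁ βQ σQ)
    (hinit : InitPolicy prog.records pr ΘQ) :
    ∃ LQ, Inv prog.records LQ pr.ctx pr.IsInput ΘQ βQ σQ ∧ L.Le LQ ∧
      (∀ ℓ, σ ℓ ≠ none → σQ ℓ = σ ℓ) ∧
      (∀ ae ∈ pr.params.zip args, BoundTo L β σ LQ βQ σQ ae.1 ae.2) ∧
      ∀ r b, r.Leaf prog.records pr.ctx → (ΘQ.Live r ∨ pr.IsInput r.root) →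
        lval βQ σQ r = some b → Origin prog.records Γ In Θ L β σ pr.params args βQ r b := by
  obtain ⟨hn₁, hn₂, -⟩ := List.nodup_append.1 hok.1
  obtain ⟨L₁, E₁, hB₁⟩ := bindParams_entered I.store I.bind hp hargs hn₁
  obtain ⟨LQ, E, hle, hx, hβ, hloc⟩ := bindLocals_entered hD I.store hl E₁ hn₂
  have hlen := (List.forall₂_iff_zip.1 hargs).1
  have hB : ∀ ae ∈ pr.params.zip args, BoundTo L β σ LQ βQ σQ ae.1 ae.2 := by
    intro ae hae
    refine (hB₁ ae hae).mono (hβ _ fun h => ?_) hle hx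
    obtain ⟨d, hd, e⟩ := List.mem_map.1 h
    exact hok.param_ne_local (List.of_mem_zip hae).1 hd e.symm
  have horig : ∀ r b, r.Leaf prog.records pr.ctx → (ΘQ.Live r ∨ pr.IsInput r.root) →
      lval βQ σQ r = some b → Origin prog.records Γ In Θ L β σ pr.params args βQ r b := by
    intro r b hr hlr hb
    rcases ProcOK.root_cases hr.wellTyped with ⟨a, ha, e⟩ | ⟨d, hd, e⟩
    · obtain ⟨ex, hae⟩ := exists_arg hlen ha
      by_cases hm : a.mode = .input
      · exact origin_of_input I hok hargs A E.ext hB hae hm hr e hb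
      · have hni := fun h => hm ((hinit.param hok hr.wellTyped ha e).1.1 h)
        exact origin_of_ref I hok hargs A E.ext hB hinit hae hm hr e (hlr.resolve_right hni) hb
    · obtain ⟨hni, hpol⟩ := hinit.local hok hr.wellTyped hd e
      have hlr := hlr.resolve_right hni
      have hd0 : r.derefs = 0 := by
        by_contra h
        rw [if_neg h] at hpol
        exact Policy.not_live_of_NO hpol hlr
      obtain ⟨l, hl'⟩ := Path.near_var hd0
      obtain ⟨ℓ, h1, h2, -⟩ := hloc d hd
      rw [e] at h1
      have hvar : lval βQ σQ (.var r.root) = some ⟨ℓ, []⟩ := h1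
      rw [hl', lval_sub hvar] at hb
      have hb : b = ⟨ℓ, l⟩ := by cases hb; simp [Addr.sub]
      subst hb
      exact .inl ⟨h1, h2, hl'⟩
  have hold : ∀ {r : Path} {b : Addr}, r.Leaf prog.records Γ → lval β σ r = some b →
      L b.loc ≠ none := by
    rintro r b ⟨τ', h1, -⟩ h2
    exact addrTy_ne_none (lval_typed I.store I.bind h1 h2)
  have hgood := hinit.good hok
  refine ⟨LQ, ⟨E.store, fun x τ hxτ => ?_, hgood, fun r₁ r₂ hr₁ hr₂ hl₁ hl₂ b hb₁ hb₂ => ?_⟩,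
    E.le, E.ext, hB, horig⟩
  · rcases Proc.ctx_cases hxτ with ⟨a, ha, rfl, rfl⟩ | ⟨d, hd, rfl, rfl⟩
    · obtain ⟨ex, hae⟩ := exists_arg hlen ha
      by_cases hm : a.mode = .input
      · obtain ⟨v, ℓ, -, h2, -, -, h5⟩ := (hB _ hae).1 hm
        exact ⟨_, h2, by simpa [addrTy, tyWalk] using h5⟩
      · obtain ⟨q, ad, h1, h2, h3⟩ := (hB _ hae).2 hm
        exact ⟨ad, h3, addrTy_mono E.le
          (lval_typed I.store I.bind ((forall₂_zip hargs _ hae).path h1) h2)⟩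
    · obtain ⟨ℓ, h1, -, h3⟩ := hloc d hd
      exact ⟨_, h1, by simpa [addrTy, tyWalk] using h3⟩
  · rcases horig r₁ b hr₁ (.inl hl₁) hb₁ with ⟨h1, h2, h3⟩ | ⟨ae, hae, ha, q, s, hqs, hs, hsb, ho⟩
    · rcases horig r₂ b hr₂ hl₂ hb₂ with ⟨h4, -, h6⟩ | ⟨_, _, _, _, s', _, hs', hsb', _⟩
      · rw [h3, h6, E.inj _ _ _ _ h1 h4 rfl h2]
      · exact absurd h2 (hold hs' hsb')
    · have hmode : ae.1.mode ≠ .input := by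
        intro hm
        exact hgood.not_in hr₁.wellTyped hl₁
          ((hinit.param hok hr₁.wellTyped (List.of_mem_zip hae).1 ha).1.2 hm)
      obtain ⟨-, he, hls, w, hw, rfl⟩ := ho.resolve_right fun h => hmode h.1
      rcases horig r₂ b hr₂ hl₂ hb₂ with
        ⟨-, h5, -⟩ | ⟨ae', hae', ha', q', s', hqs', hs', hsb', ho'⟩
      · exact absurd h5 (hold hs hsb)
      · have hes : q.app w = s' := by
          refine I.sep _ s' hs hs' hls ?_ b hsb hsb'
          rcases ho' with h | h
          · exact .inl h.2.2.1
          · exact h.2.2.2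
        subst hes
        have hcmp := Path.comparable_of_ext hqs hqs'
        by_cases hee : ae = ae'
        · subst hee
          obtain ⟨-, he', -, w', hw', hww⟩ := ho'.resolve_right fun h => hmode h.1
          rw [he] at he'
          cases he'
          rw [hw, hw', ← ha, ← ha', Path.app_inj hww]
        · rcases ho' with ⟨hm', he', -⟩ | ⟨hm', he', hns, -⟩
          · exact absurd hcmp (A.apart ae hae ae' hae' hee hmode hm' q q' he he')
          · exact absurd hcmp.symm (A.input_apart ae' hae' ae hae hm' hmode hns q' q he' he)

/-- The invariant after the return from a call. The relation `Arg` relates the `in-out` and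
`out` arguments to the names of the parameters. -/
theorem call_return {ΓQ : Ctx} {InQ : Ident → Prop} {ΘQ' : Policy} (I : Inv D L Γ In Θ β σ)
    {Arg : Path → Ident → Prop} (huniq : ∀ q q' y, Arg q y → Arg q' y → q = q')
    (hapart : ∀ q q' y y', Arg q y → Arg q' y' → q ≠ q' → ¬ q.Comparable q')
    (hargl : ∀ q y, Arg q y → Θ.Live q)
    (hty : ∀ q y, Arg q y → ∃ τ, q.ty D Γ = some τ ∧ ΓQ y = some τ)
    (hbind : ∀ q y, Arg q y → ∃ ad, lval β σ q = some ad ∧ βQ y = some ad)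
    (hle : L.Le LQ) (hx : ∀ ℓ, σ ℓ ≠ none → σQ ℓ = σ ℓ)
    (horig : ∀ b ∈ Footprint D ΓQ ΘQ βQ σQ, L b.loc = none ∨
      ∃ q y r₀, Arg q y ∧ q.Ext r₀ ∧ r₀.Leaf D Γ ∧ Θ.Live r₀ ∧ lval β σ r₀ = some b)
    (IQ : Inv D L' ΓQ InQ ΘQ' βQ σ')
    (F : Frame D (Footprint D ΓQ ΘQ βQ σQ) (Footprint D ΓQ ΘQ' βQ σ') LQ L' σQ σ')
    (hend : ∀ q y, Arg q y → ΘQ' (.var y) = some Perm.RW) (hg : Good D Γ In Θ')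
    (hlive : ∀ r : Path, r.Leaf D Γ → (Θ'.Live r ↔ Θ.Live r ∨ ∃ q y, Arg q y ∧ q.Ext r)) :
    Inv D L' Γ In Θ' β σ' ∧
      Frame D (Footprint D Γ Θ β σ) (Footprint D Γ Θ' β σ') L L' σ σ' := by
  let Z : Path → Prop := fun z => ∃ q y, Arg q y ∧ q.Ext z
  have hZ : ∀ b τ, addrTy D L b = some (.access τ) → σ'.read b = σ.read b ∨
      ∃ z : Path, z.Leaf D Γ ∧ Θ.Live z ∧ Z z ∧ lval β σ z = some b := by
    intro b τ hb
    by_cases hF : b ∈ Footprint D ΓQ ΘQ βQ σQ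
    · rcases horig b hF with h | ⟨q, y, r₀, h1, h2, h3, h4, h5⟩
      · exact absurd h (addrTy_ne_none hb)
      · exact .inr ⟨r₀, h3, h4, ⟨q, y, h1, h2⟩, h5⟩
    · left
      rw [F.read b τ (addrTy_mono hle hb) hF, read_extend I.store hx hb]
  have hwt : ∀ q y, Arg q y → q.WellTyped D Γ := fun q y h =>
    let ⟨τ, h, _⟩ := hty q y h; ⟨τ, h⟩
  have harg : ∀ q y ad, Arg q y → lval β σ q = some ad → lval β σ' q = some ad := by
    intro q y ad h had
    rw [I.lval_eq hZ (hwt q y h) (fun s hs => ⟨.inl ?_, ?_⟩), had]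
    · exact I.good.up s q (hwt q y h) hs (hargl q y h)
    · rintro ⟨q', y', h', hqs⟩
      by_cases e : q = q'
      · subst e; exact Path.not_deref_ext_self hqs hs
      · exact hapart q q' y y' h h' e (.inr (hqs.trans ((Path.Ext.refl.deref).trans hs)))
  -- An accessible path is found below an argument, hence also below a parameter in the final
  -- state of the callee, or is not affected by the call.
  have key : ∀ (r : Path) (b : Addr), r.Leaf D Γ → (Θ'.Live r ∨ In r.root) →
      lval β σ' r = some b →
      (¬ Z r ∧ lval β σ r = some b ∧ (Θ.Live r ∨ In r.root)) ∨
      ∃ q y w, Arg q y ∧ r = q.app w ∧ ((Path.var y).app w).Leaf D ΓQ ∧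
        ΘQ'.Live ((Path.var y).app w) ∧ lval βQ σ' ((Path.var y).app w) = some b := by
    intro r b hr hlr hb
    by_cases hz : Z r
    · right
      obtain ⟨q, y, h, hqr⟩ := hz
      obtain ⟨w, rfl⟩ := hqr.exists_app
      obtain ⟨τ, h1, h2⟩ := hty q y h
      obtain ⟨ad, h3, h4⟩ := hbind q y h
      have hlf : ((Path.var y).app w).Leaf D ΓQ := hr.congr h1 h2
      refine ⟨q, y, w, h, rfl, hlf,
        .inr (IQ.good.rw_ext (hend q y h) (Path.ext_app _ _) hlf.wellTyped), ?_⟩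
      rw [lval_app, harg q y ad h h3] at hb
      rw [lval_app, ← hb]
      simp [lval, h4]
    · have hlr' : Θ.Live r ∨ In r.root :=
        hlr.imp_left fun h => ((hlive r hr).1 h).resolve_right hz
      refine .inl ⟨hz, ?_, hlr'⟩
      rw [← hb]
      refine (I.lval_eq hZ hr.wellTyped fun s hs => ⟨I.good.up_or hr.wellTyped hlr' hs, ?_⟩).symm
      rintro ⟨q, y, h, hqs⟩
      exact hz ⟨q, y, h, hqs.trans ((Path.Ext.refl.deref).trans hs)⟩
  have hfoot : ∀ {y : Ident} {w : List Sel} {b : Addr}, ((Path.var y).app w).Leaf D ΓQ →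
      ΘQ'.Live ((Path.var y).app w) → lval βQ σ' ((Path.var y).app w) = some b →
      L b.loc = none ∨
        ∃ q y r₀, Arg q y ∧ q.Ext r₀ ∧ r₀.Leaf D Γ ∧ Θ.Live r₀ ∧ lval β σ r₀ = some b := by
    intro y w b h1 h2 h3
    rcases F.foot b ⟨_, h1, h2, h3⟩ with h | h
    · exact horig b h
    · exact .inl (none_of_le hle h)
  -- Paths below the arguments and paths apart from them have different addresses.
  have hmix : ∀ {r : Path} {y : Ident} {w : List Sel} {b : Addr},
      r.Leaf D Γ → ¬ Z r → lval β σ r = some b → (Θ.Live r ∨ In r.root) →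
      ((Path.var y).app w).Leaf D ΓQ → ΘQ'.Live ((Path.var y).app w) →
      lval βQ σ' ((Path.var y).app w) = some b → False := by
    intro r y w b hr hz hb hlr h1 h2 h3
    rcases hfoot h1 h2 h3 with h | ⟨q', y', r₀, h4, h5, h6, h7, h8⟩
    · obtain ⟨τ', h9, -⟩ := hr
      exact addrTy_ne_none (lval_typed I.store I.bind h9 hb) h
    · have e := I.sep r₀ r h6 hr h7 hlr b h8 hb
      exact hz ⟨q', y', h4, e ▸ h5⟩
  refine ⟨⟨IQ.store, I.bind.mono (hle.trans F.le), hg,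
    fun r₁ r₂ hr₁ hr₂ hl₁ hl₂ b hb₁ hb₂ => ?_⟩, hle.trans F.le, fun b τ hb hF => ?_, ?_⟩
  · rcases key r₁ b hr₁ (.inl hl₁) hb₁ with ⟨hz₁, h1, h2⟩ | ⟨q, y, w, h, rfl, h1, h2, h3⟩
    · rcases key r₂ b hr₂ hl₂ hb₂ with ⟨hz₂, h4, h5⟩ | ⟨q', y', w', h', rfl, h4, h5, h6⟩
      · exact I.sep r₁ r₂ hr₁ hr₂ (h2.resolve_right (hg.not_in hr₁.wellTyped hl₁)) h5 b h1 h4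
      · exact (hmix hr₁ hz₁ h1 h2 h4 h5 h6).elim
    · rcases key r₂ b hr₂ hl₂ hb₂ with ⟨hz₂, h4, h5⟩ | ⟨q', y', w', h', rfl, h4, h5, h6⟩
      · exact (hmix hr₂ hz₂ h4 h5 h1 h2 h3).elim
      · have e := IQ.sep _ _ h1 h4 h2 (.inl h5) b h3 h6
        have hy : y = y' := by
          have := congrArg Path.root e
          rwa [Path.root_app, Path.root_app] at this
        subst hy
        rw [huniq q q' y h h', Path.app_inj e]
  · refine (hZ b τ hb).resolve_right ?_
    rintro ⟨z, h1, h2, -, h3⟩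
    exact hF ⟨z, h1, h2, h3⟩
  · rintro b ⟨r, hr, hlr, hb⟩
    rcases key r b hr (.inl hlr) hb with ⟨-, h1, h2⟩ | ⟨q, y, w, h, rfl, h1, h2, h3⟩
    · exact .inl ⟨r, hr, h2.resolve_right (hg.not_in hr.wellTyped hlr), h1⟩
    · rcases hfoot h1 h2 h3 with h | ⟨q', y', r₀, h4, h5, h6, h7, h8⟩
      · exact .inr h
      · exact .inl ⟨r₀, h6, h7, h8⟩

end

/-! ### The analysis preserves the invariant of policies -/

section
variable {prog : Program} {Γ : Ctx} {In : Ident → Prop}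

theorem move_good {D : List RecDecl} {e : Expr} {τ : Ty} {Θ Θ' : Policy} (h : Good D Γ In Θ)
    (he : HasType D Γ e τ) (hm : move D Γ e Θ Θ') : Good D Γ In Θ' := by
  cases hm with
  | shallow _ hc => cases hc.2; exact h
  | deepPath _ hm => cases he with | path hq => exact (move_path_good h ⟨_, hq⟩ hm).2.1
  | addrOf hm => cases he with | addrOf hq => exact (move_addr_good h ⟨_, hq⟩ hm).2.1
  | null => exact h

/-- The syntactic counterpart of the soundness theorem. It is needed for the branch of a
conditional that an evaluation does not take: the policy after the conditional depends on it. -/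
theorem SafeSeq.good {ss : List Stmt} {Θ Θ' : Policy} (hs : SafeSeq prog Γ Θ ss Θ') :
    (∀ s ∈ ss, StmtOK prog Γ s) → Good prog.records Γ In Θ → Good prog.records Γ In Θ' := by
  refine SafeSeq.rec
    (motive_1 := fun Θ s Θ' _ => StmtOK prog Γ s → Good prog.records Γ In Θ →
      Good prog.records Γ In Θ')
    (motive_2 := fun Θ ss Θ' _ => (∀ s ∈ ss, StmtOK prog Γ s) → Good prog.records Γ In Θ →
      Good prog.records Γ In Θ')
    ?_ ?_ ?_ ?_ ?_ ?_ ?_ hs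
  · rintro Θ p e Θ₁ Θ' hm ⟨_, ⟨hl, rfl⟩, hc⟩ hok h
    cases hok with
    | assign hp he =>
    exact (fresh_lift_good (move_good h he hm) ⟨_, hp⟩ (Policy.atLeast_WO.1 hl) hc).1
  · rintro Θ p τ Θ₁ Θ' ⟨hl, rfl⟩ hc hok h
    cases hok with
    | alloc hp =>
    exact (alloc_good h ⟨τ, by simp [Path.ty, hp]⟩ (Policy.atLeast_WO.1 hl) hc).1
  · intro Θ e s₁ s₂ Θ₁ Θ₂ Θ' _ _ _ hmeet ih₁ ih₂ hok h
    cases hok with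
    | ite _ hok₁ hok₂ => exact (meet_good (ih₁ hok₁ h) (ih₂ hok₂ h) hmeet).1
  · intro Θ e s Θ' _ _ _ _ _ h
    exact h
  · intro Θ Q args pr Θ₁ Θ₂ Θ₃ Θ' hpr h1 h2 h3 h4 hok h
    cases hok with
    | call hpr' hargs =>
    rw [hpr] at hpr'
    cases hpr'
    have A := args_safe hargs h1 h2 h3
    refine (chain_fresh_lift h (fun q hq => ?_) h4).1
    rw [List.mem_append, mem_refArgsOf, mem_refArgsOf] at hq
    rcases hq with ⟨ae, ha, hm, he⟩ | ⟨ae, ha, hm, he⟩ <;>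
      exact ⟨⟨_, (forall₂_zip hargs ae ha).path he⟩, A.ref ae ha (by rw [hm]; decide) q he⟩
  · intro Θ _ h
    exact h
  · intro Θ s ss Θ₁ Θ' _ _ ih₁ ih₂ hok h
    exact ih₂ (fun s hs => hok s (List.mem_cons_of_mem _ hs)) (ih₁ (hok s List.mem_cons_self) h)

end

/-! ### Soundness -/

section
variable {prog : Program}

/-- A visited sequence point at which the invariant holds for a policy computed there. -/
def VisitOK (prog : Program) (v : Visit) : Prop :=
  ∃ pr Θ In L, prog.proc? v.proc = some pr ∧ PolicyAt prog pr v.pos Θ ∧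
    Inv prog.records L pr.ctx In Θ v.bind v.store

/-- The policies computed inside `ss`, analysed from `Θ`, are those computed for the procedure
`pr` below its sequence point `c`. -/
def PoliciesFrom (prog : Program) (pr : Proc) (c : Pos) (Θ : Policy) (ss : List Stmt) : Prop :=
  ∀ c' Θ', PolicyIn prog pr.ctx Θ ss c' Θ' → PolicyAt prog pr (c ++ c') Θ'

/-- Soundness for one evaluation of the statements `ss` from `Θ` to `Θ'`. -/
def RunOK (prog : Program) (pr : Proc) (In : Ident → Prop) (L : STyping) (Θ Θ' : Policy)
    (β : Binding) (σ : Store) (T : List Visit) (σ' : Store) : Prop :=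
  (∀ v ∈ T, VisitOK prog v) ∧ ∃ L', Inv prog.records L' pr.ctx In Θ' β σ' ∧
    Frame prog.records (Footprint prog.records pr.ctx Θ β σ)
      (Footprint prog.records pr.ctx Θ' β σ') L L' σ σ'

theorem PoliciesFrom.sub {pr : Proc} {c : Pos} {Θ Θ₁ : Policy} {ss ss' : List Stmt} {d : Dir}
    (h : PoliciesFrom prog pr c Θ ss)
    (hd : ∀ c' Θ', PolicyIn prog pr.ctx Θ₁ ss' c' Θ' → PolicyIn prog pr.ctx Θ ss (d :: c') Θ') :
    PoliciesFrom prog pr (c ++ [d]) Θ₁ ss' := by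
  intro c' Θ' h'
  have := h _ _ (hd c' Θ' h')
  simpa using this

theorem PoliciesFrom.visit {pr : Proc} {c : Pos} {Θ : Policy} {ss : List Stmt} {P : Ident}
    {In : Ident → Prop} {L : STyping} {β : Binding} {σ : Store}
    (h : PoliciesFrom prog pr c Θ ss) (hP : prog.proc? P = some pr)
    (I : Inv prog.records L pr.ctx In Θ β σ) : VisitOK prog ⟨P, c, β, σ⟩ :=
  ⟨pr, Θ, In, L, hP, by simpa using h [] Θ .here, I⟩

theorem Program.mem_of_proc? {P : Ident} {pr : Proc} (h : prog.proc? P = some pr) :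
    pr ∈ prog.procs := List.mem_of_find?_eq_some h

/-- Soundness of a call, given soundness of the evaluation of the body. The caller's invariant is
transported to the start of the body by `call_entry` and back by `call_return`. -/
theorem call_ok (hwt : prog.WellTyped) (hsafe : prog.AliasSafe) {caller pr : Proc} {Q : Ident}
    {args : List Expr} {L : STyping} {In : Ident → Prop} {Θ Θ' : Policy} {β β₁ βQ : Binding}
    {σ σ₁ σQ σ' : Store} {T : List Visit} (hpr : prog.proc? Q = some pr)
    (hbp : BindParams β σ pr.params args β₁ σ₁)
    (hbl : BindLocals prog.records pr.locals β₁ σ₁ βQ σQ)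
    (ih : ∀ L In Θ Θ', (∀ s ∈ pr.body, StmtOK prog pr.ctx s) →
      SafeSeq prog pr.ctx Θ pr.body Θ' → Inv prog.records L pr.ctx In Θ βQ σQ →
      PoliciesFrom prog pr [] Θ pr.body → RunOK prog pr In L Θ Θ' βQ σQ T σ')
    (hok : StmtOK prog caller.ctx (.call Q args))
    (hs : SafeStmt prog caller.ctx Θ (.call Q args) Θ')
    (I : Inv prog.records L caller.ctx In Θ β σ) :
    RunOK prog caller In L Θ Θ' β σ T σ' := by
  have hmem := Program.mem_of_proc? hpr
  have hpok := hwt.2.2.1 pr hmem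
  obtain ⟨ΘQ, ΘQ', hinit, hbody, hend⟩ := hsafe pr hmem
  cases hok with
  | call hpr' hargs =>
  rw [hpr] at hpr'
  cases hpr'
  cases hs with
  | call hpr' h1 h2 h3 h4 =>
  rw [hpr] at hpr'
  cases hpr'
  have A := args_safe hargs h1 h2 h3
  obtain ⟨LQ, IQ, hle, hx, hB, horig⟩ := call_entry hwt.1 hpok I hargs A hbp hbl hinit
  obtain ⟨hT, L', IQ', F⟩ := ih LQ pr.IsInput ΘQ ΘQ' hpok.2.2.2 hbody IQ
    fun c' Θv h => ⟨ΘQ, hinit, h⟩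
  let Arg : Path → Ident → Prop := fun q y =>
    ∃ ae ∈ pr.params.zip args, ae.1.mode ≠ .input ∧ ae.2 = .path q ∧ ae.1.name = y
  have hrefs : ∀ q, q ∈ refArgsOf .inout pr.params args ++ refArgsOf .output pr.params args ↔
      ∃ y, Arg q y := by
    intro q
    rw [List.mem_append, mem_refArgsOf, mem_refArgsOf]
    constructor
    · rintro (⟨ae, ha, hm, he⟩ | ⟨ae, ha, hm, he⟩)
      · exact ⟨_, ae, ha, by rw [hm]; decide, he, rfl⟩
      · exact ⟨_, ae, ha, by rw [hm]; decide, he, rfl⟩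
    · rintro ⟨y, ae, ha, hm, he, -⟩
      rcases hm' : ae.1.mode with _ | _ | _
      · exact absurd hm' hm
      · exact .inl ⟨ae, ha, hm', he⟩
      · exact .inr ⟨ae, ha, hm', he⟩
  have hty : ∀ q y, Arg q y → ∃ τ, q.ty prog.records caller.ctx = some τ ∧ pr.ctx y = some τ := by
    rintro q y ⟨ae, ha, -, he, rfl⟩
    exact ⟨_, (forall₂_zip hargs ae ha).path he, hpok.ctx_param (List.of_mem_zip ha).1⟩
  have hargl : ∀ q y, Arg q y → Θ.Live q := by
    rintro q y ⟨ae, ha, hm, he, -⟩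
    exact A.ref ae ha hm q he
  obtain ⟨hg, hlive⟩ := chain_fresh_lift I.good (fun q hq => by
    obtain ⟨y, hy⟩ := (hrefs q).1 hq
    obtain ⟨τ, h, -⟩ := hty q y hy
    exact ⟨⟨τ, h⟩, hargl q y hy⟩) h4
  -- Parameters with the same name are one parameter, with one argument.
  have hsame : ∀ ae ∈ pr.params.zip args, ∀ be ∈ pr.params.zip args, ae.1.mode ≠ .input →
      be.1.mode ≠ .input → ae.1.name = be.1.name → ∀ q q', ae.2 = .path q → be.2 = .path q' →
      q = q' := by
    intro ae ha be hb hma hmb hn q q' hq hq'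
    obtain ⟨q₁, ad, e1, h5, h6⟩ := (hB ae ha).2 hma
    obtain ⟨q₂, ad', e2, h7, h8⟩ := (hB be hb).2 hmb
    rw [hq] at e1
    cases e1
    rw [hq'] at e2
    cases e2
    by_contra hne
    have hne' : ae ≠ be := by
      rintro rfl
      rw [hq] at hq'
      cases hq'
      exact hne rfl
    -- Both arguments have the address that is bound to the parameter, and both are writable, so
    -- that the CREW condition of the caller identifies them.
    rw [hn, h8] at h6
    cases h6
    obtain ⟨τ, l1, -⟩ := hty q _ ⟨ae, ha, hma, hq, rfl⟩
    obtain ⟨τ', l2, -⟩ := hty q' _ ⟨be, hb, hmb, hq', rfl⟩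
    have hno := I.crew hwt.1 q q' hne ⟨τ, l1⟩ ⟨τ', l2⟩ _ h5 h7
      (Policy.atLeast_WO.2 (A.ref ae ha hma q hq))
    exact Policy.not_live_of_NO hno (A.ref be hb hmb q' hq')
  obtain ⟨I', F'⟩ := call_return (Arg := Arg) I
    (by
      rintro q q' y ⟨ae, ha, hma, hq, rfl⟩ ⟨be, hb, hmb, hq', hn⟩
      exact hsame ae ha be hb hma hmb hn.symm q q' hq hq')
    (by
      rintro q q' y y' ⟨ae, ha, hma, hq, -⟩ ⟨be, hb, hmb, hq', -⟩ hne
      refine A.apart ae ha be hb ?_ hma hmb q q' hq hq'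
      rintro rfl
      rw [hq] at hq'
      cases hq'
      exact hne rfl)
    hargl hty
    (by
      rintro q y ⟨ae, ha, hm, he, rfl⟩
      obtain ⟨q', ad, h5, h6, h7⟩ := (hB ae ha).2 hm
      rw [he] at h5
      cases h5
      exact ⟨ad, h6, h7⟩)
    hle hx
    (by
      rintro b ⟨r, hr, hlr, hb⟩
      rcases horig r b hr (.inl hlr) hb with ⟨-, h, -⟩ | ⟨ae, ha, hn, q, r₀, hqr, hr₀, hv, ho⟩
      · exact .inl h
      · right
        have hm : ae.1.mode ≠ .input := by
          intro hm
          exact IQ.good.not_in hr.wellTyped hlr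
            ((hinit.param hpok hr.wellTyped (List.of_mem_zip ha).1 hn).1.2 hm)
        obtain ⟨-, he, hl, -⟩ := ho.resolve_right fun h => hm h.1
        exact ⟨q, _, r₀, ⟨ae, ha, hm, he, rfl⟩, hqr, hr₀, hl, hv⟩)
    IQ' F
    (by
      rintro q y ⟨ae, ha, hm, he, rfl⟩
      have hp := (List.of_mem_zip ha).1
      apply hend
      rw [List.mem_append, Proc.mem_paramPaths, Proc.mem_paramPaths]
      rcases hm' : ae.1.mode with _ | _ | _
      · exact absurd hm' hm
      · exact .inl ⟨ae.1, hp, hm', rfl⟩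
      · exact .inr ⟨ae.1, hp, hm', rfl⟩)
    hg
    (by
      intro r hr
      rw [hlive r hr]
      constructor
      · rintro (h | ⟨q, hq, hqr⟩)
        · exact .inl h
        · obtain ⟨y, hy⟩ := (hrefs q).1 hq
          exact .inr ⟨q, y, hy, hqr⟩
      · rintro (h | ⟨q, y, hy, hqr⟩)
        · exact .inl h
        · exact .inr ⟨q, (hrefs q).2 ⟨y, hy⟩, hqr⟩)
  exact ⟨hT, L', I', F'⟩

/-- Every evaluation of an alias-safe sequence of statements preserves the invariant and
passes through good visits only. -/
theorem evalSeq_ok (hwt : prog.WellTyped) (hsafe : prog.AliasSafe) {P : Ident} {c : Pos}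
    {β : Binding} {σ : Store} {ss : List Stmt} {T : List Visit} {σ' : Store}
    (h : EvalSeq prog P c β σ ss T σ') {pr : Proc} (hP : prog.proc? P = some pr) :
    ∀ L In Θ Θ', (∀ s ∈ ss, StmtOK prog pr.ctx s) → SafeSeq prog pr.ctx Θ ss Θ' →
      Inv prog.records L pr.ctx In Θ β σ → PoliciesFrom prog pr c Θ ss →
      RunOK prog pr In L Θ Θ' β σ T σ' := by
  revert pr
  refine EvalSeq.rec
    (motive_1 := fun P c β σ s T σ' _ => ∀ {pr : Proc}, prog.proc? P = some pr →
      ∀ L In Θ Θ' ss, StmtOK prog pr.ctx s → SafeStmt prog pr.ctx Θ s Θ' →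
        Inv prog.records L pr.ctx In Θ β σ → PoliciesFrom prog pr c Θ (s :: ss) →
        RunOK prog pr In L Θ Θ' β σ T σ')
    (motive_2 := fun P c β σ ss T σ' _ => ∀ {pr : Proc}, prog.proc? P = some pr →
      ∀ L In Θ Θ', (∀ s ∈ ss, StmtOK prog pr.ctx s) → SafeSeq prog pr.ctx Θ ss Θ' →
        Inv prog.records L pr.ctx In Θ β σ → PoliciesFrom prog pr c Θ ss →
        RunOK prog pr In L Θ Θ' β σ T σ')
    ?_ ?_ ?_ ?_ ?_ ?_ ?_ ?_ ?_ h
  · intro P c β σ p e v a σ' hv ha hw pr hP L In Θ Θ' ss hok hs I _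
    cases hok with
    | assign hp he =>
    cases hs with
    | assign hm hc =>
    obtain ⟨I', F⟩ := stmt_assign_inv I hp he hm hc hv ha hw
    exact ⟨by simp, L, I', F⟩
  · intro P c β σ p τ ℓ a σ' hℓ ha hw pr hP L In Θ Θ' ss hok hs I _
    cases hok with
    | alloc hp =>
    cases hs with
    | alloc hc hm =>
    obtain ⟨hl, rfl⟩ := hc
    have hl := Policy.atLeast_WO.1 hl
    obtain ⟨hg, hlive⟩ := alloc_good I.good ⟨τ, by simp [Path.ty, hp]⟩ hl hm
    obtain ⟨L', I', F⟩ := alloc_inv hwt.1 I hp hl hg hlive hℓ ha hw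
    exact ⟨by simp, L', I', F⟩
  · intro P c β σ e s₁ s₂ T σ' _ _ ih pr hP L In Θ Θ' ss hok hs I hK
    cases hok with
    | ite _ hok₁ hok₂ =>
    cases hs with
    | ite _ hs₁ hs₂ hmeet =>
    obtain ⟨hT, L', I', F⟩ := ih hP L In _ _ hok₁ hs₁ I (hK.sub fun _ _ h => .thenBranch h)
    obtain ⟨hg, hlive⟩ := meet_good I'.good (hs₂.good hok₂ I.good) hmeet
    exact ⟨hT, L', I'.weaken hg fun r hr h => ((hlive r hr.wellTyped).1 h).1,
      F.trans (.of_subset (footprint_subset fun r hr h => ((hlive r hr.wellTyped).1 h).1))⟩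
  · intro P c β σ e s₁ s₂ T σ' _ _ ih pr hP L In Θ Θ' ss hok hs I hK
    cases hok with
    | ite _ hok₁ hok₂ =>
    cases hs with
    | ite _ hs₁ hs₂ hmeet =>
    obtain ⟨hT, L', I', F⟩ := ih hP L In _ _ hok₂ hs₂ I (hK.sub fun _ _ h => .elseBranch h)
    obtain ⟨hg, hlive⟩ := meet_good (hs₁.good hok₁ I.good) I'.good hmeet
    exact ⟨hT, L', I'.weaken hg fun r hr h => ((hlive r hr.wellTyped).1 h).2,
      F.trans (.of_subset (footprint_subset fun r hr h => ((hlive r hr.wellTyped).1 h).2))⟩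
  · intro P c β σ e s T₁ σ₁ T₂ σ' _ _ _ ih₁ ih₂ pr hP L In Θ Θ' ss hok hs I hK
    have hok' := hok
    have hs' := hs
    cases hok with
    | loop _ hokb =>
    cases hs with
    | @loop _ _ _ Θb _ hsb hmono =>
    obtain ⟨hT₁, L₁, I₁, F₁⟩ := ih₁ hP L In _ _ hokb hsb I (hK.sub fun _ _ h => .loopBody h)
    have hlive : ∀ r : Path, Θ.Live r → Policy.Live Θb r := by
      intro r hr
      obtain ⟨π, h1, h2⟩ := Policy.atLeast_WO.2 hr
      obtain ⟨π', h3, h4⟩ := hmono r π h1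
      exact Policy.atLeast_WO.1 ⟨π', h3, h2.trans h4⟩
    have I₂ := I₁.weaken I.good fun r _ h => hlive r h
    obtain ⟨hT₂, L₂, I₃, F₂⟩ := ih₂ hP L₁ In Θ Θ ss hok' hs' I₂ hK
    refine ⟨fun v hv => ?_, L₂, I₃,
      (F₁.trans (.of_subset (footprint_subset fun r _ h => hlive r h))).trans F₂⟩
    rcases List.mem_append.1 hv with hv | hv
    · exact hT₁ v hv
    · rcases List.mem_cons.1 hv with rfl | hv
      · exact hK.visit hP I₂
      · exact hT₂ v hv
  · intro P c β σ e s _ pr hP L In Θ Θ' ss hok hs I hK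
    cases hs with
    | loop _ _ _ =>
    exact ⟨by simp, L, I, .of_subset (le_refl _)⟩
  · intro P c β σ Q args pr₁ β₁ σ₁ βQ σQ T σ' hpr hbp hbl _ ih pr hP L In Θ Θ' ss hok hs I hK
    exact call_ok hwt hsafe hpr hbp hbl (ih hpr) hok hs I
  · intro P c β σ pr hP L In Θ Θ' hok hs I hK
    cases hs with
    | nil =>
    refine ⟨fun v hv => ?_, L, I, .of_subset (le_refl _)⟩
    rw [List.mem_singleton] at hv
    subst hv
    exact hK.visit hP I
  · intro P c β σ s ss T₁ σ₁ T₂ σ' _ _ ih₁ ih₂ pr hP L In Θ Θ' hok hs I hK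
    cases hs with
    | cons hs₁ hs₂ =>
    obtain ⟨hT₁, L₁, I₁, F₁⟩ := ih₁ hP L In _ _ ss (hok s List.mem_cons_self) hs₁ I hK
    obtain ⟨hT₂, L₂, I₂, F₂⟩ := ih₂ hP L₁ In _ _ (fun s hs => hok s (List.mem_cons_of_mem _ hs))
      hs₂ I₁ (hK.sub fun _ _ h => .next hs₁ h)
    refine ⟨fun v hv => ?_, L₂, I₂, F₁.trans F₂⟩
    rcases List.mem_append.1 hv with hv | hv
    · rcases List.mem_cons.1 hv with rfl | hv
      · exact hK.visit hP I
      · exact hT₁ v hv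
    · exact hT₂ v hv

/-- The invariant holds for the empty context and the empty store. -/
theorem Inv.empty (D : List RecDecl) :
    Inv D (fun _ => none) (fun _ => none) (fun _ => False) (fun _ => none) (fun _ => none)
      (fun _ => none) := by
  have hno : ∀ p : Path, ¬ p.WellTyped D (fun _ => none) := by
    intro p hp
    obtain ⟨τ, hτ⟩ := hp.of_ext p.root_ext
    cases hτ
  exact ⟨⟨fun _ => by simp, fun _ _ _ h => (nomatch h)⟩, fun _ _ h => (nomatch h),
    ⟨fun p hp => (hno p hp).elim, fun p hp => (hno p hp).elim, fun p s hp => (hno _ hp).elim,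
      fun p f hp => (hno _ hp).elim, fun s r hr => (hno r hr).elim⟩,
    fun p q hp => (hno p hp.wellTyped).elim⟩

/-- Every sequence point reached by a terminating program is visited in a state with the invariant.
-/
theorem terminates_ok (hwt : prog.WellTyped) (hsafe : prog.AliasSafe) {T : List Visit}
    {σ' : Store} (h : prog.Terminates T σ') : ∀ v ∈ T, VisitOK prog v := by
  obtain ⟨pr, β, σ, hpr, hnil, hbl, heval⟩ := h
  have hmem := Program.mem_of_proc? hpr
  have hpok := hwt.2.2.1 pr hmem
  obtain ⟨Θ, Θ', hinit, hbody, -⟩ := hsafe pr hmem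
  -- The start of the program is a call without arguments from the empty state.
  have hbp : BindParams (fun _ => none) (fun _ => none) pr.params [] (fun _ => none)
      (fun _ => none) := by rw [hnil]; exact .nil
  obtain ⟨L, I, -⟩ := call_entry hwt.1 hpok (Inv.empty prog.records) (args := [])
    (by rw [hnil]; exact .nil)
    (by rw [hnil]; constructor <;> intro ae hae <;> exact nomatch hae) hbp hbl hinit
  exact (evalSeq_ok hwt hsafe heval hpr L _ Θ Θ' hpok.2.2.2 hbody I
    fun c' Θv h => ⟨Θ, hinit, h⟩).1

end

end MuSpark


theorem mainTheorem1 (prog : MuSpark.Program)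
    (hwt : prog.WellTyped) (hsafe : prog.AliasSafe)
    (T : List MuSpark.Visit) (σ' : MuSpark.Store) (hrun : prog.Terminates T σ') :
    ∀ v ∈ T, ∃ pr, prog.proc? v.proc = some pr ∧
      (∃ Θ, MuSpark.PolicyAt prog pr v.pos Θ) ∧
      ∀ Θ, MuSpark.PolicyAt prog pr v.pos Θ →
        Θ.Consistent prog.records pr.ctx ∧
        MuSpark.CREW prog.records pr.ctx Θ v.bind v.store := by
  intro v hv
  obtain ⟨pr, Θ, In, L, hpr, hΘ, I⟩ := MuSpark.terminates_ok hwt hsafe hrun v hv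
  refine ⟨pr, hpr, ⟨Θ, hΘ⟩, fun Θ' hΘ' => ?_⟩
  cases hΘ.det hΘ'
  exact ⟨I.good.consistent, I.crew hwt.1⟩
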